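/- Let $s:[0,1]\to\mathbb{R}$ be $C$-Lipschitz, let $X$ be a random variable in $[0,1]$ with a continuous density $\mu$ such that $\mu>0$ on $[0,1]$, and let $Y=s(X)+\varepsilon$, where $\varepsilon$ is independent of $X$, $\mathbb{E}[\varepsilon]=0$ and $\operatorname{Var}(\varepsilon)=\sigma^2<\infty$. For each $n$ let $(X_1,Y_1),\dots,(X_n,Y_n)$ be i.i.d. copies of $(X,Y)$, independent of $(X,Y)$, and let $\mathbb{U}^1,\dots,\mathbb{U}^q$, with $\mathbb{U}^l=(U^l_1,\dots,U^l_k)$, be vectors of i.i.d. uniform variables on $[0,1]$, independent of each other and of all the observations; here $k=k(n)$ and $q=q(n)$ are natural numbers. For $u\in[0,1]^k$ with ordered values $u_{(1)}\le\dots\le u_{(k)}$, $u_{(0)}=0$, $u_{(k+1)}=1$, put $$\hat s_u(x)=\sum_{j=0}^k\hat\beta_j\mathbf 1_{u_{(j)}<x\le u_{(j+1)}},\qquad \tilde s_u(x)=\sum_{j=0}^k\beta_j\mathbf 1_{u_{(j)}<x\le u_{(j+1)}},$$ where $\hat\beta_j$ is the mean of those $Y_i$ with $u_{(j)}<X_i\le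 u_{(j+1)}$ ($\hat\beta_j=0$ if there are none), and $\beta_j=\mathbb{E}[Y\mid u_{(j)}<X\le u_{(j+1)}]$. Each $\hat s_{\mathbb{U}^l}$ is a purely uniformly random tree. The purely uniformly random forest (PURF) and its population version are $$\hat s=\frac1q\sum_{l=1}^q\hat s_{\mathbb{U}^l},\qquad \tilde s=\frac1q\sum_{l=1}^q\tilde s_{\mathbb{U}^l}.$$ **Theorem.** Suppose that $k\to\infty$, $k/n\to0$ and $q\to\infty$ as $n\to\infty$. Then the variance term of the forest is finite and satisfies $$\mathbb{E}\big[(\hat s(X)-\tilde s(X))^2\big]\le\frac34\,\frac{\sigma^2(k+1)}{n}+o\!\left(\frac kn\right)\qquad(n\to\infty).$$ The leading term is three fourths of the variance term of a single tree: for every $l$, the latter is finite and $$\mathbb{E}\big[(\hat s_{\mathbb{U}^l}(X)-\tilde s_{\mathbb{U}^l}(X))^2\big]=\frac{\sigma^2(k+1)}{n}+o\!\left(\frac kn\right)\qquad(n\to\infty),$$ with the same error term for every $l\in\{1,\dots,q\}$. -/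

import Mathlib

open MeasureTheory ProbabilityTheory Filter Set Topology Asymptotics
open scoped NNReal ENNReal

noncomputable section

namespace PURF

/-- The order statistics of `u = (u₁, …, u_k)`, completed by `u_(0) = 0` and `u_(k+1) = 1`. -/
def orderStat {k : ℕ} (u : Fin k → ℝ) (j : ℕ) : ℝ :=
  if j = 0 then 0 else if h : j - 1 < k then u (Tuple.sort u ⟨j - 1, h⟩) else 1

/-- The `j`-th cell `(u_(j), u_(j+1)]` of the partition given by `u`, for `j = 0, …, k`. -/
def cell {k : ℕ} (u : Fin k → ℝ) (j : ℕ) : Set ℝ :=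
  Ioc (orderStat u j) (orderStat u (j + 1))

open Classical in
/-- The average of the `y i` over the indices with `x i ∈ A`. If there is no such index, the
value is `0 / 0 = 0`, which is the convention for empty cells. -/
def cellAverage {n : ℕ} (x y : Fin n → ℝ) (A : Set ℝ) : ℝ :=
  (∑ i with x i ∈ A, y i) / (Finset.card {i | x i ∈ A} : ℝ)

/-- The tree (regressogram) built from the learning set `(x i, y i)` on the partition given by
`u`, evaluated at `t`. -/
def treeEst {n k : ℕ} (x y : Fin n → ℝ) (u : Fin k → ℝ) (t : ℝ) : ℝ :=
  ∑ j ∈ Finset.range (k + 1), (cell u j).indicator (fun _ => cellAverage x y (cell u j)) t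

/-- The forest built from `q` partitions: the average of its `q` trees. -/
def forestEst {n k q : ℕ} (x y : Fin n → ℝ) (v : Fin q → Fin k → ℝ) (t : ℝ) : ℝ :=
  (1 / (q : ℝ)) * ∑ l, treeEst x y (v l) t

section Population

variable {Ω : Type*} [MeasurableSpace Ω]

/-- The conditional expectation `E[Y | X ∈ A]` given the event `X ∈ A`. -/
def cellMean (P : Measure Ω) (X Y : Ω → ℝ) (A : Set ℝ) : ℝ :=
  ∫ ω, Y ω ∂(ProbabilityTheory.cond P (X ⁻¹' A))

/-- The best approximation of the regression function by a regressogram on the partition given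
by `u`, evaluated at `t`. -/
def treeProj (P : Measure Ω) (X Y : Ω → ℝ) {k : ℕ} (u : Fin k → ℝ) (t : ℝ) : ℝ :=
  ∑ j ∈ Finset.range (k + 1), (cell u j).indicator (fun _ => cellMean P X Y (cell u j)) t

/-- The average of the best approximations on `q` partitions. -/
def forestProj (P : Measure Ω) (X Y : Ω → ℝ) {k q : ℕ} (v : Fin q → Fin k → ℝ) (t : ℝ) : ℝ :=
  (1 / (q : ℝ)) * ∑ l, treeProj P X Y (v l) t

/-- The random variables of the model, on the probability space `(Ω, P)`: the observations
with index `some i`, `i : Fin n`, are the learning set, the observation with index `none` is the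
generic one. The design points have density `dens` on `[0,1]`, the errors have law `ν`, the
`U l j` are uniform on `[0,1]`, and all these variables are independent. -/
structure Model (P : Measure Ω) (dens : ℝ → ℝ) (ν : Measure ℝ) (n k q : ℕ) where
  X : Option (Fin n) → Ω → ℝ
  ε : Option (Fin n) → Ω → ℝ
  U : Fin q → Fin k → Ω → ℝ
  measurable_X : ∀ i, Measurable (X i)
  measurable_ε : ∀ i, Measurable (ε i)
  measurable_U : ∀ l j, Measurable (U l j)
  law_X : ∀ i, P.map (X i) =
    (volume.restrict (Icc (0 : ℝ) 1)).withDensity (fun x => ENNReal.ofReal (dens x))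
  law_ε : ∀ i, P.map (ε i) = ν
  law_U : ∀ l j, P.map (U l j) = volume.restrict (Icc (0 : ℝ) 1)
  indep : iIndepFun (Sum.elim X (Sum.elim ε (fun p : Fin q × Fin k => U p.1 p.2))) P

namespace Model

variable {P : Measure Ω} {dens : ℝ → ℝ} {ν : Measure ℝ} {n k q : ℕ}

/-- The responses `Y = s(X) + ε`. -/
def Y (M : Model P dens ν n k q) (s : ℝ → ℝ) (i : Option (Fin n)) (ω : Ω) : ℝ :=
  s (M.X i ω) + M.ε i ω

/-- The difference of the tree on the `l`-th partition and of its population version, at the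
generic design point. -/
def treeDev (M : Model P dens ν n k q) (s : ℝ → ℝ) (l : Fin q) (ω : Ω) : ℝ :=
  treeEst (fun i => M.X (some i) ω) (fun i => M.Y s (some i) ω) (fun j => M.U l j ω) (M.X none ω)
    - treeProj P (M.X none) (M.Y s none) (fun j => M.U l j ω) (M.X none ω)

/-- The difference of the forest and of its population version, at the generic design point. -/
def forestDev (M : Model P dens ν n k q) (s : ℝ → ℝ) (ω : Ω) : ℝ :=
  forestEst (fun i => M.X (some i) ω) (fun i => M.Y s (some i) ω)
      (fun l j => M.U l j ω) (M.X none ω)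
    - forestProj P (M.X none) (M.Y s none) (fun l j => M.U l j ω) (M.X none ω)

/-- The variance term of the tree on the `l`-th partition. -/
def treeVar (M : Model P dens ν n k q) (s : ℝ → ℝ) (l : Fin q) : ℝ :=
  ∫ ω, (M.treeDev s l ω) ^ 2 ∂P

/-- The variance term of the forest. -/
def forestVar (M : Model P dens ν n k q) (s : ℝ → ℝ) : ℝ :=
  ∫ ω, (M.forestDev s ω) ^ 2 ∂P

end Model

end Population

end PURF

end

/-! Condition on the partitions. A tree minus its population version is a linear form in the errors
plus the error it would make with noiseless responses (`treeEst_sub_eq_deviation`). Expanding the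
square of the average of `q` exchangeable trees gives V/q + (1 - 1/q) W, where V is the mean of
`condCov` for one partition used twice and W its mean for two independent partitions
(`Model.forestVar_eq`). V is the variance term of a single tree, and since `q → ∞` only W matters
for the forest.

By `condCov_eq`, `condCov` is σ² times `noiseCov` plus the mean product of the two noiseless errors.
An observation is weighted by a cell A of the first and a cell B of the second partition only if it
and the generic point both lie in A ∩ B. The noise part is therefore the sum of n μ(A ∩ B)² E[1/((1
+ N_A)(1 + N_B))], where the N count the other n - 1 points. Inverse moments of such counts
(`invSq_le`, `le_invSq`) bound n times this by the sum of μ(A ∩ B)²/(μ(A) μ(B)), up to errors 4/(1 +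
n μ(A)), with a matching lower bound when the partitions coincide. Because `k/n → 0`, cells with few
observations are rare and these errors add up to o(k) in mean (`tendsto_integral_smallCells_div`).
The noiseless errors are also negligible: s is Lipschitz, and empty cells are covered by the same
bound. For equal partitions the sum has k + 1 diagonal terms equal to 1, which gives the claim on a
single tree.

For independent partitions the factor 3/4 comes from geometry. The density is almost constant on
short cells, so μ can be replaced by Lebesgue measure there, while long cells and the two boundary
cells contribute a bounded amount (`sum_overlapProb_le_interiorOverlap`). The sum of |A ∩ B|²/(|A|
|B|) is the integral over (x, y) of K_u K_v, where K_u(x, y) is 1/|A| if x and y share the interior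
cell A and 0 if they share none. By independence its mean is the integral of (E K)². Moreover E K(x,
y) ≤ g(|x - y|) with g = `spacingProfile`, which satisfies g(d) ≤ k exp(-kd) and has integral 1/2
over [0,1]. These two facts alone give 2 ∫ g² ≤ 3k/4 (`integral_spacingProfile_sq_le`). -/

namespace PURF

/-! ### Order statistics, cells and their lengths -/

section OrderStat

variable {k : ℕ}

/-- Ties are broken by the index, so finitely many comparisons of coordinates decide which
permutation sorts `u`. Order statistics are then measurable as finite sums over permutations. -/
theorem measurableSet_sort_eq (τ : Equiv.Perm (Fin k)) :
    MeasurableSet {u : Fin k → ℝ | Tuple.sort u = τ} := by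
  have : {u : Fin k → ℝ | Tuple.sort u = τ} =
      (⋂ i, ⋂ j, ⋂ (_ : i ≤ j), {u | u (τ i) ≤ u (τ j)}) ∩
        ⋂ i, ⋂ j, ⋂ (_ : i < j), ({u | u (τ i) = u (τ j)}ᶜ ∪ {_u | τ i < τ j}) := by
    ext u
    simp only [mem_ofPred_eq, eq_comm (a := Tuple.sort u), Tuple.eq_sort_iff, mem_inter_iff,
      mem_iInter, mem_union, mem_compl_iff, ← imp_iff_not_or]
    rfl
  rw [this]
  refine MeasurableSet.inter ?_ ?_
  · exact .iInter fun i => .iInter fun j => .iInter fun _ =>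
      measurableSet_le (measurable_pi_apply _) (measurable_pi_apply _)
  · exact .iInter fun i => .iInter fun j => .iInter fun _ =>
      (measurableSet_eq_fun (measurable_pi_apply (τ i)) (measurable_pi_apply (τ j))).compl.union
        (.const (τ i < τ j))

theorem measurable_orderStat (j : ℕ) :
    Measurable fun u : Fin k → ℝ => orderStat u j := by
  unfold orderStat
  split_ifs with h0 h
  · exact measurable_const
  · have : (fun u : Fin k → ℝ => u (Tuple.sort u ⟨j - 1, h⟩)) = fun u =>
        ∑ τ : Equiv.Perm (Fin k), {u : Fin k → ℝ | Tuple.sort u = τ}.indicator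
          (fun u => u (τ ⟨j - 1, h⟩)) u := by
      ext u
      rw [Finset.sum_eq_single (Tuple.sort u)]
      · simp [indicator]
      · intro τ _ hτ
        simp [indicator, Ne.symm hτ]
      · simp
    rw [this]
    exact Finset.measurable_sum _ fun τ _ =>
      (measurable_pi_apply _).indicator (measurableSet_sort_eq τ)
  · exact measurable_const

@[simp] theorem orderStat_zero (u : Fin k → ℝ) : orderStat u 0 = 0 := by simp [orderStat]

theorem orderStat_of_lt (u : Fin k → ℝ) {i : ℕ} (h : i < k) :
    orderStat u (i + 1) = u (Tuple.sort u ⟨i, h⟩) := by simp [orderStat, h]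

theorem orderStat_of_le (u : Fin k → ℝ) {i : ℕ} (h : k ≤ i) : orderStat u (i + 1) = 1 := by
  simp [orderStat, h]

theorem orderStat_mem {u : Fin k → ℝ} (hu : ∀ i, u i ∈ Icc (0 : ℝ) 1) (j : ℕ) :
    orderStat u j ∈ Icc (0 : ℝ) 1 := by
  unfold orderStat
  split_ifs
  · simp
  · exact hu _
  · simp

theorem monotone_orderStat {u : Fin k → ℝ} (hu : ∀ i, u i ∈ Icc (0 : ℝ) 1) :
    Monotone (orderStat u) := by
  refine monotone_nat_of_le_succ fun j => ?_
  rcases j with _ | i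
  · simpa using (orderStat_mem hu 1).1
  · by_cases h : i + 1 < k
    · rw [orderStat_of_lt u h, orderStat_of_lt u (Nat.lt_of_succ_lt h)]
      exact Tuple.monotone_sort u (by simp [Fin.le_def])
    · rw [orderStat_of_le u (not_lt.mp h)]
      exact (orderStat_mem hu _).2

theorem measurableSet_cell (u : Fin k → ℝ) (j : ℕ) : MeasurableSet (cell u j) :=
  measurableSet_Ioc

theorem disjoint_cell {u : Fin k → ℝ} (hu : ∀ i, u i ∈ Icc (0 : ℝ) 1) :
    Pairwise (Function.onFun Disjoint (cell u)) :=
  (monotone_orderStat hu).pairwise_disjoint_on_Ioc_succ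

theorem cell_subset {u : Fin k → ℝ} (hu : ∀ i, u i ∈ Icc (0 : ℝ) 1) (j : ℕ) :
    cell u j ⊆ Icc 0 1 := fun _ hx =>
  ⟨(orderStat_mem hu j).1.trans hx.1.le, hx.2.trans (orderStat_mem hu (j + 1)).2⟩

/-- The length of the `j`-th cell. -/
noncomputable def cellLength (u : Fin k → ℝ) (j : ℕ) : ℝ := orderStat u (j + 1) - orderStat u j

theorem cellLength_nonneg {u : Fin k → ℝ} (hu : ∀ i, u i ∈ Icc (0 : ℝ) 1) (j : ℕ) :
    0 ≤ cellLength u j := sub_nonneg.mpr (monotone_orderStat hu j.le_succ)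

theorem sum_cellLength (u : Fin k → ℝ) :
    ∑ j ∈ Finset.range (k + 1), cellLength u j = 1 := by
  unfold cellLength
  rw [Finset.sum_range_sub, orderStat_of_le u le_rfl, orderStat_zero, sub_zero]

theorem cellLength_le_one {u : Fin k → ℝ} (hu : ∀ i, u i ∈ Icc (0 : ℝ) 1) (j : ℕ) :
    cellLength u j ≤ 1 := by
  have h1 := (orderStat_mem hu (j + 1)).2
  have h2 := (orderStat_mem hu j).1
  unfold cellLength
  linarith

theorem measurable_cellLength (j : ℕ) : Measurable fun u : Fin k → ℝ => cellLength u j :=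
  (measurable_orderStat _).sub (measurable_orderStat _)

/-- An interior cell contains no point of the partition in its interior. -/
theorem not_mem_Ioo_orderStat (u : Fin k → ℝ) {i : ℕ} (h : i + 1 < k) (t : Fin k) :
    u t ∉ Ioo (orderStat u (i + 1)) (orderStat u (i + 2)) := by
  rw [orderStat_of_lt u h, orderStat_of_lt u (Nat.lt_of_succ_lt h)]
  rintro ⟨h1, h2⟩
  obtain ⟨t', rfl⟩ := (Tuple.sort u).surjective t
  have hm := Tuple.monotone_sort u
  have h3 : (⟨i, Nat.lt_of_succ_lt h⟩ : Fin k) < t' := by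
    by_contra hc
    exact absurd (hm (not_lt.mp hc)) (not_le.mpr h1)
  have h4 : t' < (⟨i + 1, h⟩ : Fin k) := by
    by_contra hc
    exact absurd (hm (not_lt.mp hc)) (not_le.mpr h2)
  simp only [Fin.lt_def] at h3 h4
  omega

/-- A sum over the interior cells is at most the sum over the pairs of points that are the
endpoints of an interval without a further point inside. -/
theorem sum_interior_le (u : Fin k → ℝ) (hu : ∀ i, u i ∈ Icc (0 : ℝ) 1)
    {R : Type*} [AddCommMonoid R] [PartialOrder R] [IsOrderedAddMonoid R]
    (F : ℝ → ℝ → R) (G : Fin k → Fin k → R)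
    (hG0 : ∀ a b, 0 ≤ G a b)
    (hG : ∀ a b, a ≠ b → u a ≤ u b → (∀ t, u t ∉ Ioo (u a) (u b)) → F (u a) (u b) ≤ G a b) :
    ∑ i ∈ Finset.range (k - 1), F (orderStat u (i + 1)) (orderStat u (i + 2)) ≤
      ∑ a, ∑ b ∈ Finset.univ.erase a, G a b := by
  rw [Finset.sum_sigma']
  have key : ∀ i : Fin (k - 1), (i : ℕ) + 1 < k := fun i => by have := i.2; omega
  -- A cell is recorded by the indices of its two endpoints. Sorting is a permutation, so distinct
  -- cells give distinct pairs, even if some points coincide.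
  let e : Fin (k - 1) → (Σ _ : Fin k, Fin k) := fun i =>
    ⟨Tuple.sort u ⟨i, Nat.lt_of_succ_lt (key i)⟩, Tuple.sort u ⟨i + 1, key i⟩⟩
  have he : Function.Injective e := by
    intro i j hij
    have := congrArg Sigma.fst hij
    simpa [e, Fin.ext_iff] using this
  rw [Finset.sum_range]
  calc ∑ i : Fin (k - 1), F (orderStat u (i + 1)) (orderStat u (i + 2))
      ≤ ∑ i : Fin (k - 1), G (e i).1 (e i).2 := by
        refine Finset.sum_le_sum fun i _ => ?_
        have h1 := orderStat_of_lt u (Nat.lt_of_succ_lt (key i))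
        have h2 := orderStat_of_lt u (key i)
        have h3 := not_mem_Ioo_orderStat u (key i)
        have h4 := monotone_orderStat hu (show (i : ℕ) + 1 ≤ i + 2 by omega)
        rw [show (i : ℕ) + 2 = i + 1 + 1 from rfl] at *
        rw [h1, h2] at *
        refine hG _ _ ?_ h4 h3
        simp [Fin.ext_iff]
    _ = ∑ p ∈ Finset.univ.map ⟨e, he⟩, G p.1 p.2 := by simp
    _ ≤ _ := by
        refine Finset.sum_le_sum_of_subset_of_nonneg ?_ fun _ _ _ => hG0 _ _
        intro p hp
        simp only [Finset.mem_map, Finset.mem_univ, true_and, Function.Embedding.coeFn_mk] at hp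
        obtain ⟨i, rfl⟩ := hp
        simp [e, Fin.ext_iff]

end OrderStat

/-! ### Integrating one coordinate of a product measure separately -/

section Isolate

variable {m : ℕ} (μ : Measure ℝ) [IsProbabilityMeasure μ]

/-- One coordinate of a product measure can be integrated separately. -/
theorem integral_pi_isolate (i : Fin (m + 1)) (F : ℝ × (Fin m → ℝ) → ℝ) :
    ∫ x : Fin (m + 1) → ℝ, F (x i, i.removeNth x) ∂Measure.pi (fun _ => μ) =
      ∫ z, F z ∂μ.prod (Measure.pi fun _ => μ) :=
  (measurePreserving_piFinSuccAbove (fun _ : Fin (m + 1) => μ) i).integral_comp' F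

theorem integral_pi_isolate_mul (i : Fin (m + 1)) (f : ℝ → ℝ) (g : (Fin m → ℝ) → ℝ) :
    ∫ x : Fin (m + 1) → ℝ, f (x i) * g (i.removeNth x) ∂Measure.pi (fun _ => μ) =
      (∫ a, f a ∂μ) * ∫ y, g y ∂Measure.pi fun _ => μ := by
  rw [integral_pi_isolate μ i fun z => f z.1 * g z.2, integral_prod_mul]

end Isolate

/-! ### Inverse moments of the number of sample points in a set -/

section Count

/-- The number of points in `A`. -/
noncomputable def hits {m : ℕ} (A : Set ℝ) (x : Fin m → ℝ) : ℝ :=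
  ∑ i, A.indicator (fun _ => (1 : ℝ)) (x i)

variable {m : ℕ} {A : Set ℝ}

theorem indicator_one_nonneg (A : Set ℝ) (a : ℝ) : 0 ≤ A.indicator (fun _ => (1 : ℝ)) a :=
  indicator_nonneg (fun _ _ => zero_le_one) a

theorem indicator_one_le (A : Set ℝ) (a : ℝ) : A.indicator (fun _ => (1 : ℝ)) a ≤ 1 := by
  by_cases h : a ∈ A <;> simp [h]

theorem hits_nonneg (A : Set ℝ) (x : Fin m → ℝ) : 0 ≤ hits A x :=
  Finset.sum_nonneg fun _ _ => indicator_one_nonneg A _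

theorem hits_le (A : Set ℝ) (x : Fin m → ℝ) : hits A x ≤ m := by
  unfold hits
  calc _ ≤ ∑ _i : Fin m, (1 : ℝ) := Finset.sum_le_sum fun _ _ => indicator_one_le A _
    _ = m := by simp

theorem hits_eq_add (A : Set ℝ) (x : Fin (m + 1) → ℝ) (i : Fin (m + 1)) :
    hits A x = A.indicator (fun _ => (1 : ℝ)) (x i) + hits A (i.removeNth x) := by
  simp only [hits, Fin.sum_univ_succAbove _ i, Fin.removeNth]

theorem measurable_hits (hA : MeasurableSet A) :
    Measurable fun x : Fin m → ℝ => hits A x :=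
  Finset.measurable_sum _ fun i _ =>
    (measurable_const.indicator hA).comp (measurable_pi_apply i)

variable (μ : Measure ℝ) [IsProbabilityMeasure μ]

theorem integrable_of_abs_le {α : Type*} [MeasurableSpace α] {ρ : Measure α} [IsFiniteMeasure ρ]
    {f : α → ℝ} (hf : Measurable f) {c : ℝ} (h : ∀ a, |f a| ≤ c) : Integrable f ρ :=
  .of_bound hf.aestronglyMeasurable c (.of_forall h)

theorem integral_indicator_one_eq (hA : MeasurableSet A) :
    ∫ a, A.indicator (fun _ => (1 : ℝ)) a ∂μ = μ.real A := by
  rw [integral_indicator hA]; simp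

/-- Exchangeability of the points, for functions of the number of points in `A`. -/
theorem integral_hits_shift (hA : MeasurableSet A) {G : ℝ → ℝ} (hG : Measurable G) {c : ℝ}
    (hb : ∀ y, 0 ≤ y → |G y| ≤ c) :
    ((m : ℝ) + 1) * μ.real A * ∫ x : Fin m → ℝ, G (hits A x) ∂Measure.pi (fun _ => μ) =
      ∫ x : Fin (m + 1) → ℝ, hits A x * G (hits A x - 1) ∂Measure.pi (fun _ => μ) := by
  -- The factor `hits A x` is a sum over the points in `A`. For each of them the other points number
  -- `hits A x - 1` in `A`, and these are independent of the isolated point.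
  have h1 : ∀ x : Fin (m + 1) → ℝ, hits A x * G (hits A x - 1) =
      ∑ i, A.indicator (fun _ => (1 : ℝ)) (x i) * G (hits A (i.removeNth x)) := by
    intro x
    rw [hits, Finset.sum_mul]
    refine Finset.sum_congr rfl fun i _ => ?_
    by_cases h : x i ∈ A
    · have := hits_eq_add A x i
      simp only [h, indicator_of_mem] at this ⊢
      rw [← hits, this]
      simp
    · simp [h]
  simp_rw [h1]
  rw [integral_finsetSum]
  · simp_rw [integral_pi_isolate_mul μ _ (A.indicator fun _ => (1 : ℝ))
      (fun y => G (hits A y)), integral_indicator_one_eq μ hA]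
    simp [mul_assoc]
  · intro i _
    have hr : Measurable fun x : Fin (m + 1) → ℝ => i.removeNth x :=
      measurable_pi_iff.mpr fun j => measurable_pi_apply _
    refine integrable_of_abs_le (c := c) ?_ ?_
    · exact ((measurable_const.indicator hA).comp (measurable_pi_apply i)).mul
        (hG.comp ((measurable_hits hA).comp hr))
    · intro x
      rw [abs_mul, abs_of_nonneg (indicator_one_nonneg A _)]
      exact (mul_le_of_le_one_left (abs_nonneg _) (indicator_one_le A _)).trans
        (hb _ (hits_nonneg A _))

theorem integrable_hits (hA : MeasurableSet A) {G : ℝ → ℝ} (hG : Measurable G) {c : ℝ}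
    (hb : ∀ y, 0 ≤ y → |G y| ≤ c) :
    Integrable (fun x : Fin m → ℝ => G (hits A x)) (Measure.pi fun _ => μ) :=
  integrable_of_abs_le (hG.comp (measurable_hits hA)) fun x => hb _ (hits_nonneg A x)

theorem abs_inv_le_one {y : ℝ} (hy : 1 ≤ y) : |y⁻¹| ≤ 1 := by
  rw [abs_of_nonneg (by positivity)]
  exact inv_le_one_of_one_le₀ hy

/-- The exchangeability identity turns 1/(1 + N) into N/N ≤ 1, at the price of one more sample
point. Iterating it bounds the inverse rising factorials below without binomial sums. -/
theorem integral_inv_one_add_hits (hA : MeasurableSet A) (m : ℕ) :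
    ((m : ℝ) + 1) * μ.real A *
      ∫ x : Fin m → ℝ, (1 + hits A x)⁻¹ ∂Measure.pi (fun _ => μ) ≤ 1 := by
  rw [integral_hits_shift μ hA (G := fun y => (1 + y)⁻¹) (c := 1) (by fun_prop)
    fun y hy => abs_inv_le_one (by linarith)]
  calc _ ≤ ∫ x : Fin (m + 1) → ℝ, (1 : ℝ) ∂Measure.pi (fun _ => μ) := by
        refine integral_mono_of_nonneg (.of_forall fun x => ?_) (by fun_prop)
          (.of_forall fun x => ?_)
        · have := hits_nonneg A x
          simp only [add_sub_cancel, Pi.zero_apply]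
          positivity
        · simpa using mul_inv_le_one
    _ = 1 := by simp

/-- The shift turns 1/((1 + N)(2 + N)) into N/(N(1 + N)) ≤ 1/(1 + N), which is the previous bound
with `m + 1` points. -/
theorem integral_inv_two_hits (hA : MeasurableSet A) (m : ℕ) :
    (((m : ℝ) + 1) * μ.real A) * (((m : ℝ) + 2) * μ.real A) *
      ∫ x : Fin m → ℝ, ((1 + hits A x) * (2 + hits A x))⁻¹ ∂Measure.pi (fun _ => μ) ≤ 1 := by
  have h := integral_hits_shift (m := m) μ hA (G := fun y => ((1 + y) * (2 + y))⁻¹) (c := 1)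
    (by fun_prop) fun y hy => abs_inv_le_one (by nlinarith)
  have h2 := integral_inv_one_add_hits μ hA (m + 1)
  have h3 : ∫ x : Fin (m + 1) → ℝ,
        hits A x * ((1 + (hits A x - 1)) * (2 + (hits A x - 1)))⁻¹ ∂Measure.pi (fun _ => μ) ≤
      ∫ x : Fin (m + 1) → ℝ, (1 + hits A x)⁻¹ ∂Measure.pi (fun _ => μ) := by
    refine integral_mono_of_nonneg (.of_forall fun x => ?_)
      (integrable_hits μ hA (G := fun y => (1 + y)⁻¹) (c := 1) (by fun_prop)
        fun y hy => abs_inv_le_one (by linarith)) (.of_forall fun x => ?_)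
    · have := hits_nonneg A x
      have : (1 + (hits A x - 1)) * (2 + (hits A x - 1)) = hits A x * (1 + hits A x) := by ring
      simp only [this, Pi.zero_apply]
      positivity
    · have := hits_nonneg A x
      have e : (1 + (hits A x - 1)) * (2 + (hits A x - 1)) = hits A x * (1 + hits A x) := by ring
      simp only [e, mul_inv, ← mul_assoc]
      exact mul_le_of_le_one_left (by positivity) mul_inv_le_one
  rw [← h] at h3
  push_cast at h2
  have hp : 0 ≤ μ.real A := measureReal_nonneg
  calc _ = (((m : ℝ) + 2) * μ.real A) * (((m : ℝ) + 1) * μ.real A *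
      ∫ x : Fin m → ℝ, ((1 + hits A x) * (2 + hits A x))⁻¹ ∂Measure.pi (fun _ => μ)) := by ring
    _ ≤ _ := mul_le_mul_of_nonneg_left h3 (by positivity)
    _ ≤ 1 := by convert h2 using 3; ring

theorem integral_inv_three_hits (hA : MeasurableSet A) (m : ℕ) :
    (((m : ℝ) + 1) * μ.real A) * (((m : ℝ) + 2) * μ.real A) * (((m : ℝ) + 3) * μ.real A) *
      ∫ x : Fin m → ℝ, ((1 + hits A x) * (2 + hits A x) * (3 + hits A x))⁻¹
        ∂Measure.pi (fun _ => μ) ≤ 1 := by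
  have h := integral_hits_shift (m := m) μ hA
    (G := fun y => ((1 + y) * (2 + y) * (3 + y))⁻¹) (c := 1)
    (by fun_prop) fun y hy => abs_inv_le_one (by
      have : 1 ≤ (1 + y) * (2 + y) := by nlinarith
      nlinarith)
  have h2 := integral_inv_two_hits μ hA (m + 1)
  have h3 : ∫ x : Fin (m + 1) → ℝ, hits A x *
        ((1 + (hits A x - 1)) * (2 + (hits A x - 1)) * (3 + (hits A x - 1)))⁻¹
          ∂Measure.pi (fun _ => μ) ≤
      ∫ x : Fin (m + 1) → ℝ, ((1 + hits A x) * (2 + hits A x))⁻¹ ∂Measure.pi (fun _ => μ) := by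
    have e : ∀ x : Fin (m + 1) → ℝ, (1 + (hits A x - 1)) * (2 + (hits A x - 1)) *
        (3 + (hits A x - 1)) = hits A x * ((1 + hits A x) * (2 + hits A x)) := fun x => by ring
    simp only [e]
    refine integral_mono_of_nonneg (.of_forall fun x => ?_)
      (integrable_hits μ hA (G := fun y => ((1 + y) * (2 + y))⁻¹) (c := 1) (by fun_prop)
        fun y hy => abs_inv_le_one (by nlinarith)) (.of_forall fun x => ?_)
    · have := hits_nonneg A x
      simp only [Pi.zero_apply]
      positivity
    · have := hits_nonneg A x
      simp only
      rw [mul_inv (hits A x), ← mul_assoc]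
      exact mul_le_of_le_one_left (by positivity) mul_inv_le_one
  rw [← h] at h3
  push_cast at h2
  have hp : 0 ≤ μ.real A := measureReal_nonneg
  calc _ = (((m : ℝ) + 2) * μ.real A) * (((m : ℝ) + 3) * μ.real A) *
      (((m : ℝ) + 1) * μ.real A * ∫ x : Fin m → ℝ,
        ((1 + hits A x) * (2 + hits A x) * (3 + hits A x))⁻¹ ∂Measure.pi (fun _ => μ)) := by ring
    _ ≤ _ := mul_le_mul_of_nonneg_left h3 (by positivity)
    _ ≤ 1 := by convert h2 using 2; ring

theorem integral_hits (hA : MeasurableSet A) (m : ℕ) :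
    ∫ x : Fin m → ℝ, hits A x ∂Measure.pi (fun _ => μ) = m * μ.real A := by
  unfold hits
  rw [integral_finsetSum]
  · have : ∀ i : Fin m, ∫ x : Fin m → ℝ, A.indicator (fun _ => (1 : ℝ)) (x i)
        ∂Measure.pi (fun _ => μ) = μ.real A := by
      intro i
      rw [← integral_indicator_one_eq μ hA]
      exact integral_comp_eval (μ := fun _ : Fin m => μ) (f := A.indicator fun _ => (1 : ℝ)) (i := i)
        ((measurable_const.indicator hA).aestronglyMeasurable)
    simp [this]
  · intro i _
    refine integrable_of_abs_le (c := 1)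
      ((measurable_const.indicator hA).comp (measurable_pi_apply i)) fun x => ?_
    rw [abs_of_nonneg (indicator_one_nonneg A _)]
    exact indicator_one_le A _

/-- The second inverse moment of the number of points in `A`. -/
noncomputable def invSq (m : ℕ) (A : Set ℝ) : ℝ :=
  ∫ x : Fin m → ℝ, ((1 + hits A x) ^ 2)⁻¹ ∂Measure.pi (fun _ => μ)

theorem integrable_invSq (hA : MeasurableSet A) :
    Integrable (fun x : Fin m → ℝ => ((1 + hits A x) ^ 2)⁻¹) (Measure.pi fun _ => μ) :=
  integrable_hits μ hA (G := fun y => ((1 + y) ^ 2)⁻¹) (c := 1) (by fun_prop)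
    fun y hy => abs_inv_le_one (by nlinarith)

theorem invSq_nonneg (m : ℕ) (A : Set ℝ) : 0 ≤ invSq μ m A :=
  integral_nonneg fun x => by positivity

/-- The inverse square is compared with inverse rising factorials: 1/(1+N)² is at most
1/((1+N)(2+N)) + 3/((1+N)(2+N)(3+N)), which is good for large t = (m+1)μ(A), and at most
2/((1+N)(2+N)), which serves for small t. -/
theorem invSq_le (hA : MeasurableSet A) (m : ℕ) :
    (((m : ℝ) + 1) * μ.real A) ^ 2 * invSq μ m A ≤ 1 + 4 / (1 + ((m : ℝ) + 1) * μ.real A) := by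
  have hp : 0 ≤ μ.real A := measureReal_nonneg
  rcases hp.eq_or_lt with h0 | hp
  · simp [← h0]
    norm_num
  have h2 := integral_inv_two_hits μ hA m
  have h3 := integral_inv_three_hits μ hA m
  set t := ((m : ℝ) + 1) * μ.real A with ht
  have htpos : 0 < t := by positivity
  set J2 := ∫ x : Fin m → ℝ, ((1 + hits A x) * (2 + hits A x))⁻¹ ∂Measure.pi (fun _ => μ)
  set J3 := ∫ x : Fin m → ℝ, ((1 + hits A x) * (2 + hits A x) * (3 + hits A x))⁻¹
        ∂Measure.pi (fun _ => μ)
  have i2 : Integrable (fun x : Fin m → ℝ => ((1 + hits A x) * (2 + hits A x))⁻¹)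
      (Measure.pi fun _ => μ) :=
    integrable_hits μ hA (G := fun y => ((1 + y) * (2 + y))⁻¹) (c := 1) (by fun_prop)
        fun y hy => abs_inv_le_one (by nlinarith)
  have i3 : Integrable (fun x : Fin m → ℝ =>
      ((1 + hits A x) * (2 + hits A x) * (3 + hits A x))⁻¹) (Measure.pi fun _ => μ) :=
    integrable_hits μ hA (G := fun y => ((1 + y) * (2 + y) * (3 + y))⁻¹) (c := 1) (by fun_prop)
      fun y hy => abs_inv_le_one (by
      have : 1 ≤ (1 + y) * (2 + y) := by nlinarith
      nlinarith)
  have hJ2 : 0 ≤ J2 := integral_nonneg fun x => by have := hits_nonneg A x; positivity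
  have hJ3 : 0 ≤ J3 := integral_nonneg fun x => by have := hits_nonneg A x; positivity
  have e1 : t ≤ ((m : ℝ) + 2) * μ.real A := by rw [ht]; gcongr; norm_num
  have e2 : t ≤ ((m : ℝ) + 3) * μ.real A := by rw [ht]; gcongr; norm_num
  have b2 : t ^ 2 * J2 ≤ 1 := by
    refine le_trans ?_ h2
    rw [pow_two]
    gcongr
  have b3 : t ^ 3 * J3 ≤ 1 := by
    refine le_trans ?_ h3
    rw [show t ^ 3 = t * t * t by ring]
    gcongr
  have c1 : invSq μ m A ≤ 2 * J2 := by
    unfold invSq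
    rw [← integral_const_mul]
    refine integral_mono (integrable_invSq μ hA) (i2.const_mul 2) fun x => ?_
    have := hits_nonneg A x
    simp only
    rw [← div_eq_mul_inv, ← one_div, div_le_div_iff₀ (by positivity) (by positivity)]
    nlinarith
  have c2 : invSq μ m A ≤ J2 + 3 * J3 := by
    unfold invSq
    rw [← integral_const_mul, ← integral_add i2 (i3.const_mul 3)]
    refine integral_mono (integrable_invSq μ hA) (i2.add (i3.const_mul 3)) fun x => ?_
    have := hits_nonneg A x
    simp only
    have : ((1 + hits A x) * (2 + hits A x))⁻¹ +
        3 * ((1 + hits A x) * (2 + hits A x) * (3 + hits A x))⁻¹ =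
        (6 + hits A x) / ((1 + hits A x) * (2 + hits A x) * (3 + hits A x)) := by
      field_simp; ring
    rw [this, ← one_div, div_le_div_iff₀ (by positivity) (by positivity)]
    nlinarith [pow_nonneg (hits_nonneg A x) 2, pow_nonneg (hits_nonneg A x) 3]
  have d1 : t ^ 2 * invSq μ m A ≤ 2 := by nlinarith [mul_le_mul_of_nonneg_left c1 (sq_nonneg t)]
  have d2 : t ^ 2 * invSq μ m A ≤ 1 + 3 / t := by
    have : t ^ 2 * J3 ≤ 1 / t := by rw [le_div_iff₀ htpos]; linarith
    have e : 3 / t = 3 * (1 / t) := by ring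
    nlinarith [mul_le_mul_of_nonneg_left c2 (sq_nonneg t)]
  -- The two regimes meet at 3: there 4/(1 + t) equals both 1 and 3/t.
  rcases le_total t 3 with h | h
  · refine d1.trans ?_
    have : 1 ≤ 4 / (1 + t) := by rw [le_div_iff₀ (by positivity)]; linarith
    linarith
  · refine d2.trans ?_
    gcongr 1 + ?_
    rw [div_le_div_iff₀ htpos (by positivity)]
    linarith

/-- By convexity, y⁻² lies above its tangent at t = (m+1)μ(A), namely 3/t² - 2y/t³. For y = 1 + N
the mean is at most 1 + t, so only the first moment of the count is needed. -/
theorem le_invSq (hA : MeasurableSet A) (m : ℕ) :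
    1 - 4 / (1 + ((m : ℝ) + 1) * μ.real A) ≤ (((m : ℝ) + 1) * μ.real A) ^ 2 * invSq μ m A := by
  have hp : 0 ≤ μ.real A := measureReal_nonneg
  rcases hp.eq_or_lt with h0 | hp
  · simp [← h0]
  have hI := integral_hits μ hA m
  set t := ((m : ℝ) + 1) * μ.real A with ht
  have htpos : 0 < t := by positivity
  have hi : Integrable (fun x : Fin m → ℝ => hits A x) (Measure.pi fun _ => μ) :=
    integrable_of_abs_le (c := m) (measurable_hits hA) fun x => by
      rw [abs_of_nonneg (hits_nonneg A x)]; exact hits_le A x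
  have c : 3 / t ^ 2 - 2 * (1 + m * μ.real A) / t ^ 3 ≤ invSq μ m A := by
    calc _ = ∫ x : Fin m → ℝ, (3 / t ^ 2 - 2 / t ^ 3 - 2 / t ^ 3 * hits A x)
          ∂Measure.pi (fun _ => μ) := by
          rw [integral_sub (by fun_prop) (hi.const_mul _), integral_const_mul, hI]
          simp
          ring
      _ ≤ _ := by
          refine integral_mono ((integrable_const _).sub (hi.const_mul _))
            (integrable_invSq μ hA) fun x => ?_
          have := hits_nonneg A x
          simp only
          set y := 1 + hits A x with hy
          have hy0 : 0 < y := by positivity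
          have e : 3 / t ^ 2 - 2 / t ^ 3 - 2 / t ^ 3 * hits A x = (3 * t - 2 * y) / t ^ 3 := by
            rw [hy]; field_simp; ring
          rw [e, ← one_div, div_le_div_iff₀ (by positivity) (by positivity)]
          -- The tangent inequality is the identity t³ - (3t - 2y)y² = (t - y)²(t + 2y).
          nlinarith [mul_nonneg (sq_nonneg (t - y)) (by positivity : 0 ≤ t + 2 * y)]
  have d : 1 - 2 / t ≤ t ^ 2 * invSq μ m A := by
    calc 1 - 2 / t ≤ t ^ 2 * (3 / t ^ 2 - 2 * (1 + m * μ.real A) / t ^ 3) := by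
          have e : t ^ 2 * (3 / t ^ 2 - 2 * (1 + m * μ.real A) / t ^ 3) =
              3 - 2 * (1 + m * μ.real A) / t := by field_simp
          have : 2 * (1 + m * μ.real A) / t ≤ 2 * (1 + t) / t := by
            gcongr; rw [ht]; linarith
          have e2 : 2 * (1 + t) / t = 2 / t + 2 := by field_simp
          linarith
      _ ≤ _ := by gcongr
  rcases le_total t 1 with h | h
  · have : 1 ≤ 4 / (1 + t) := by rw [le_div_iff₀ (by positivity)]; linarith
    have := mul_nonneg (sq_nonneg t) (invSq_nonneg μ m A)
    linarith
  · have : 2 / t ≤ 4 / (1 + t) := by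
      rw [div_le_div_iff₀ htpos (by positivity)]; linarith
    linarith

/-- The probability that there is no point in `A`. -/
theorem integral_hits_eq_zero_le (hA : MeasurableSet A) (m : ℕ) :
    (((m : ℝ) + 1) * μ.real A) * ∫ x : Fin (m + 1) → ℝ,
      ({0} : Set ℝ).indicator (fun _ => (1 : ℝ)) (hits A x) ∂Measure.pi (fun _ => μ) ≤
        4 / (1 + ((m : ℝ) + 1) * μ.real A) := by
  have hp : 0 ≤ μ.real A := measureReal_nonneg
  rcases hp.eq_or_lt with h0 | hp
  · simp [← h0]
  have h2 := integral_inv_two_hits μ hA (m + 1)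
  push_cast at h2
  set t := ((m : ℝ) + 1) * μ.real A with ht
  have htpos : 0 < t := by positivity
  set J2 := ∫ x : Fin (m + 1) → ℝ, ((1 + hits A x) * (2 + hits A x))⁻¹ ∂Measure.pi (fun _ => μ)
  have i2 : Integrable (fun x : Fin (m + 1) → ℝ => ((1 + hits A x) * (2 + hits A x))⁻¹)
      (Measure.pi fun _ => μ) :=
    integrable_hits μ hA (G := fun y => ((1 + y) * (2 + y))⁻¹) (c := 1) (by fun_prop)
        fun y hy => abs_inv_le_one (by nlinarith)
  have hJ2 : 0 ≤ J2 := integral_nonneg fun x => by have := hits_nonneg A x; positivity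
  have i0 : Integrable (fun x : Fin (m + 1) → ℝ =>
      ({0} : Set ℝ).indicator (fun _ => (1 : ℝ)) (hits A x)) (Measure.pi fun _ => μ) :=
    integrable_hits μ hA (c := 1) (measurable_const.indicator (measurableSet_singleton 0))
      fun y _ => by
        rw [abs_of_nonneg (indicator_one_nonneg _ _)]; exact indicator_one_le _ _
  set Q := ∫ x : Fin (m + 1) → ℝ,
      ({0} : Set ℝ).indicator (fun _ => (1 : ℝ)) (hits A x) ∂Measure.pi (fun _ => μ)
  have b2 : t ^ 2 * J2 ≤ 1 := by
    refine le_trans ?_ h2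
    rw [pow_two]
    gcongr
    · rw [ht]; gcongr; linarith
    · rw [ht, add_assoc]; gcongr; norm_num
  -- At count zero the inverse product equals 1/2, whence the factor 2.
  have c1 : Q ≤ 2 * J2 := by
    rw [← integral_const_mul]
    refine integral_mono i0 (i2.const_mul 2) fun x => ?_
    have := hits_nonneg A x
    simp only
    by_cases h : hits A x = 0
    · simp [h]
    · simp only [indicator, mem_singleton_iff, h, if_false]
      positivity
  have c2 : Q ≤ 1 := by
    calc Q ≤ ∫ x : Fin (m + 1) → ℝ, (1 : ℝ) ∂Measure.pi (fun _ => μ) :=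
        integral_mono i0 (by fun_prop) fun x => indicator_one_le _ _
      _ = 1 := by simp
  rw [le_div_iff₀ (by positivity)]
  have : t ^ 2 * Q ≤ 2 := by nlinarith [mul_le_mul_of_nonneg_left c1 (sq_nonneg t)]
  rcases le_total t 1 with h | h <;> nlinarith

end Count

/-! ### Second moments of affine functions of the errors -/

section Noise

variable {n : ℕ} {ν : Measure ℝ} [IsProbabilityMeasure ν]

theorem memLp_eval (hν : MemLp id 2 ν) (i : Fin n) :
    MemLp (fun e : Fin n → ℝ => e i) 2 (Measure.pi fun _ => ν) :=
  hν.comp_measurePreserving (measurePreserving_eval (fun _ : Fin n => ν) i)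

theorem integral_eval_mul_eval (hν0 : ∫ e, e ∂ν = 0) {v : ℝ}
    (hv : ∫ e, e ^ 2 ∂ν = v) (i j : Fin n) :
    ∫ e : Fin n → ℝ, e i * e j ∂Measure.pi (fun _ => ν) = if i = j then v else 0 := by
  split_ifs with h
  · subst h
    rw [← hv]
    simp_rw [← pow_two]
    exact integral_comp_eval (μ := fun _ : Fin n => ν) (i := i) (f := fun e => e ^ 2)
      (by fun_prop)
  · have hi : IndepFun (fun e : Fin n → ℝ => e i) (fun e => e j) (Measure.pi fun _ => ν) :=
      (iIndepFun_pi (X := fun _ : Fin n => (id : ℝ → ℝ)) (μ := fun _ => ν)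
        fun _ => aemeasurable_id).indepFun h
    rw [hi.integral_fun_mul_eq_mul_integral (measurable_pi_apply i).aestronglyMeasurable
      (measurable_pi_apply j).aestronglyMeasurable,
      integral_comp_eval (μ := fun _ : Fin n => ν) (i := i) (f := fun e => e) (by fun_prop), hν0,
      zero_mul]

/-- The product of two affine functions of centered independent variables has the covariance of
the linear parts plus the product of the constants as its expectation. -/
theorem integral_affine_mul_affine (hν : MemLp id 2 ν) (hν0 : ∫ e, e ∂ν = 0) {v : ℝ}
    (hv : ∫ e, e ^ 2 ∂ν = v) (a b : Fin n → ℝ) (r r' : ℝ) :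
    ∫ e : Fin n → ℝ, (∑ i, e i * a i + r) * (∑ i, e i * b i + r') ∂Measure.pi (fun _ => ν) =
      v * ∑ i, a i * b i + r * r' := by
  have hI : ∀ i : Fin n, Integrable (fun e : Fin n → ℝ => e i) (Measure.pi fun _ => ν) :=
    fun i => (memLp_eval hν i).integrable one_le_two
  have hII : ∀ i j : Fin n, Integrable (fun e : Fin n → ℝ => e i * e j)
      (Measure.pi fun _ => ν) :=
    fun i j => (memLp_eval hν i).integrable_mul (memLp_eval hν j)
  have h0 : ∀ i : Fin n, ∫ e : Fin n → ℝ, e i ∂(Measure.pi fun _ => ν) = 0 := fun i => by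
    rw [integral_comp_eval (μ := fun _ : Fin n => ν) (i := i) (f := fun e => e) (by fun_prop), hν0]
  have e1 : ∀ e : Fin n → ℝ, (∑ i, e i * a i + r) * (∑ i, e i * b i + r') =
      ∑ i, ∑ j, (e i * e j) * (a i * b j) + (∑ i, e i * (a i * r') + ∑ i, e i * (b i * r))
        + r * r' := by
    intro e
    rw [add_mul, mul_add, mul_add, Finset.sum_mul_sum, Finset.sum_mul, Finset.mul_sum]
    simp only [mul_assoc, mul_left_comm, mul_comm r]
    ring
  simp_rw [e1]
  have i1 : Integrable (fun e : Fin n → ℝ => ∑ i, ∑ j, (e i * e j) * (a i * b j))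
      (Measure.pi fun _ => ν) :=
    integrable_finsetSum _ fun i _ => integrable_finsetSum _ fun j _ => (hII i j).mul_const _
  have i2 : ∀ c : Fin n → ℝ, Integrable (fun e : Fin n → ℝ => ∑ i, e i * c i)
      (Measure.pi fun _ => ν) := fun c => integrable_finsetSum _ fun i _ => (hI i).mul_const _
  have z : ∀ c : Fin n → ℝ, ∫ e : Fin n → ℝ, ∑ i, e i * c i ∂(Measure.pi fun _ => ν) = 0 := by
    intro c
    rw [integral_finsetSum _ fun i _ => (hI i).mul_const _]
    simp [integral_mul_const, h0]
  rw [integral_add (i1.fun_add ((i2 _).fun_add (i2 _))) (integrable_const _),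
    integral_add i1 ((i2 _).fun_add (i2 _)), integral_add (i2 _) (i2 _), z, z,
    integral_finsetSum _ fun i _ => integrable_finsetSum _ fun j _ => (hII i j).mul_const _]
  simp_rw [integral_finsetSum _ fun j _ => (hII _ j).mul_const _, integral_mul_const,
    integral_eval_mul_eval hν0 hv]
  simp [Finset.mul_sum]

end Noise

/-! ### Weights and noiseless error of a regressogram on fixed cells -/

section Histogram

variable {m : ℕ} (μ : Measure ℝ) [IsProbabilityMeasure μ]

/-- The mean of the function `s` over `A` with respect to `μ`. -/
noncomputable def meanOn (s : ℝ → ℝ) (A : Set ℝ) : ℝ := (∫ a in A, s a ∂μ) / μ.real A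

/-- The weight of the `i`-th point in the regressogram over the cells `A j`, `j ∈ J`. -/
noncomputable def weight {n : ℕ} (J : Finset ℕ) (A : ℕ → Set ℝ) (x : Fin n → ℝ) (t : ℝ)
    (i : Fin n) : ℝ :=
  ∑ j ∈ J, (A j).indicator (fun _ => (1 : ℝ)) t *
    ((A j).indicator (fun _ => (1 : ℝ)) (x i) / hits (A j) x)

/-- The average of the `s (x i)` over the points in `A`, centered by the mean of `s`. -/
noncomputable def centeredAverage {n : ℕ} (s : ℝ → ℝ) (A : Set ℝ) (x : Fin n → ℝ) : ℝ :=
  (∑ i, A.indicator (fun _ => (1 : ℝ)) (x i) * s (x i)) / hits A x - meanOn μ s A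

/-- The error of the regressogram for noiseless responses. -/
noncomputable def bias {n : ℕ} (s : ℝ → ℝ) (J : Finset ℕ) (A : ℕ → Set ℝ) (x : Fin n → ℝ)
    (t : ℝ) : ℝ :=
  ∑ j ∈ J, (A j).indicator (fun _ => (1 : ℝ)) t * centeredAverage μ s (A j) x

/-- The denominator no longer involves the i-th point, so that point can be integrated out
independently. If it lies outside `A`, both sides vanish whatever the count is. -/
theorem indicator_div_hits (A : Set ℝ) (x : Fin (m + 1) → ℝ) (i : Fin (m + 1)) :
    A.indicator (fun _ => (1 : ℝ)) (x i) / hits A x =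
      A.indicator (fun _ => (1 : ℝ)) (x i) * (1 + hits A (i.removeNth x))⁻¹ := by
  by_cases h : x i ∈ A
  · rw [hits_eq_add A x i]; simp [h]
  · simp [h]

theorem measurable_removeNth (i : Fin (m + 1)) :
    Measurable fun x : Fin (m + 1) → ℝ => i.removeNth x :=
  measurable_pi_iff.mpr fun _ => measurable_pi_apply _

/-- The mixed second inverse moment of the numbers of points in `A` and `B`. -/
noncomputable def crossInv (m : ℕ) (A B : Set ℝ) : ℝ :=
  ∫ x : Fin m → ℝ, ((1 + hits A x) * (1 + hits B x))⁻¹ ∂Measure.pi (fun _ => μ)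

variable {A B : Set ℝ}

theorem integrable_crossInv (hA : MeasurableSet A) (hB : MeasurableSet B) :
    Integrable (fun x : Fin m → ℝ => ((1 + hits A x) * (1 + hits B x))⁻¹)
      (Measure.pi fun _ => μ) :=
  integrable_of_abs_le (c := 1) (by
      have := measurable_hits (m := m) hA
      have := measurable_hits (m := m) hB
      fun_prop) fun x =>
    abs_inv_le_one (by nlinarith [hits_nonneg A x, hits_nonneg B x])

theorem crossInv_self (m : ℕ) (A : Set ℝ) : crossInv μ m A A = invSq μ m A := by
  simp only [crossInv, invSq, pow_two]

/-- Weighted arithmetic-geometric mean inequality. The weight is free so that it can later be the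
ratio of the probabilities of the two cells, which makes each term proportional to a normalized
second inverse moment. -/
theorem crossInv_le (hA : MeasurableSet A) (hB : MeasurableSet B) {c : ℝ} (hc : 0 < c) :
    crossInv μ m A B ≤ (c * invSq μ m A + c⁻¹ * invSq μ m B) / 2 := by
  unfold crossInv invSq
  rw [← integral_const_mul, ← integral_const_mul, ← integral_add
    ((integrable_invSq μ hA).const_mul c) ((integrable_invSq μ hB).const_mul c⁻¹),
    ← integral_div]
  refine integral_mono (integrable_crossInv μ hA hB)
    ((((integrable_invSq μ hA).const_mul c).add
      ((integrable_invSq μ hB).const_mul c⁻¹)).div_const 2) fun x => ?_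
  simp only [Pi.add_apply]
  rw [mul_inv, ← inv_pow, ← inv_pow]
  set a := (1 + hits A x)⁻¹
  set b := (1 + hits B x)⁻¹
  have : c * a ^ 2 + c⁻¹ * b ^ 2 - 2 * (a * b) = c⁻¹ * (c * a - b) ^ 2 := by
    field_simp; ring
  have h2 : 0 ≤ c⁻¹ * (c * a - b) ^ 2 := by positivity
  linarith

/-- The i-th observation and the generic point must both lie in `A j ∩ B l`, which gives the squared
probability. The other `m` observations give `crossInv`, and all `m + 1` indices contribute equally.
-/
theorem integral_sum_weight_mul_weight (J K : Finset ℕ) {A B : ℕ → Set ℝ}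
    (hA : ∀ j, MeasurableSet (A j)) (hB : ∀ j, MeasurableSet (B j)) :
    ∫ z : (Fin (m + 1) → ℝ) × ℝ, ∑ i, weight J A z.1 z.2 i * weight K B z.1 z.2 i
        ∂((Measure.pi fun _ => μ).prod μ) =
      ∑ j ∈ J, ∑ l ∈ K, ((m : ℝ) + 1) * μ.real (A j ∩ B l) ^ 2 * crossInv μ m (A j) (B l) := by
  have h1 : ∀ z : (Fin (m + 1) → ℝ) × ℝ, ∑ i, weight J A z.1 z.2 i * weight K B z.1 z.2 i =
      ∑ i, ∑ j ∈ J, ∑ l ∈ K, ((A j ∩ B l).indicator (fun _ => (1 : ℝ)) (z.1 i) *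
        ((1 + hits (A j) (i.removeNth z.1)) * (1 + hits (B l) (i.removeNth z.1)))⁻¹) *
        (A j ∩ B l).indicator (fun _ => (1 : ℝ)) z.2 := by
    intro z
    refine Finset.sum_congr rfl fun i _ => ?_
    rw [weight, weight, Finset.sum_mul_sum]
    refine Finset.sum_congr rfl fun j _ => Finset.sum_congr rfl fun l _ => ?_
    rw [indicator_div_hits, indicator_div_hits, mul_inv]
    have e : ∀ y, (A j ∩ B l).indicator (fun _ => (1 : ℝ)) y =
        (A j).indicator (fun _ => (1 : ℝ)) y * (B l).indicator (fun _ => (1 : ℝ)) y := by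
      intro y
      by_cases h1 : y ∈ A j <;> by_cases h2 : y ∈ B l <;> simp [h1, h2]
    rw [e, e]
    ring
  have hint : ∀ (i : Fin (m + 1)) (j l : ℕ), Integrable (fun z : (Fin (m + 1) → ℝ) × ℝ =>
      ((A j ∩ B l).indicator (fun _ => (1 : ℝ)) (z.1 i) *
        ((1 + hits (A j) (i.removeNth z.1)) * (1 + hits (B l) (i.removeNth z.1)))⁻¹) *
        (A j ∩ B l).indicator (fun _ => (1 : ℝ)) z.2) ((Measure.pi fun _ => μ).prod μ) := by
    intro i j l
    have hm1 : Measurable ((A j ∩ B l).indicator fun _ => (1 : ℝ)) :=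
      measurable_const.indicator ((hA j).inter (hB l))
    have hm2 := (measurable_hits (m := m) (hA j)).comp (measurable_removeNth i)
    have hm3 := (measurable_hits (m := m) (hB l)).comp (measurable_removeNth i)
    refine integrable_of_abs_le (c := 1) ?_ fun z => ?_
    · exact ((hm1.comp ((measurable_pi_apply i).comp measurable_fst)).mul
        (((hm2.const_add 1).mul (hm3.const_add 1)).inv.comp measurable_fst)).mul
        (hm1.comp measurable_snd)
    · have h1 := hits_nonneg (A j) (i.removeNth z.1)
      have h2 := hits_nonneg (B l) (i.removeNth z.1)
      rw [abs_mul, abs_mul, abs_of_nonneg (indicator_one_nonneg _ _),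
        abs_of_nonneg (indicator_one_nonneg _ _)]
      refine mul_le_one₀ (mul_le_one₀ (indicator_one_le _ _) (abs_nonneg _)
        (abs_inv_le_one (by nlinarith))) (indicator_one_nonneg _ _) (indicator_one_le _ _)
  simp_rw [h1]
  rw [integral_finsetSum _ fun i _ => integrable_finsetSum _ fun j _ =>
    integrable_finsetSum _ fun l _ => hint i j l]
  simp_rw [integral_finsetSum _ fun j _ => integrable_finsetSum _ fun l _ => hint _ j l,
    integral_finsetSum _ fun l _ => hint _ _ l]
  have h2 : ∀ (i : Fin (m + 1)) (j l : ℕ), ∫ z : (Fin (m + 1) → ℝ) × ℝ,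
      ((A j ∩ B l).indicator (fun _ => (1 : ℝ)) (z.1 i) *
        ((1 + hits (A j) (i.removeNth z.1)) * (1 + hits (B l) (i.removeNth z.1)))⁻¹) *
        (A j ∩ B l).indicator (fun _ => (1 : ℝ)) z.2 ∂((Measure.pi fun _ => μ).prod μ) =
      μ.real (A j ∩ B l) ^ 2 * crossInv μ m (A j) (B l) := by
    intro i j l
    rw [integral_prod_mul (fun x : Fin (m + 1) → ℝ =>
      (A j ∩ B l).indicator (fun _ => (1 : ℝ)) (x i) *
        ((1 + hits (A j) (i.removeNth x)) * (1 + hits (B l) (i.removeNth x)))⁻¹)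
      ((A j ∩ B l).indicator fun _ => (1 : ℝ)),
      integral_pi_isolate_mul μ i ((A j ∩ B l).indicator fun _ => (1 : ℝ))
      (fun y => ((1 + hits (A j) y) * (1 + hits (B l) y))⁻¹),
      integral_indicator_one_eq μ ((hA j).inter (hB l)), crossInv]
    ring
  simp_rw [h2]
  simp [Finset.mul_sum, mul_assoc]

variable {s : ℝ → ℝ} {C : ℝ}

theorem integrable_of_bounded (hs : Measurable s) (hC : ∀ a, |s a| ≤ C) : Integrable s μ :=
  integrable_of_abs_le hs hC

theorem abs_meanOn_le (hC : ∀ a, |s a| ≤ C) (A : Set ℝ) : |meanOn μ s A| ≤ C := by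
  have hC0 : 0 ≤ C := (abs_nonneg _).trans (hC 0)
  unfold meanOn
  rw [abs_div, abs_of_nonneg (measureReal_nonneg (μ := μ))]
  refine div_le_of_le_mul₀ measureReal_nonneg hC0 ?_
  exact norm_setIntegral_le_of_norm_le_const (measure_lt_top _ _) fun a _ =>
    (Real.norm_eq_abs _).trans_le (hC a)

theorem abs_sub_meanOn_le (hs : Measurable s) (hC : ∀ a, |s a| ≤ C)
    (hp : 0 < μ.real A) {d : ℝ} (hd : ∀ a ∈ A, ∀ b ∈ A, |s a - s b| ≤ d) {a : ℝ} (ha : a ∈ A) :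
    |s a - meanOn μ s A| ≤ d := by
  have e : s a - meanOn μ s A = (∫ b in A, (s a - s b) ∂μ) / μ.real A := by
    rw [integral_sub (integrable_const _) (integrable_of_bounded μ hs hC).integrableOn, meanOn]
    simp only [integral_const, MeasurableSet.univ, measureReal_restrict_apply, univ_inter,
      smul_eq_mul]
    field_simp
  rw [e, abs_div, abs_of_pos hp, div_le_iff₀ hp]
  exact norm_setIntegral_le_of_norm_le_const (measure_lt_top _ _) fun b hb =>
    (Real.norm_eq_abs _).trans_le (hd a ha b hb)

theorem abs_centeredAverage_le {n : ℕ} (hC : ∀ a, |s a| ≤ C) (A : Set ℝ) (x : Fin n → ℝ) :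
    |centeredAverage μ s A x| ≤ 2 * C := by
  have hC0 : 0 ≤ C := (abs_nonneg _).trans (hC 0)
  have h1 := abs_meanOn_le μ hC A
  have h2 : |(∑ i, A.indicator (fun _ => (1 : ℝ)) (x i) * s (x i)) / hits A x| ≤ C := by
    rw [abs_div, abs_of_nonneg (hits_nonneg A x)]
    refine div_le_of_le_mul₀ (hits_nonneg A x) hC0 ?_
    refine (Finset.abs_sum_le_sum_abs _ _).trans ?_
    rw [hits, Finset.mul_sum]
    refine Finset.sum_le_sum fun i _ => ?_
    rw [abs_mul, abs_of_nonneg (indicator_one_nonneg _ _), mul_comm]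
    exact mul_le_mul_of_nonneg_right (hC _) (indicator_one_nonneg _ _)
  unfold centeredAverage
  exact (abs_sub _ _).trans (by linarith)

theorem measurable_centeredAverage {n : ℕ} (hs : Measurable s) (hA : MeasurableSet A) :
    Measurable fun x : Fin n → ℝ => centeredAverage μ s A x := by
  unfold centeredAverage
  have h1 : Measurable (A.indicator fun _ => (1 : ℝ)) := measurable_const.indicator hA
  have h2 := measurable_hits (m := n) hA
  fun_prop

/-- Given a nonempty cell, this is the variance of an average of centered values of size at most
`d`. An empty cell leaves only the mean of `s`, which is bounded by `C`, and is charged to the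
probability of emptiness. -/
theorem integral_centeredAverage_sq_le (hs : Measurable s) (hC : ∀ a, |s a| ≤ C)
    (hA : MeasurableSet A) {d : ℝ} (hd : ∀ a ∈ A, ∀ b ∈ A, |s a - s b| ≤ d) :
    ((m : ℝ) + 1) * μ.real A *
      ∫ x : Fin (m + 1) → ℝ, centeredAverage μ s A x ^ 2 ∂Measure.pi (fun _ => μ) ≤
    C ^ 2 * (4 / (1 + ((m : ℝ) + 1) * μ.real A)) + 5 * d ^ 2 := by
  rcases (measureReal_nonneg (μ := μ) (s := A)).eq_or_lt with h0 | hp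
  · simp only [← h0]
    simp only [mul_zero, zero_mul]
    positivity
  have hC0 : 0 ≤ C := (abs_nonneg _).trans (hC 0)
  set c := meanOn μ s A with hc
  set g : ℝ → ℝ := fun a => A.indicator (fun _ => (1 : ℝ)) a * (s a - c) with hg
  have hcC : |c| ≤ C := abs_meanOn_le μ hC A
  have hgm : Measurable g := (measurable_const.indicator hA).mul (hs.sub_const c)
  have hgb : ∀ a, |g a| ≤ 2 * C := by
    intro a
    rw [hg, abs_mul, abs_of_nonneg (indicator_one_nonneg _ _)]
    refine (mul_le_of_le_one_left (abs_nonneg _) (indicator_one_le _ _)).trans ?_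
    exact (abs_sub _ _).trans (by linarith [hC a])
  have hgd : ∀ a, g a ^ 2 ≤ d ^ 2 * A.indicator (fun _ => (1 : ℝ)) a := by
    intro a
    by_cases ha : a ∈ A
    · have := abs_sub_meanOn_le μ hs hC hp hd ha
      simp only [hg, ha, indicator_of_mem, one_mul, mul_one]
      exact sq_le_sq' (abs_le.mp this).1 (abs_le.mp this).2
    · simp [hg, ha]
  have hg0 : ∫ a, g a ∂μ = 0 := by
    have e : g = A.indicator fun a => s a - c := by
      ext a
      by_cases ha : a ∈ A <;> simp [hg, ha]
    rw [e, integral_indicator hA, integral_sub (integrable_of_bounded μ hs hC).integrableOn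
      (integrable_const _), hc, meanOn]
    simp only [integral_const, MeasurableSet.univ, measureReal_restrict_apply, univ_inter,
      smul_eq_mul]
    field_simp
    ring
  have hg2 : ∫ a, g a ^ 2 ∂μ ≤ d ^ 2 * μ.real A := by
    rw [← integral_indicator_one_eq μ hA, ← integral_const_mul]
    exact integral_mono_of_nonneg (.of_forall fun a => sq_nonneg _)
      (integrable_of_abs_le ((measurable_const.indicator hA).const_mul _) (c := d ^ 2) fun a => by
        rw [abs_of_nonneg (mul_nonneg (sq_nonneg _) (indicator_one_nonneg _ _))]
        exact mul_le_of_le_one_right (sq_nonneg _) (indicator_one_le _ _)) (.of_forall hgd)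
  -- The square of the sum of the `g (x i)` is expanded with one factor isolated, and the
  -- denominator is rewritten through the other points. In the off-diagonal term `g (x i)` is then
  -- independent of the rest and has mean zero. The first summand is the empty cell, where the
  -- average is 0 by convention.
  have hpt : ∀ x : Fin (m + 1) → ℝ, centeredAverage μ s A x ^ 2 =
      c ^ 2 * ({0} : Set ℝ).indicator (fun _ => (1 : ℝ)) (hits A x) +
      ∑ i, (g (x i) ^ 2 * ((1 + hits A (i.removeNth x)) ^ 2)⁻¹ +
        g (x i) * ((∑ j, g (i.removeNth x j)) * ((1 + hits A (i.removeNth x)) ^ 2)⁻¹)) := by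
    intro x
    have h1 : ∀ i, g (x i) ^ 2 * ((1 + hits A (i.removeNth x)) ^ 2)⁻¹ +
        g (x i) * ((∑ j, g (i.removeNth x j)) * ((1 + hits A (i.removeNth x)) ^ 2)⁻¹) =
        g (x i) * ((∑ j, g (x j)) * (hits A x ^ 2)⁻¹) := by
      intro i
      rw [Fin.sum_univ_succAbove _ i, hits_eq_add A x i]
      by_cases ha : x i ∈ A
      · simp only [ha, indicator_of_mem, Fin.removeNth]
        ring
      · simp [hg, ha]
    simp_rw [h1]
    rw [← Finset.sum_mul]
    have h2 : ∑ i, g (x i) =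
        (∑ i, A.indicator (fun _ => (1 : ℝ)) (x i) * s (x i)) - c * hits A x := by
      rw [hits, Finset.mul_sum, ← Finset.sum_sub_distrib]
      exact Finset.sum_congr rfl fun i _ => by rw [hg]; ring
    rw [h2, centeredAverage]
    by_cases hz : hits A x = 0
    · simp [hz, hc]
    · simp only [indicator, mem_singleton_iff, hz, if_false, mul_zero, zero_add]
      rw [← hc]
      field_simp
  have i0 : Integrable (fun x : Fin (m + 1) → ℝ =>
      ({0} : Set ℝ).indicator (fun _ => (1 : ℝ)) (hits A x)) (Measure.pi fun _ => μ) :=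
    integrable_hits μ hA (c := 1) (measurable_const.indicator (measurableSet_singleton 0))
      fun y _ => by
        rw [abs_of_nonneg (indicator_one_nonneg _ _)]; exact indicator_one_le _ _
  have hinv : ∀ (i : Fin (m + 1)) (x : Fin (m + 1) → ℝ),
      |((1 + hits A (i.removeNth x)) ^ 2)⁻¹| ≤ 1 := fun i x =>
    abs_inv_le_one (by nlinarith [hits_nonneg A (i.removeNth x)])
  have hinvm : ∀ i : Fin (m + 1), Measurable fun x : Fin (m + 1) → ℝ =>
      ((1 + hits A (i.removeNth x)) ^ 2)⁻¹ := fun i =>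
    ((((measurable_hits hA).comp (measurable_removeNth i)).const_add 1).pow_const 2).inv
  have i1 : ∀ i : Fin (m + 1), Integrable (fun x : Fin (m + 1) → ℝ =>
      g (x i) ^ 2 * ((1 + hits A (i.removeNth x)) ^ 2)⁻¹) (Measure.pi fun _ => μ) := fun i =>
    integrable_of_abs_le (c := (2 * C) ^ 2)
      (((hgm.comp (measurable_pi_apply i)).pow_const 2).mul (hinvm i)) fun x => by
      rw [abs_mul, abs_pow]
      refine (mul_le_of_le_one_right (by positivity) (hinv i x)).trans ?_
      gcongr
      exact hgb _
  have i2 : ∀ i : Fin (m + 1), Integrable (fun x : Fin (m + 1) → ℝ =>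
      g (x i) * ((∑ j, g (i.removeNth x j)) * ((1 + hits A (i.removeNth x)) ^ 2)⁻¹))
      (Measure.pi fun _ => μ) := fun i =>
    integrable_of_abs_le (c := 2 * C * (m * (2 * C))) ((hgm.comp (measurable_pi_apply i)).mul
      ((Finset.measurable_sum _ fun j _ => hgm.comp (measurable_pi_apply _)).mul (hinvm i)))
      fun x => by
      rw [abs_mul (g _)]
      refine mul_le_mul (hgb _) ?_ (by positivity) (by positivity)
      rw [abs_mul (Finset.sum _ _)]
      refine (mul_le_of_le_one_right (by positivity) (hinv i x)).trans ?_
      refine (Finset.abs_sum_le_sum_abs _ _).trans ?_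
      calc _ ≤ ∑ _j : Fin m, 2 * C := Finset.sum_le_sum fun j _ => hgb _
        _ = _ := by simp
  simp_rw [hpt]
  rw [integral_add (i0.const_mul _) (integrable_finsetSum _ fun i _ => (i1 i).fun_add (i2 i)),
    integral_const_mul, integral_finsetSum _ fun i _ => (i1 i).fun_add (i2 i)]
  have e3 : ∀ i : Fin (m + 1), ∫ x : Fin (m + 1) → ℝ,
      (g (x i) ^ 2 * ((1 + hits A (i.removeNth x)) ^ 2)⁻¹ +
        g (x i) * ((∑ j, g (i.removeNth x j)) * ((1 + hits A (i.removeNth x)) ^ 2)⁻¹))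
        ∂(Measure.pi fun _ => μ) = (∫ a, g a ^ 2 ∂μ) * invSq μ m A := by
    intro i
    rw [integral_add (i1 i) (i2 i), integral_pi_isolate_mul μ i (fun a => g a ^ 2)
      fun y => ((1 + hits A y) ^ 2)⁻¹, integral_pi_isolate_mul μ i g
      fun y => (∑ j, g (y j)) * ((1 + hits A y) ^ 2)⁻¹, hg0, invSq]
    ring
  simp_rw [e3]
  simp only [Finset.sum_const, Finset.card_univ, Fintype.card_fin, nsmul_eq_mul, Nat.cast_add,
    Nat.cast_one]
  have hz := integral_hits_eq_zero_le μ hA m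
  have hI := invSq_le μ hA m
  have hI0 := invSq_nonneg μ m A
  set Q := ∫ x : Fin (m + 1) → ℝ,
      ({0} : Set ℝ).indicator (fun _ => (1 : ℝ)) (hits A x) ∂Measure.pi (fun _ => μ)
  set t := ((m : ℝ) + 1) * μ.real A with ht
  have ht0 : 0 < t := by positivity
  have hI5 : t ^ 2 * invSq μ m A ≤ 5 := by
    refine hI.trans ?_
    have : 4 / (1 + t) ≤ 4 := div_le_self (by norm_num) (by linarith)
    linarith
  have hc2 : c ^ 2 ≤ C ^ 2 := sq_le_sq' (by linarith [abs_le.mp hcC]) (abs_le.mp hcC).2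
  calc t * (c ^ 2 * Q + ((m : ℝ) + 1) * ((∫ a, g a ^ 2 ∂μ) * invSq μ m A))
      = c ^ 2 * (t * Q) + t * (((m : ℝ) + 1) * invSq μ m A) * ∫ a, g a ^ 2 ∂μ := by ring
    _ ≤ C ^ 2 * (4 / (1 + t)) + t * (((m : ℝ) + 1) * invSq μ m A) * (d ^ 2 * μ.real A) := by
        have : 0 ≤ t * (((m : ℝ) + 1) * invSq μ m A) := mul_nonneg ht0.le (by positivity)
        exact add_le_add ((mul_le_mul_of_nonneg_left hz (sq_nonneg c)).trans
          (mul_le_mul_of_nonneg_right hc2 (by positivity))) (mul_le_mul_of_nonneg_left hg2 this)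
    _ = C ^ 2 * (4 / (1 + t)) + (t ^ 2 * invSq μ m A) * d ^ 2 := by rw [ht]; ring
    _ ≤ _ := by gcongr

/-- Disjointness of the cells removes all cross terms, and the generic point contributes the factor
`μ.real (A j)` independently of the sample. What remains is the bound for a single cell. -/
theorem integral_bias_sq_le (hs : Measurable s) (hC : ∀ a, |s a| ≤ C) (J : Finset ℕ)
    {A : ℕ → Set ℝ} (hA : ∀ j, MeasurableSet (A j))
    (hdisj : Pairwise (Function.onFun Disjoint A)) {d : ℕ → ℝ}
    (hd : ∀ j, ∀ a ∈ A j, ∀ b ∈ A j, |s a - s b| ≤ d j) :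
    ((m : ℝ) + 1) * ∫ z : (Fin (m + 1) → ℝ) × ℝ, bias μ s J A z.1 z.2 ^ 2
        ∂((Measure.pi fun _ => μ).prod μ) ≤
      C ^ 2 * ∑ j ∈ J, 4 / (1 + ((m : ℝ) + 1) * μ.real (A j)) + 5 * ∑ j ∈ J, d j ^ 2 := by
  have h1 : ∀ z : (Fin (m + 1) → ℝ) × ℝ, bias μ s J A z.1 z.2 ^ 2 =
      ∑ j ∈ J, centeredAverage μ s (A j) z.1 ^ 2 * (A j).indicator (fun _ => (1 : ℝ)) z.2 := by
    intro z
    by_cases h : ∃ j ∈ J, z.2 ∈ A j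
    · obtain ⟨j, hj, hz⟩ := h
      have hne : ∀ l ∈ J, l ≠ j → z.2 ∉ A l := fun l _ hl hz' =>
        Set.disjoint_left.mp (hdisj hl) hz' hz
      rw [bias, Finset.sum_eq_single_of_mem j hj fun l hl hlj => by simp [hne l hl hlj],
        Finset.sum_eq_single_of_mem j hj fun l hl hlj => by simp [hne l hl hlj]]
      simp [hz]
    · push Not at h
      rw [bias, Finset.sum_eq_zero fun l hl => by simp [h l hl],
        Finset.sum_eq_zero fun l hl => by simp [h l hl]]
      simp
  have hint : ∀ j, Integrable (fun z : (Fin (m + 1) → ℝ) × ℝ =>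
      centeredAverage μ s (A j) z.1 ^ 2 * (A j).indicator (fun _ => (1 : ℝ)) z.2)
      ((Measure.pi fun _ => μ).prod μ) := fun j =>
    integrable_of_abs_le (c := (2 * C) ^ 2)
      ((((measurable_centeredAverage μ hs (hA j)).comp measurable_fst).pow_const 2).mul
        ((measurable_const.indicator (hA j)).comp measurable_snd)) fun z => by
      rw [abs_mul, abs_pow, abs_of_nonneg (indicator_one_nonneg _ _)]
      refine (mul_le_of_le_one_right (by positivity) (indicator_one_le _ _)).trans ?_
      gcongr
      exact abs_centeredAverage_le μ hC _ _
  simp_rw [h1]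
  rw [integral_finsetSum _ fun j _ => hint j, Finset.mul_sum, Finset.mul_sum, Finset.mul_sum,
    ← Finset.sum_add_distrib]
  refine Finset.sum_le_sum fun j _ => ?_
  rw [integral_prod_mul (fun x : Fin (m + 1) → ℝ => centeredAverage μ s (A j) x ^ 2)
    ((A j).indicator fun _ => (1 : ℝ)), integral_indicator_one_eq μ (hA j)]
  have := integral_centeredAverage_sq_le (m := m) μ hs hC (hA j) (hd j)
  linarith

end Histogram

/-! ### The spacing profile and the constant 3/4 -/

section Profile

/-- The integrand of `spacingProfile`. -/
noncomputable def spacingIntegrand (m : ℕ) (d w : ℝ) : ℝ := (1 - w) ^ m * (max (w - d) 0 / w)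

theorem spacingIntegrand_nonneg (m : ℕ) (d : ℝ) {w : ℝ} (hw : w ∈ Icc (0 : ℝ) 1) :
    0 ≤ spacingIntegrand m d w := by
  have h1 := hw.1
  have : 0 ≤ 1 - w := sub_nonneg.mpr hw.2
  unfold spacingIntegrand
  positivity

theorem spacingIntegrand_le (m : ℕ) {d w : ℝ} (hd : 0 ≤ d) (hw : w ∈ Icc (0 : ℝ) 1) :
    spacingIntegrand m d w ≤ 1 := by
  have h1 := hw.1
  have h2 : 0 ≤ 1 - w := sub_nonneg.mpr hw.2
  refine mul_le_one₀ (pow_le_one₀ h2 (by linarith)) (by positivity) ?_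
  exact div_le_one_of_le₀ (max_le (by linarith) h1) h1

theorem measurable_spacingIntegrand (m : ℕ) :
    Measurable fun p : ℝ × ℝ => spacingIntegrand m p.1 p.2 := by
  unfold spacingIntegrand; fun_prop

/-- An upper bound for the expectation of the sum of `1 / |A|` over the interior cells `A` of a
uniform partition with `m + 2` points that contain two given points at distance `d`. -/
noncomputable def spacingProfile (m : ℕ) (d : ℝ) : ℝ :=
  ((m : ℝ) + 2) * ((m : ℝ) + 1) * ∫ w in Icc (0 : ℝ) 1, spacingIntegrand m d w

theorem integrableOn_spacingIntegrand (m : ℕ) {d : ℝ} (hd : 0 ≤ d) :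
    IntegrableOn (spacingIntegrand m d) (Icc 0 1) := by
  refine Integrable.of_bound (C := 1)
    ((measurable_spacingIntegrand m).comp measurable_prodMk_left).aestronglyMeasurable ?_
  filter_upwards [ae_restrict_mem measurableSet_Icc] with w hw
  rw [Real.norm_eq_abs, abs_of_nonneg (spacingIntegrand_nonneg m d hw)]
  exact spacingIntegrand_le m hd hw

theorem spacingProfile_nonneg (m : ℕ) (d : ℝ) : 0 ≤ spacingProfile m d :=
  mul_nonneg (by positivity)
    (setIntegral_nonneg measurableSet_Icc fun _ hw => spacingIntegrand_nonneg m d hw)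

theorem measurable_spacingProfile (m : ℕ) : Measurable (spacingProfile m) :=
  (StronglyMeasurable.integral_prod_right (f := fun d w => spacingIntegrand m d w)
    (measurable_spacingIntegrand m).stronglyMeasurable).measurable.const_mul _

theorem integral_one_sub_pow (m : ℕ) (d : ℝ) :
    ∫ w in d..1, (1 - w) ^ m = (1 - d) ^ (m + 1) / ((m : ℝ) + 1) := by
  rw [intervalIntegral.integral_comp_sub_left (fun w => w ^ m) 1, integral_pow]
  simp

/-- For d < w ≤ 1 one has (w - d)/w ≤ 1 - d. The remaining integral of (1 - w)^m is explicit, and 1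
- d ≤ exp(-d). -/
theorem spacingProfile_le (m : ℕ) {d : ℝ} (hd : d ∈ Icc (0 : ℝ) 1) :
    spacingProfile m d ≤ ((m : ℝ) + 2) * Real.exp (-(((m : ℝ) + 2) * d)) := by
  have h1 : ∫ w in Icc (0 : ℝ) 1, spacingIntegrand m d w ≤
      (1 - d) * ((1 - d) ^ (m + 1) / ((m : ℝ) + 1)) := by
    rw [← integral_one_sub_pow, intervalIntegral.integral_of_le hd.2, ← integral_const_mul,
      ← integral_indicator measurableSet_Icc, ← integral_indicator measurableSet_Ioc]
    refine integral_mono_of_nonneg (.of_forall fun w => ?_) ?_ (.of_forall fun w => ?_)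
    · exact indicator_nonneg (fun w hw => spacingIntegrand_nonneg m d hw) w
    · rw [integrable_indicator_iff measurableSet_Ioc]
      exact (Continuous.integrableOn_Icc (by fun_prop)).mono_set Ioc_subset_Icc_self
    · by_cases hw : w ∈ Icc (0 : ℝ) 1
      · by_cases hwd : d < w
        · have hw0 : 0 < w := hd.1.trans_lt hwd
          simp only [hw, indicator_of_mem, mem_Ioc, hwd, hw.2, and_self, spacingIntegrand]
          rw [mul_comm]
          refine mul_le_mul_of_nonneg_right ?_ (pow_nonneg (sub_nonneg.mpr hw.2) _)
          rw [max_eq_left (by linarith), div_le_iff₀ hw0]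
          nlinarith [hd.1, hw.2]
        · have : w ∉ Ioc d 1 := fun h => hwd h.1
          simp only [hw, this, indicator_of_mem, indicator_of_notMem, not_false_iff,
            spacingIntegrand]
          rw [max_eq_right (by linarith)]
          simp
      · have : w ∉ Ioc d 1 := fun h => hw ⟨hd.1.trans h.1.le, h.2⟩
        simp [hw, this]
  calc spacingProfile m d ≤ ((m : ℝ) + 2) * ((m : ℝ) + 1) *
        ((1 - d) * ((1 - d) ^ (m + 1) / ((m : ℝ) + 1))) := by
        unfold spacingProfile; gcongr
    _ = ((m : ℝ) + 2) * (1 - d) ^ (m + 2) := by field_simp; ring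
    _ ≤ ((m : ℝ) + 2) * Real.exp (-d) ^ (m + 2) := by
        have := sub_nonneg.mpr hd.2
        gcongr
        have := Real.add_one_le_exp (-d)
        linarith
    _ = _ := by
        rw [← Real.exp_nat_mul]; push_cast; ring_nf

theorem integral_spacingIntegrand_left (m : ℕ) {w : ℝ} (hw : w ∈ Icc (0 : ℝ) 1) :
    ∫ d in Icc (0 : ℝ) 1, spacingIntegrand m d w = (1 - w) ^ m * w / 2 := by
  unfold spacingIntegrand
  rw [integral_const_mul, integral_div]
  have : ∫ d in Icc (0 : ℝ) 1, max (w - d) 0 = w ^ 2 / 2 := by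
    rw [integral_Icc_eq_integral_Ioc, ← intervalIntegral.integral_of_le zero_le_one,
      ← intervalIntegral.integral_add_adjacent_intervals (b := w)
        (Continuous.intervalIntegrable (by fun_prop) _ _)
        (Continuous.intervalIntegrable (by fun_prop) _ _)]
    have e1 : ∫ d in (0 : ℝ)..w, max (w - d) 0 = ∫ d in (0 : ℝ)..w, (w - d) := by
      refine intervalIntegral.integral_congr fun d hd => ?_
      rw [uIcc_of_le hw.1] at hd
      exact max_eq_left (sub_nonneg.mpr hd.2)
    have e2 : ∫ d in w..1, max (w - d) 0 = ∫ d in w..1, (0 : ℝ) := by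
      refine intervalIntegral.integral_congr fun d hd => ?_
      rw [uIcc_of_le hw.2] at hd
      exact max_eq_right (sub_nonpos.mpr hd.1)
    rw [e1, e2, intervalIntegral.integral_sub (by simp) (by simp)]
    simp
    ring
  rw [this]
  rcases hw.1.eq_or_lt with h | h
  · simp [← h]
  · field_simp

/-- Integrating over `d` first replaces (w - d)⁺/w by w/2. Then the Beta integral of (1 - w)^m w
equals 1/((m+1)(m+2)) and cancels the prefactor. -/
theorem integral_spacingProfile (m : ℕ) :
    ∫ d in Icc (0 : ℝ) 1, spacingProfile m d = 1 / 2 := by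
  unfold spacingProfile
  rw [integral_const_mul, integral_integral_swap]
  · have : ∫ w in Icc (0 : ℝ) 1, ∫ d in Icc (0 : ℝ) 1, spacingIntegrand m d w =
        ∫ w in Icc (0 : ℝ) 1, ((1 - w) ^ m - (1 - w) ^ (m + 1)) / 2 := by
      refine setIntegral_congr_fun measurableSet_Icc fun w hw => ?_
      rw [integral_spacingIntegrand_left m hw]
      ring
    rw [this, integral_Icc_eq_integral_Ioc, ← intervalIntegral.integral_of_le zero_le_one,
      intervalIntegral.integral_div, intervalIntegral.integral_sub
        (Continuous.intervalIntegrable (by fun_prop) _ _)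
        (Continuous.intervalIntegrable (by fun_prop) _ _), integral_one_sub_pow,
      integral_one_sub_pow]
    push_cast
    simp
    field_simp
    ring
  · refine Integrable.of_bound (C := 1)
      (measurable_spacingIntegrand m).aestronglyMeasurable ?_
    rw [Measure.prod_restrict]
    filter_upwards [ae_restrict_mem (measurableSet_Icc.prod measurableSet_Icc)] with p hp
    simp only [Function.uncurry]
    rw [Real.norm_eq_abs, abs_of_nonneg (spacingIntegrand_nonneg m _ hp.2)]
    exact spacingIntegrand_le m hp.1.1 hp.2

theorem spacingProfile_le_const (m : ℕ) {d : ℝ} (hd : d ∈ Icc (0 : ℝ) 1) :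
    spacingProfile m d ≤ (m : ℝ) + 2 := by
  refine (spacingProfile_le m hd).trans (mul_le_of_le_one_right (by positivity) ?_)
  rw [Real.exp_le_one_iff]
  have := hd.1
  have : 0 ≤ ((m : ℝ) + 2) * d := by positivity
  linarith

theorem integrableOn_spacingProfile (m : ℕ) :
    IntegrableOn (spacingProfile m) (Icc 0 1) := by
  refine Integrable.of_bound (C := (m : ℝ) + 2)
    (measurable_spacingProfile m).aestronglyMeasurable ?_
  filter_upwards [ae_restrict_mem measurableSet_Icc] with d hd
  rw [Real.norm_eq_abs, abs_of_nonneg (spacingProfile_nonneg m d)]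
  exact spacingProfile_le_const m hd

theorem integrableOn_spacingProfile_sq (m : ℕ) :
    IntegrableOn (fun d => spacingProfile m d ^ 2) (Icc 0 1) := by
  refine Integrable.of_bound (C := ((m : ℝ) + 2) ^ 2)
    ((measurable_spacingProfile m).pow_const 2).aestronglyMeasurable ?_
  filter_upwards [ae_restrict_mem measurableSet_Icc] with d hd
  rw [Real.norm_eq_abs, abs_pow, abs_of_nonneg (spacingProfile_nonneg m d)]
  gcongr
  · exact spacingProfile_nonneg m d
  · exact spacingProfile_le_const m hd

theorem integral_exp_neg_mul (c : ℝ) (hc : c ≠ 0) (b : ℝ) :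
    ∫ d in (0 : ℝ)..b, Real.exp (-(c * d)) = (1 - Real.exp (-(c * b))) / c := by
  have h : ∀ d : ℝ, HasDerivAt (fun d => -Real.exp (-(c * d)) / c) (Real.exp (-(c * d))) d := by
    intro d
    have h1 : HasDerivAt (fun d : ℝ => -(c * d)) (-c) d := by
      simpa using ((hasDerivAt_id d).const_mul c).fun_neg
    exact (h1.exp.fun_neg.div_const c).congr_deriv (by field_simp)
  rw [intervalIntegral.integral_eq_sub_of_hasDerivAt (fun d _ => h d)
    (Continuous.intervalIntegrable (by fun_prop) _ _)]
  simp
  ring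

/-- Only two facts on the profile g enter: g(d) ≤ k exp(-kd) and ∫ g = 1/2. The square is at most
(k/2) g plus an explicit excess, supported where k exp(-kd) ≥ k/2. This yields 2(k/4 + k/8) = 3k/4.
-/
theorem integral_spacingProfile_sq_le (m : ℕ) :
    2 * ∫ d in Icc (0 : ℝ) 1, spacingProfile m d ^ 2 ≤ 3 / 4 * ((m : ℝ) + 2) := by
  set k : ℝ := (m : ℝ) + 2 with hk
  have hk0 : 0 < k := by positivity
  have hk2 : 2 ≤ k := by rw [hk]; linarith [(Nat.cast_nonneg m : (0 : ℝ) ≤ m)]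
  -- This is the point where exp(-kd) falls to 1/2, so it marks the end of the excess region.
  set c : ℝ := Real.log 2 / k with hc
  have hc0 : 0 < c := div_pos (Real.log_pos one_lt_two) hk0
  set f : ℝ → ℝ := fun d => Real.exp (-(2 * k * d)) - 1 / 2 * Real.exp (-(k * d)) with hf
  have hfc : Continuous f := by fun_prop
  -- With E = exp(-kd) and g ≤ kE: g² ≤ kE g = (k/2) g + k(E - 1/2) g. The last term is at most
  -- k²(E² - E/2) when E ≥ 1/2, and can be dropped when E ≤ 1/2.
  have hpt : ∀ d ∈ Icc (0 : ℝ) 1, spacingProfile m d ^ 2 ≤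
      k / 2 * spacingProfile m d + k ^ 2 * (Icc 0 c).indicator f d := by
    intro d hd
    have h1 := spacingProfile_le m hd
    have h0 := spacingProfile_nonneg m d
    rw [← hk] at h1
    set E := Real.exp (-(k * d)) with hE
    have hE0 : 0 < E := Real.exp_pos _
    have e2 : Real.exp (-(2 * k * d)) = E ^ 2 := by
      rw [hE, ← Real.exp_nat_mul]; push_cast; ring_nf
    have hfd : f d = E ^ 2 - 1 / 2 * E := by rw [hf]; simp only [e2]; rw [hE]
    have h3 : spacingProfile m d ^ 2 ≤ k * E * spacingProfile m d := by nlinarith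
    have hlog : Real.exp (-Real.log 2) = 1 / 2 := by
      rw [Real.exp_neg, Real.exp_log two_pos]; norm_num
    by_cases hdc : d ≤ c
    · have hE2 : 1 / 2 ≤ E := by
        rw [← hlog, hE, Real.exp_le_exp, neg_le_neg_iff]
        rw [hc, le_div_iff₀ hk0] at hdc
        linarith
      have hs : k ^ 2 * (Icc 0 c).indicator f d =
          k ^ 2 * (E ^ 2 - 1 / 2 * E) := by
        simp [hdc, hd.1, hfd]
      rw [hs]
      have := mul_le_mul_of_nonneg_left h1 (mul_nonneg hk0.le (sub_nonneg.mpr hE2))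
      nlinarith
    · have hE2 : E ≤ 1 / 2 := by
        rw [← hlog, hE, Real.exp_le_exp, neg_le_neg_iff]
        rw [hc, not_le, div_lt_iff₀ hk0] at hdc
        linarith
      have hs : k ^ 2 * (Icc 0 c).indicator f d = 0 := by
        simp [hdc]
      rw [hs]
      nlinarith [mul_nonneg hk0.le h0]
  have hfI : Integrable ((Icc 0 c).indicator f) := by
    rw [integrable_indicator_iff measurableSet_Icc]
    exact hfc.integrableOn_Icc
  -- At the cut-off the exponentials are 1/4 and 1/2, so the value is 3/(8k) - 1/(4k).
  have hcint : ∫ d in Icc (0 : ℝ) 1, (Icc 0 c).indicator f d = 1 / (8 * k) := by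
    have hc1 : c ≤ 1 := by
      rw [hc, div_le_one hk0]
      have := Real.log_two_lt_d9
      linarith
    have hsub : Icc (0 : ℝ) 1 ∩ Icc 0 c = Icc 0 c :=
      inter_eq_right.mpr fun d hd => ⟨hd.1, hd.2.trans hc1⟩
    rw [setIntegral_indicator measurableSet_Icc, hsub, integral_Icc_eq_integral_Ioc, ← intervalIntegral.integral_of_le hc0.le,
      hf, intervalIntegral.integral_sub (Continuous.intervalIntegrable (by fun_prop) _ _)
        (Continuous.intervalIntegrable (by fun_prop) _ _), intervalIntegral.integral_const_mul,
      integral_exp_neg_mul _ (by positivity), integral_exp_neg_mul _ (by positivity)]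
    have e1 : Real.exp (-(k * c)) = 1 / 2 := by
      rw [hc, mul_div_cancel₀ _ hk0.ne', Real.exp_neg, Real.exp_log two_pos]; norm_num
    have e2 : Real.exp (-(2 * k * c)) = 1 / 4 := by
      rw [show -(2 * k * c) = ((2 : ℕ) : ℝ) * (-(k * c)) by push_cast; ring, Real.exp_nat_mul, e1]
      norm_num
    rw [e1, e2]
    field_simp
    norm_num
  have hI := integrableOn_spacingProfile m
  calc 2 * ∫ d in Icc (0 : ℝ) 1, spacingProfile m d ^ 2
      ≤ 2 * ∫ d in Icc (0 : ℝ) 1, (k / 2 * spacingProfile m d +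
          k ^ 2 * (Icc 0 c).indicator f d) := by
        refine mul_le_mul_of_nonneg_left (setIntegral_mono_on (integrableOn_spacingProfile_sq m)
          ?_ measurableSet_Icc hpt) zero_le_two
        exact (hI.const_mul _).add (hfI.integrableOn.const_mul _)
    _ = 3 / 4 * k := by
        rw [integral_add (hI.const_mul _) (hfI.integrableOn.const_mul _), integral_const_mul,
          integral_const_mul, hcint, integral_spacingProfile]
        field_simp
        norm_num

end Profile

/-! ### Mean overlap of two independent uniform partitions -/

section Uniform

/-- The uniform distribution on `[0,1]`. -/
noncomputable abbrev unif : Measure ℝ := volume.restrict (Icc (0 : ℝ) 1)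

instance : IsProbabilityMeasure unif := ⟨by simp [unif]⟩

theorem ae_pi_mem (k : ℕ) :
    ∀ᵐ u ∂(Measure.pi fun _ : Fin k => unif), ∀ i, u i ∈ Icc (0 : ℝ) 1 := by
  rw [ae_all_iff]
  intro i
  exact (measurePreserving_eval (fun _ : Fin k => unif) i).quasiMeasurePreserving.ae
    (ae_restrict_mem measurableSet_Icc)

theorem lintegral_pi_isolate {m : ℕ} (μ : Measure ℝ) [IsProbabilityMeasure μ] (i : Fin (m + 1))
    {F : ℝ × (Fin m → ℝ) → ℝ≥0∞} (hF : Measurable F) :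
    ∫⁻ x : Fin (m + 1) → ℝ, F (x i, i.removeNth x) ∂Measure.pi (fun _ => μ) =
      ∫⁻ a, ∫⁻ y, F (a, y) ∂(Measure.pi fun _ => μ) ∂μ := by
  rw [← lintegral_prod _ hF.aemeasurable]
  exact (measurePreserving_piFinSuccAbove (fun _ : Fin (m + 1) => μ) i).lintegral_comp_emb
    (MeasurableEquiv.measurableEmbedding _) F

open Classical in
/-- The inverse of the distance of `l` and `r` if `l < x`, `y ≤ r` and none of the points `z t`
is between `l` and `r`. -/
noncomputable def gapTerm {m : ℕ} (x y l r : ℝ) (z : Fin m → ℝ) : ℝ≥0∞ :=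
  if l < x ∧ y ≤ r ∧ l ≤ r ∧ ∀ t, z t ∉ Ioo l r then ENNReal.ofReal (r - l)⁻¹ else 0

theorem measurable_gapTerm {m : ℕ} (x y : ℝ) {α : Type*} [MeasurableSpace α] {l r : α → ℝ}
    {z : α → Fin m → ℝ} (hl : Measurable l) (hr : Measurable r) (hz : Measurable z) :
    Measurable fun a => gapTerm x y (l a) (r a) (z a) := by
  unfold gapTerm
  refine Measurable.ite ?_ (by fun_prop) measurable_const
  refine (measurableSet_lt hl measurable_const).inter
    ((measurableSet_le measurable_const hr).inter ((measurableSet_le hl hr).inter ?_))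
  have : {a | ∀ t, z a t ∉ Ioo (l a) (r a)} =
      ⋂ t, ({a | l a < z a t} ∩ {a | z a t < r a})ᶜ := by
    ext a
    simp
  have hzt : ∀ t, Measurable fun a => z a t := fun t => (measurable_pi_apply t).comp hz
  have h := MeasurableSet.iInter fun t =>
    ((measurableSet_lt hl (hzt t)).inter (measurableSet_lt (hzt t) hr)).compl
  rw [← this] at h
  exact h

/-- The weight of a gap of length `w`. -/
noncomputable def gapWeight (m : ℕ) (w : ℝ) : ℝ≥0∞ :=
  (Icc (0 : ℝ) 1).indicator (fun w => ENNReal.ofReal ((1 - w) ^ m * w⁻¹)) w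

theorem measurable_gapWeight (m : ℕ) : Measurable (gapWeight m) :=
  Measurable.indicator (by fun_prop) measurableSet_Icc

theorem lintegral_gapTerm_le (m : ℕ) (x y : ℝ) {l r : ℝ} (hl : l ∈ Icc (0 : ℝ) 1)
    (hr : r ∈ Icc (0 : ℝ) 1) :
    ∫⁻ z : Fin m → ℝ, gapTerm x y l r z ∂(Measure.pi fun _ => unif) ≤
      (Iio x).indicator (fun _ => 1) l * ((Ici y).indicator (fun _ => 1) r *
        gapWeight m (r - l)) := by
  by_cases h : l < x ∧ y ≤ r ∧ l ≤ r
  · obtain ⟨h1, h2, h3⟩ := h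
    have hw : r - l ∈ Icc (0 : ℝ) 1 := ⟨sub_nonneg.mpr h3, by linarith [hl.1, hr.2]⟩
    have e : ∀ z : Fin m → ℝ, gapTerm x y l r z =
        (univ.pi fun _ => (Ioo l r)ᶜ).indicator (fun _ => ENNReal.ofReal (r - l)⁻¹) z := by
      intro z
      by_cases hz : ∀ t, z t ∉ Ioo l r
      · have hz' : z ∈ univ.pi fun _ => (Ioo l r)ᶜ := fun t _ => hz t
        simp only [gapTerm, h1, h2, h3, true_and, hz', indicator_of_mem]
        exact if_pos hz
      · have hz' : z ∉ univ.pi fun _ => (Ioo l r)ᶜ := fun h => hz fun t => h t trivial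
        simp only [gapTerm, h1, h2, h3, true_and, hz', indicator_of_notMem, not_false_iff]
        exact if_neg hz
    have hvol : unif (Ioo l r)ᶜ = ENNReal.ofReal (1 - (r - l)) := by
      rw [prob_compl_eq_one_sub measurableSet_Ioo, unif, Measure.restrict_apply measurableSet_Ioo,
        inter_eq_left.mpr (show Ioo l r ⊆ Icc 0 1 from fun a ha =>
          ⟨hl.1.trans ha.1.le, ha.2.le.trans hr.2⟩),
        Real.volume_Ioo,
        ENNReal.ofReal_sub _ hw.1, ENNReal.ofReal_one]
    simp_rw [e]
    rw [lintegral_indicator_const (MeasurableSet.univ_pi fun _ => measurableSet_Ioo.compl),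
      Measure.pi_pi, Finset.prod_const, hvol, Finset.card_univ, Fintype.card_fin]
    simp only [mem_Iio, h1, mem_Ici, h2, indicator_of_mem, one_mul, gapWeight, hw]
    rw [ENNReal.ofReal_mul (pow_nonneg (sub_nonneg.mpr hw.2) _), ENNReal.ofReal_pow
      (sub_nonneg.mpr hw.2), mul_comm]
  · have e : ∀ z : Fin m → ℝ, gapTerm x y l r z = 0 := fun z =>
      if_neg fun h' => h ⟨h'.1, h'.2.1, h'.2.2.1⟩
    simp [e]

/-- With w = r - l as a variable, the admissible left endpoints are those in [y - w, x), a set of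
length (w - (y - x))⁺. The constraint that both endpoints lie in [0,1] is relaxed to 0 ≤ w ≤ 1,
which costs the equality. -/
theorem lintegral_lintegral_gapTerm_le (m : ℕ) {x y : ℝ} (hxy : x ≤ y) :
    ∫⁻ l, ∫⁻ r, ∫⁻ z : Fin m → ℝ, gapTerm x y l r z ∂(Measure.pi fun _ => unif) ∂unif ∂unif ≤
      ENNReal.ofReal (∫ w in Icc (0 : ℝ) 1, spacingIntegrand m (y - x) w) := by
  have hm : Measurable fun p : ℝ × ℝ => (Iio x).indicator (fun _ => (1 : ℝ≥0∞)) p.1 *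
      ((Ici y).indicator (fun _ => 1) (p.2 + p.1) * gapWeight m p.2) :=
    ((measurable_const.indicator measurableSet_Iio).comp measurable_fst).mul
      (((measurable_const.indicator measurableSet_Ici).comp
        (measurable_snd.add measurable_fst)).mul ((measurable_gapWeight m).comp measurable_snd))
  calc ∫⁻ l, ∫⁻ r, ∫⁻ z : Fin m → ℝ, gapTerm x y l r z ∂(Measure.pi fun _ => unif) ∂unif ∂unif
      ≤ ∫⁻ l, ∫⁻ r, (Iio x).indicator (fun _ => 1) l * ((Ici y).indicator (fun _ => 1) r *
        gapWeight m (r - l)) := by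
        refine le_trans (setLIntegral_mono' measurableSet_Icc fun l hl => ?_)
          (setLIntegral_le_lintegral _ _)
        exact le_trans (setLIntegral_mono' measurableSet_Icc fun r hr =>
          lintegral_gapTerm_le m x y hl hr) (setLIntegral_le_lintegral _ _)
    _ = ∫⁻ l, ∫⁻ w, (Iio x).indicator (fun _ => 1) l * ((Ici y).indicator (fun _ => 1) (w + l) *
        gapWeight m w) := by
        refine lintegral_congr fun l => ?_
        rw [← lintegral_sub_right_eq_self (fun w => (Iio x).indicator (fun _ => (1 : ℝ≥0∞)) l *
          ((Ici y).indicator (fun _ => 1) (w + l) * gapWeight m w)) l]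
        simp only [sub_add_cancel]
    _ = ∫⁻ w, ∫⁻ l, (Iio x).indicator (fun _ => 1) l * ((Ici y).indicator (fun _ => 1) (w + l) *
        gapWeight m w) := lintegral_lintegral_swap hm.aemeasurable
    _ = ∫⁻ w, (Icc (0 : ℝ) 1).indicator
          (fun w => ENNReal.ofReal (spacingIntegrand m (y - x) w)) w := by
        refine lintegral_congr fun w => ?_
        have e : ∀ l, (Iio x).indicator (fun _ => (1 : ℝ≥0∞)) l *
            ((Ici y).indicator (fun _ => 1) (w + l) * gapWeight m w) =
            (Ico (y - w) x).indicator (fun _ => gapWeight m w) l := by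
          intro l
          by_cases h1 : l < x <;> by_cases h2 : y ≤ w + l
          · have : y - w ≤ l := by linarith
            simp [h1, h2, this]
          · have : ¬ (y - w ≤ l) := fun h => h2 (by linarith)
            simp [h2, this]
          · simp [h1]
          · simp [h1]
        simp_rw [e]
        rw [lintegral_indicator_const measurableSet_Ico, Real.volume_Ico, gapWeight]
        by_cases hw : w ∈ Icc (0 : ℝ) 1
        · simp only [hw, indicator_of_mem]
          have hw0 : 0 ≤ (1 - w) ^ m * w⁻¹ :=
            mul_nonneg (pow_nonneg (sub_nonneg.mpr hw.2) _) (inv_nonneg.mpr hw.1)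
          rw [← ENNReal.ofReal_mul hw0, spacingIntegrand]
          rcases le_total 0 (x - (y - w)) with h | h
          · rw [max_eq_left (by linarith)]
            congr 1
            rw [div_eq_mul_inv]
            ring
          · rw [max_eq_right (by linarith), ENNReal.ofReal_of_nonpos (mul_nonpos_of_nonneg_of_nonpos hw0 h)]
            simp
        · simp [hw]
    _ = _ := by
        rw [lintegral_indicator measurableSet_Icc, ofReal_integral_eq_lintegral_ofReal
          (integrableOn_spacingIntegrand m (sub_nonneg.mpr hxy))]
        filter_upwards [ae_restrict_mem measurableSet_Icc] with w hw
        exact spacingIntegrand_nonneg m _ hw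

/-- The function `1 / |A|` of the pairs of points in the cell `A = (a, b]`. -/
noncomputable def cellKernel (a b : ℝ) (p : ℝ × ℝ) : ℝ≥0∞ :=
  (Ioc a b ×ˢ Ioc a b).indicator (fun _ => ENNReal.ofReal (b - a)⁻¹) p

theorem measurable_cellKernel {α : Type*} [MeasurableSpace α] {a b : α → ℝ} {p : α → ℝ × ℝ}
    (ha : Measurable a) (hb : Measurable b) (hp : Measurable p) :
    Measurable fun t => cellKernel (a t) (b t) (p t) := by
  have : (fun t => cellKernel (a t) (b t) (p t)) =
      ((({t | a t < (p t).1} ∩ {t | (p t).1 ≤ b t}) ∩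
        ({t | a t < (p t).2} ∩ {t | (p t).2 ≤ b t})).indicator
        fun t => ENNReal.ofReal (b t - a t)⁻¹) := by
    ext t
    simp only [cellKernel, indicator, mem_prod, mem_Ioc, mem_inter_iff, mem_ofPred_eq]
  rw [this]
  exact Measurable.indicator (by fun_prop)
    (((measurableSet_lt ha hp.fst).inter (measurableSet_le hp.fst hb)).inter
      ((measurableSet_lt ha hp.snd).inter (measurableSet_le hp.snd hb)))

theorem cellKernel_swap (a b x y : ℝ) : cellKernel a b (x, y) = cellKernel a b (y, x) := by
  simp only [cellKernel, indicator, mem_prod, and_comm]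

/-- The sum of the `cellKernel` over the interior cells. -/
noncomputable def interiorKernel {k : ℕ} (u : Fin k → ℝ) (p : ℝ × ℝ) : ℝ≥0∞ :=
  ∑ i ∈ Finset.range (k - 1), cellKernel (orderStat u (i + 1)) (orderStat u (i + 2)) p

theorem measurable_interiorKernel (k : ℕ) :
    Measurable fun q : (Fin k → ℝ) × (ℝ × ℝ) => interiorKernel q.1 q.2 :=
  Finset.measurable_sum _ fun _ _ => measurable_cellKernel
    ((measurable_orderStat _).comp measurable_fst) ((measurable_orderStat _).comp measurable_fst)
    measurable_snd

/-- The endpoints `u a` and `u b` are isolated one after the other. Only the `m` remaining points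
are then required to avoid the gap, which is all that the integral over them uses. -/
theorem lintegral_gapTerm_pair_le (m : ℕ) {x y : ℝ} (hxy : x ≤ y) {a b : Fin (m + 2)}
    (hab : b ≠ a) :
    ∫⁻ u : Fin (m + 2) → ℝ, gapTerm x y (u a) (u b) u ∂(Measure.pi fun _ => unif) ≤
      ENNReal.ofReal (∫ w in Icc (0 : ℝ) 1, spacingIntegrand m (y - x) w) := by
  obtain ⟨b', rfl⟩ := Fin.exists_succAbove_eq hab
  calc _ ≤ ∫⁻ u : Fin (m + 2) → ℝ, (fun q : ℝ × (Fin (m + 1) → ℝ) =>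
        gapTerm x y q.1 (q.2 b') (b'.removeNth q.2)) (u a, a.removeNth u)
          ∂(Measure.pi fun _ => unif) := by
        refine lintegral_mono fun u => ?_
        simp only [gapTerm]
        by_cases h : u a < x ∧ y ≤ u (a.succAbove b') ∧ u a ≤ u (a.succAbove b') ∧
            ∀ t, u t ∉ Ioo (u a) (u (a.succAbove b'))
        · rw [if_pos h, if_pos]
          · rfl
          · exact ⟨h.1, h.2.1, h.2.2.1, fun t => h.2.2.2 _⟩
        · rw [if_neg h]
          exact zero_le
    _ = ∫⁻ l, ∫⁻ y' : Fin (m + 1) → ℝ, (fun q : ℝ × (Fin m → ℝ) => gapTerm x y l q.1 q.2)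
          (y' b', b'.removeNth y') ∂(Measure.pi fun _ => unif) ∂unif :=
        lintegral_pi_isolate unif a (measurable_gapTerm x y measurable_fst
          ((measurable_pi_apply _).comp measurable_snd)
          ((measurable_removeNth b').comp measurable_snd))
    _ = ∫⁻ l, ∫⁻ r, ∫⁻ z : Fin m → ℝ, gapTerm x y l r z
          ∂(Measure.pi fun _ => unif) ∂unif ∂unif := by
        refine lintegral_congr fun l => ?_
        exact lintegral_pi_isolate unif b' (measurable_gapTerm x y measurable_const
          measurable_fst measurable_snd)
    _ ≤ _ := lintegral_lintegral_gapTerm_le m hxy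

theorem lintegral_interiorKernel_le_of_le (m : ℕ) {x y : ℝ} (hxy : x ≤ y) :
    ∫⁻ u : Fin (m + 2) → ℝ, interiorKernel u (x, y) ∂(Measure.pi fun _ => unif) ≤
      ENNReal.ofReal (spacingProfile m (y - x)) := by
  set c := ENNReal.ofReal (∫ w in Icc (0 : ℝ) 1, spacingIntegrand m (y - x) w) with hc
  calc _ ≤ ∫⁻ u : Fin (m + 2) → ℝ, ∑ a, ∑ b ∈ Finset.univ.erase a, gapTerm x y (u a) (u b) u
        ∂(Measure.pi fun _ => unif) := by
        refine lintegral_mono_ae ?_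
        filter_upwards [ae_pi_mem (m + 2)] with u hu
        refine sum_interior_le u hu (fun a b => cellKernel a b (x, y))
          (fun a b => gapTerm x y (u a) (u b) u) (fun _ _ => zero_le) fun a b _ hab hn => ?_
        simp only [cellKernel, indicator, mem_prod, mem_Ioc, gapTerm]
        by_cases h : (u a < x ∧ x ≤ u b) ∧ u a < y ∧ y ≤ u b
        · rw [if_pos h, if_pos ⟨h.1.1, h.2.2, hab, hn⟩]
        · rw [if_neg h]
          exact zero_le
    _ = ∑ a, ∑ b ∈ Finset.univ.erase a, ∫⁻ u : Fin (m + 2) → ℝ, gapTerm x y (u a) (u b) u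
        ∂(Measure.pi fun _ => unif) := by
        have hm : ∀ a b : Fin (m + 2), Measurable fun u : Fin (m + 2) → ℝ =>
            gapTerm x y (u a) (u b) u := fun a b =>
          measurable_gapTerm x y (measurable_pi_apply a) (measurable_pi_apply b) measurable_id
        rw [lintegral_finsetSum _ fun a _ => Finset.measurable_sum _ fun b _ => hm a b]
        exact Finset.sum_congr rfl fun a _ => lintegral_finsetSum _ fun b _ => hm a b
    -- All (m + 2)(m + 1) ordered pairs of distinct points obey the same bound. Their number is the
    -- prefactor in `spacingProfile`.
    _ ≤ ∑ _a : Fin (m + 2), ∑ _b ∈ Finset.univ.erase _a, c :=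
        Finset.sum_le_sum fun a _ => Finset.sum_le_sum fun b hb =>
          lintegral_gapTerm_pair_le m hxy (Finset.ne_of_mem_erase hb)
    _ = _ := by
        simp only [Finset.sum_const, Finset.card_erase_of_mem (Finset.mem_univ _),
          Finset.card_univ, Fintype.card_fin, nsmul_eq_mul]
        rw [hc, spacingProfile, ENNReal.ofReal_mul (by positivity),
          ENNReal.ofReal_mul (by positivity), ← mul_assoc]
        congr 2
        · rw [show (m : ℝ) + 2 = ((m + 2 : ℕ) : ℝ) by push_cast; ring, ENNReal.ofReal_natCast]
        · rw [show (m : ℝ) + 1 = ((m + 1 : ℕ) : ℝ) by push_cast; ring, ENNReal.ofReal_natCast]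
          simp

theorem lintegral_interiorKernel_le (m : ℕ) (x y : ℝ) :
    ∫⁻ u : Fin (m + 2) → ℝ, interiorKernel u (x, y) ∂(Measure.pi fun _ => unif) ≤
      ENNReal.ofReal (spacingProfile m |y - x|) := by
  rcases le_total x y with h | h
  · rw [abs_of_nonneg (sub_nonneg.mpr h)]
    exact lintegral_interiorKernel_le_of_le m h
  · rw [abs_of_nonpos (sub_nonpos.mpr h), neg_sub]
    simp only [interiorKernel, cellKernel_swap _ _ x y]
    exact lintegral_interiorKernel_le_of_le m h

/-- For fixed `x` the distance is counted at most once on each side of `x`. Extending both sides to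
the full range of distances, by translation and reflection, gives the factor 2 of
`integral_spacingProfile_sq_le`. -/
theorem lintegral_profile_le (m : ℕ) (x : ℝ) (hx : x ∈ Icc (0 : ℝ) 1) :
    ∫⁻ y, ENNReal.ofReal (spacingProfile m |y - x|) ^ 2 ∂unif ≤
      ENNReal.ofReal (3 / 4 * ((m : ℝ) + 2)) := by
  set G : ℝ → ℝ≥0∞ := (Icc (0 : ℝ) 1).indicator
    fun d => ENNReal.ofReal (spacingProfile m d) ^ 2 with hG
  have hGm : Measurable G :=
    ((measurable_spacingProfile m).ennreal_ofReal.pow_const 2).indicator measurableSet_Icc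
  have hGi : ∫⁻ d, G d = ENNReal.ofReal (∫ d in Icc (0 : ℝ) 1, spacingProfile m d ^ 2) := by
    rw [hG, lintegral_indicator measurableSet_Icc, ofReal_integral_eq_lintegral_ofReal
      (integrableOn_spacingProfile_sq m) (.of_forall fun d => sq_nonneg _)]
    simp_rw [ENNReal.ofReal_pow (spacingProfile_nonneg m _)]
  calc _ ≤ ∫⁻ y, (G (y - x) + G (x - y)) := by
        refine le_trans (setLIntegral_mono' measurableSet_Icc fun y hy => ?_)
          (setLIntegral_le_lintegral _ _)
        rcases le_total x y with h | h
        · have : y - x ∈ Icc (0 : ℝ) 1 := ⟨sub_nonneg.mpr h, by linarith [hx.1, hy.2]⟩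
          rw [abs_of_nonneg this.1]
          refine le_trans (le_of_eq ?_) le_self_add
          simp [hG, this]
        · have : x - y ∈ Icc (0 : ℝ) 1 := ⟨sub_nonneg.mpr h, by linarith [hy.1, hx.2]⟩
          rw [abs_sub_comm, abs_of_nonneg this.1]
          refine le_trans (le_of_eq ?_) le_add_self
          simp [hG, this]
    _ = 2 * ∫⁻ d, G d := by
        rw [lintegral_add_left (f := fun y => G (y - x)) (hGm.comp (measurable_id.sub_const x)),
          lintegral_sub_right_eq_self, lintegral_sub_left_eq_self, two_mul]
    _ ≤ _ := by
        rw [hGi, show (2 : ℝ≥0∞) = ENNReal.ofReal 2 by simp, ← ENNReal.ofReal_mul zero_le_two]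
        exact ENNReal.ofReal_le_ofReal (integral_spacingProfile_sq_le m)

/-- This is where independence of the two partitions is used: by Tonelli, the mean of the product of
two independent copies of a kernel is the square of its mean, pointwise in `p`. -/
theorem lintegral_lintegral_lintegral_mul {α β : Type*} [MeasurableSpace α] [MeasurableSpace β]
    {Λ : Measure α} {ρ : Measure β} [SFinite Λ] [SFinite ρ] {K : α → β → ℝ≥0∞}
    (hK : Measurable (Function.uncurry K)) :
    ∫⁻ u, ∫⁻ v, ∫⁻ p, K u p * K v p ∂ρ ∂Λ ∂Λ = ∫⁻ p, (∫⁻ u, K u p ∂Λ) ^ 2 ∂ρ := by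
  have hp : ∀ p, Measurable fun u => K u p := fun p => hK.comp measurable_prodMk_right
  have hu : ∀ u, Measurable fun p => K u p := fun u => hK.comp measurable_prodMk_left
  set κ : β → ℝ≥0∞ := fun p => ∫⁻ v, K v p ∂Λ with hκ
  have hκm : Measurable κ := hK.lintegral_prod_left'
  calc ∫⁻ u, ∫⁻ v, ∫⁻ p, K u p * K v p ∂ρ ∂Λ ∂Λ = ∫⁻ u, ∫⁻ p, K u p * κ p ∂ρ ∂Λ := by
        refine lintegral_congr fun u => ?_
        rw [lintegral_lintegral_swap]
        · exact lintegral_congr fun p => lintegral_const_mul _ (hp p)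
        · exact (((hu u).comp measurable_snd).mul hK).aemeasurable
    _ = ∫⁻ p, κ p ^ 2 ∂ρ := by
        rw [lintegral_lintegral_swap]
        · refine lintegral_congr fun p => ?_
          rw [lintegral_mul_const _ (hp p), pow_two]
        · exact (hK.mul (hκm.comp measurable_snd)).aemeasurable

theorem lintegral_interiorKernel_mul_le (m : ℕ) :
    ∫⁻ u : Fin (m + 2) → ℝ, ∫⁻ v : Fin (m + 2) → ℝ, ∫⁻ p, interiorKernel u p * interiorKernel v p
      ∂(unif.prod unif) ∂(Measure.pi fun _ => unif) ∂(Measure.pi fun _ => unif) ≤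
      ENNReal.ofReal (3 / 4 * ((m : ℝ) + 2)) := by
  have hm : Measurable (Function.uncurry (interiorKernel (k := m + 2))) :=
    measurable_interiorKernel (m + 2)
  have hκ : Measurable fun p => ∫⁻ u : Fin (m + 2) → ℝ, interiorKernel u p
      ∂(Measure.pi fun _ => unif) := hm.lintegral_prod_left'
  rw [lintegral_lintegral_lintegral_mul hm, lintegral_prod _ (hκ.pow_const 2).aemeasurable]
  calc _ ≤ ∫⁻ _x, ENNReal.ofReal (3 / 4 * ((m : ℝ) + 2)) ∂unif := by
        refine setLIntegral_mono' measurableSet_Icc fun x hx => ?_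
        refine le_trans (lintegral_mono fun y => ?_) (lintegral_profile_le m x hx)
        exact pow_le_pow_left₀ zero_le (lintegral_interiorKernel_le m x y) 2
    _ = _ := by simp

/-- The squared length of the intersection of two interior cells of two partitions, divided by
the lengths of the cells. -/
noncomputable def overlap {k : ℕ} (u v : Fin k → ℝ) (i l : ℕ) : ℝ :=
  volume.real (cell u i ∩ cell v l) ^ 2 / (cellLength u i * cellLength v l)

theorem measurable_volume_inter {k : ℕ} (i l : ℕ) :
    Measurable fun p : (Fin k → ℝ) × (Fin k → ℝ) => volume.real (cell p.1 i ∩ cell p.2 l) := by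
  have : ∀ p : (Fin k → ℝ) × (Fin k → ℝ), volume.real (cell p.1 i ∩ cell p.2 l) =
      max (min (orderStat p.1 (i + 1)) (orderStat p.2 (l + 1)) -
        max (orderStat p.1 i) (orderStat p.2 l)) 0 := by
    intro p
    rw [cell, cell, Ioc_inter_Ioc, Real.volume_real_Ioc]
  simp_rw [this]
  have h := fun j => (measurable_orderStat (k := k) j).comp
    (measurable_fst : Measurable (Prod.fst : (Fin k → ℝ) × (Fin k → ℝ) → _))
  have h' := fun j => (measurable_orderStat (k := k) j).comp
    (measurable_snd : Measurable (Prod.snd : (Fin k → ℝ) × (Fin k → ℝ) → _))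
  exact (((h _).min (h' _)).sub ((h _).max (h' _))).max measurable_const

theorem measurable_overlap {k : ℕ} (i l : ℕ) :
    Measurable fun p : (Fin k → ℝ) × (Fin k → ℝ) => overlap p.1 p.2 i l :=
  ((measurable_volume_inter i l).pow_const 2).div
    (((measurable_cellLength i).comp measurable_fst).mul
      ((measurable_cellLength l).comp measurable_snd))

theorem overlap_nonneg {k : ℕ} {u v : Fin k → ℝ} (hu : ∀ i, u i ∈ Icc (0 : ℝ) 1)
    (hv : ∀ i, v i ∈ Icc (0 : ℝ) 1) (i l : ℕ) : 0 ≤ overlap u v i l :=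
  div_nonneg (sq_nonneg _) (mul_nonneg (cellLength_nonneg hu i) (cellLength_nonneg hv l))

/-- The product of the two kernels is constant on the square of the intersection of the cells and
zero elsewhere. The overlap is thereby linear in the kernel of each partition. -/
theorem ofReal_overlap {k : ℕ} {u v : Fin k → ℝ} (hu : ∀ i, u i ∈ Icc (0 : ℝ) 1)
    (hv : ∀ i, v i ∈ Icc (0 : ℝ) 1) (i l : ℕ) :
    ENNReal.ofReal (overlap u v i l) = ∫⁻ p, cellKernel (orderStat u i) (orderStat u (i + 1)) p *
      cellKernel (orderStat v l) (orderStat v (l + 1)) p ∂(unif.prod unif) := by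
  have e : ∀ p, cellKernel (orderStat u i) (orderStat u (i + 1)) p *
      cellKernel (orderStat v l) (orderStat v (l + 1)) p =
      ((cell u i ∩ cell v l) ×ˢ (cell u i ∩ cell v l)).indicator (fun _ =>
        ENNReal.ofReal (cellLength u i)⁻¹ * ENNReal.ofReal (cellLength v l)⁻¹) p := by
    intro p
    rw [prod_inter_prod.symm, cellKernel, cellKernel, ← cell, ← cell, ← cellLength, ← cellLength]
    by_cases h1 : p ∈ cell u i ×ˢ cell u i <;> by_cases h2 : p ∈ cell v l ×ˢ cell v l <;>
      simp only [h1, h2, indicator_of_mem, indicator_of_notMem, not_false_iff, mem_inter_iff,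
        and_true, and_false, zero_mul, mul_zero, and_self]
  have hms : MeasurableSet (cell u i ∩ cell v l) := (measurableSet_cell _ _).inter
    (measurableSet_cell _ _)
  have hvol : unif (cell u i ∩ cell v l) = ENNReal.ofReal (volume.real (cell u i ∩ cell v l)) := by
    rw [unif, Measure.restrict_apply hms,
      inter_eq_left.mpr (inter_subset_left.trans (cell_subset hu i)), ofReal_measureReal
      ((measure_mono inter_subset_left).trans_lt (by simp [cell])).ne]
  simp_rw [e]
  rw [lintegral_indicator_const (hms.prod hms), Measure.prod_prod, hvol, overlap,
    ← ENNReal.ofReal_mul measureReal_nonneg, ← ENNReal.ofReal_mul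
      (inv_nonneg.mpr (cellLength_nonneg hu i)), ← ENNReal.ofReal_mul (mul_nonneg
      (inv_nonneg.mpr (cellLength_nonneg hu i)) (inv_nonneg.mpr (cellLength_nonneg hv l)))]
  congr 1
  rw [div_eq_mul_inv, mul_inv]
  ring

theorem overlap_le_one {k : ℕ} {u v : Fin k → ℝ} (hu : ∀ i, u i ∈ Icc (0 : ℝ) 1)
    (hv : ∀ i, v i ∈ Icc (0 : ℝ) 1) (i l : ℕ) : overlap u v i l ≤ 1 := by
  have h1 : volume.real (cell u i ∩ cell v l) ≤ cellLength u i := by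
    refine (measureReal_mono inter_subset_left (by simp [cell])).trans_eq ?_
    rw [cell, Real.volume_real_Ioc_of_le (monotone_orderStat hu i.le_succ), cellLength]
  have h2 : volume.real (cell u i ∩ cell v l) ≤ cellLength v l := by
    refine (measureReal_mono inter_subset_right (by simp [cell])).trans_eq ?_
    rw [cell, Real.volume_real_Ioc_of_le (monotone_orderStat hv l.le_succ), cellLength]
  refine div_le_one_of_le₀ ?_ (mul_nonneg (cellLength_nonneg hu i) (cellLength_nonneg hv l))
  rw [pow_two]
  exact mul_le_mul h1 h2 measureReal_nonneg (cellLength_nonneg hu i)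

/-- The sum of the overlaps of the interior cells. -/
noncomputable def interiorOverlap {k : ℕ} (u v : Fin k → ℝ) : ℝ :=
  ∑ i ∈ Finset.range (k - 1), ∑ l ∈ Finset.range (k - 1), overlap u v (i + 1) (l + 1)

theorem integral_interiorOverlap_le (m : ℕ) :
    Integrable (fun p : (Fin (m + 2) → ℝ) × (Fin (m + 2) → ℝ) => interiorOverlap p.1 p.2)
      ((Measure.pi fun _ => unif).prod (Measure.pi fun _ => unif)) ∧
    ∫ p : (Fin (m + 2) → ℝ) × (Fin (m + 2) → ℝ), interiorOverlap p.1 p.2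
      ∂((Measure.pi fun _ => unif).prod (Measure.pi fun _ => unif)) ≤
      3 / 4 * ((m : ℝ) + 2) := by
  set Λ : Measure (Fin (m + 2) → ℝ) := Measure.pi fun _ => unif with hΛ
  have hmeas : Measurable fun p : (Fin (m + 2) → ℝ) × (Fin (m + 2) → ℝ) =>
      interiorOverlap p.1 p.2 :=
    Finset.measurable_sum _ fun i _ => Finset.measurable_sum _ fun l _ => measurable_overlap _ _
  have hae : ∀ᵐ p ∂(Λ.prod Λ), (∀ i, p.1 i ∈ Icc (0 : ℝ) 1) ∧ ∀ i, p.2 i ∈ Icc (0 : ℝ) 1 := by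
    have h := ae_pi_mem (m + 2)
    exact (Measure.quasiMeasurePreserving_fst.ae h).and (Measure.quasiMeasurePreserving_snd.ae h)
  have h0 : ∀ᵐ p ∂(Λ.prod Λ), 0 ≤ interiorOverlap p.1 p.2 := by
    filter_upwards [hae] with p hp
    exact Finset.sum_nonneg fun i _ => Finset.sum_nonneg fun l _ => overlap_nonneg hp.1 hp.2 _ _
  constructor
  · refine Integrable.of_bound (C := ((m + 2 - 1 : ℕ) : ℝ) * ((m + 2 - 1 : ℕ) : ℝ))
      hmeas.aestronglyMeasurable ?_
    filter_upwards [hae, h0] with p hp hp0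
    rw [Real.norm_eq_abs, abs_of_nonneg hp0]
    calc interiorOverlap p.1 p.2 ≤ ∑ _i ∈ Finset.range (m + 2 - 1),
          ∑ _l ∈ Finset.range (m + 2 - 1), (1 : ℝ) :=
          Finset.sum_le_sum fun i _ => Finset.sum_le_sum fun l _ => overlap_le_one hp.1 hp.2 _ _
      _ = _ := by simp only [Finset.sum_const, Finset.card_range, nsmul_eq_mul, mul_one]
  · rw [integral_eq_lintegral_of_nonneg_ae h0 hmeas.aestronglyMeasurable]
    refine ENNReal.toReal_le_of_le_ofReal (by positivity) ?_
    rw [lintegral_prod _ hmeas.ennreal_ofReal.aemeasurable]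
    refine le_trans (le_of_eq ?_) (lintegral_interiorKernel_mul_le m)
    refine lintegral_congr_ae ?_
    filter_upwards [ae_pi_mem (m + 2)] with u hu
    refine lintegral_congr_ae ?_
    filter_upwards [ae_pi_mem (m + 2)] with v hv
    have hk : ∀ (w : Fin (m + 2) → ℝ) i, Measurable
        (cellKernel (orderStat w (i + 1)) (orderStat w (i + 2))) := fun w i =>
      measurable_cellKernel measurable_const measurable_const measurable_id
    simp only [interiorKernel, Finset.sum_mul_sum]
    have hkk : ∀ i l, Measurable fun p =>
        cellKernel (orderStat u (i + 1)) (orderStat u (i + 2)) p *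
          cellKernel (orderStat v (l + 1)) (orderStat v (l + 2)) p := fun i l =>
      (hk u i).mul (hk v l)
    rw [lintegral_finsetSum _ fun i _ => Finset.measurable_sum _ fun l _ => hkk i l,
      interiorOverlap, ENNReal.ofReal_sum_of_nonneg fun i _ => Finset.sum_nonneg fun l _ =>
        overlap_nonneg hu hv _ _]
    refine Finset.sum_congr rfl fun i _ => ?_
    rw [lintegral_finsetSum _ fun l _ => hkk i l,
      ENNReal.ofReal_sum_of_nonneg fun l _ => overlap_nonneg hu hv _ _]
    exact Finset.sum_congr rfl fun l _ => ofReal_overlap hu hv _ _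

end Uniform

/-! ### Cells too short to contain many observations -/

section SmallCells

/-- A bound for the relative error terms coming from the cells with few points. -/
noncomputable def smallCells {k : ℕ} (c : ℝ) (u : Fin k → ℝ) : ℝ :=
  ∑ j ∈ Finset.range (k + 1), 4 / (1 + c * cellLength u j)

theorem measurable_smallCells (k : ℕ) (c : ℝ) :
    Measurable fun u : Fin k → ℝ => smallCells c u :=
  Finset.measurable_sum _ fun j _ => by
    have := measurable_cellLength (k := k) j
    fun_prop

theorem smallCells_nonneg {k : ℕ} {c : ℝ} (hc : 0 ≤ c) {u : Fin k → ℝ}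
    (hu : ∀ i, u i ∈ Icc (0 : ℝ) 1) : 0 ≤ smallCells c u :=
  Finset.sum_nonneg fun j _ => by have := cellLength_nonneg hu j; positivity

theorem smallCells_le {k : ℕ} {c : ℝ} (hc : 0 ≤ c) {u : Fin k → ℝ}
    (hu : ∀ i, u i ∈ Icc (0 : ℝ) 1) : smallCells c u ≤ ((k : ℝ) + 1) * 4 := by
  calc smallCells c u ≤ ∑ _j ∈ Finset.range (k + 1), (4 : ℝ) :=
        Finset.sum_le_sum fun j _ => by
          have := mul_nonneg hc (cellLength_nonneg hu j)
          exact div_le_self (by norm_num) (by linarith)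
    _ = _ := by simp

theorem integrable_smallCells (k : ℕ) {c : ℝ} (hc : 0 ≤ c) :
    Integrable (fun u : Fin k → ℝ => smallCells c u) (Measure.pi fun _ => unif) := by
  refine Integrable.of_bound (C := ((k : ℝ) + 1) * 4)
    (measurable_smallCells k c).aestronglyMeasurable ?_
  filter_upwards [ae_pi_mem k] with u hu
  rw [Real.norm_eq_abs, abs_of_nonneg (smallCells_nonneg hc hu)]
  exact smallCells_le hc hu

theorem sum_range_interior {R : Type*} [AddCommMonoid R] (k : ℕ) (F : ℕ → R) :
    ∑ j ∈ Finset.range (k + 1), (if j ≠ 0 ∧ j ≠ k then F j else 0) =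
      ∑ i ∈ Finset.range (k - 1), F (i + 1) := by
  rcases k with _ | k
  · simp
  · rw [Finset.sum_range_succ, Finset.sum_range_succ']
    simp only [ne_eq, Nat.add_eq_zero_iff, one_ne_zero, and_false, not_false_eq_true, true_and,
      not_true_eq_false, false_and, if_false, add_zero, Nat.add_sub_cancel]
    refine Finset.sum_congr rfl fun i hi => ?_
    rw [if_pos]
    have := Finset.mem_range.mp hi
    omega

/-- Given one point, the other must fall in an interval of length `2 * δ` around it. -/
theorem measure_abs_sub_le (m : ℕ) {a b : Fin (m + 1)} (hab : b ≠ a) {δ : ℝ} (hδ : 0 ≤ δ) :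
    (Measure.pi fun _ : Fin (m + 1) => unif).real {u | |u b - u a| ≤ δ} ≤ 2 * δ := by
  obtain ⟨b', rfl⟩ := Fin.exists_succAbove_eq hab
  have hms : MeasurableSet {u : Fin (m + 1) → ℝ | |u (a.succAbove b') - u a| ≤ δ} :=
    measurableSet_le (by fun_prop) measurable_const
  have hms2 : MeasurableSet {q : ℝ × ℝ | |q.2 - q.1| ≤ δ} :=
    measurableSet_le (by fun_prop) measurable_const
  have hF : Measurable ({q : ℝ × ℝ | |q.2 - q.1| ≤ δ}.indicator fun _ => (1 : ℝ≥0∞)) :=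
    measurable_const.indicator hms2
  refine ENNReal.toReal_le_of_le_ofReal (by positivity) ?_
  calc (Measure.pi fun _ : Fin (m + 1) => unif) {u | |u (a.succAbove b') - u a| ≤ δ}
      = ∫⁻ u : Fin (m + 1) → ℝ, (fun q : ℝ × (Fin m → ℝ) =>
          {q : ℝ × ℝ | |q.2 - q.1| ≤ δ}.indicator (fun _ => (1 : ℝ≥0∞)) (q.1, q.2 b'))
            (u a, a.removeNth u) ∂(Measure.pi fun _ => unif) := by
        rw [← lintegral_indicator_one hms]
        rfl
    _ = ∫⁻ l, ∫⁻ y : Fin m → ℝ, {q : ℝ × ℝ | |q.2 - q.1| ≤ δ}.indicator (fun _ => (1 : ℝ≥0∞))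
          (l, y b') ∂(Measure.pi fun _ => unif) ∂unif :=
        lintegral_pi_isolate unif a (hF.comp (measurable_fst.prodMk
          ((measurable_pi_apply b').comp measurable_snd)))
    _ ≤ ∫⁻ _l, ENNReal.ofReal (2 * δ) ∂unif := by
        refine lintegral_mono fun l => ?_
        calc _ = ∫⁻ r, {q : ℝ × ℝ | |q.2 - q.1| ≤ δ}.indicator (fun _ => (1 : ℝ≥0∞)) (l, r)
              ∂unif := (measurePreserving_eval (fun _ : Fin m => unif) b').lintegral_comp
                (f := fun r => {q : ℝ × ℝ | |q.2 - q.1| ≤ δ}.indicator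
                  (fun _ => (1 : ℝ≥0∞)) (l, r)) (hF.comp measurable_prodMk_left)
          _ = ∫⁻ r, (Metric.closedBall l δ).indicator (fun _ => (1 : ℝ≥0∞)) r ∂unif := by
              refine lintegral_congr fun r => ?_
              simp only [indicator, mem_ofPred_eq, Metric.mem_closedBall, Real.dist_eq]
          _ = unif (Metric.closedBall l δ) := by
              rw [lintegral_indicator_const Metric.isClosed_closedBall.measurableSet, one_mul]
          _ ≤ volume (Metric.closedBall l δ) := Measure.restrict_apply_le _ _
          _ = _ := Real.volume_closedBall _ _
    _ = _ := by simp

/-- Each summand is at most 4. The two boundary cells account for 8, a cell longer than `δ` has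
summand at most 4 / (1 + c * δ), and a short interior cell is charged to the pair of close points
that bound it. -/
theorem smallCells_le_pairs {k : ℕ} {c δ : ℝ} (hc : 0 ≤ c) (hδ : 0 ≤ δ) {u : Fin k → ℝ}
    (hu : ∀ i, u i ∈ Icc (0 : ℝ) 1) :
    smallCells c u ≤ 8 + ((k : ℝ) + 1) * (4 / (1 + c * δ)) +
      4 * ∑ a, ∑ b ∈ Finset.univ.erase a,
        {u : Fin k → ℝ | |u b - u a| ≤ δ}.indicator (fun _ => (1 : ℝ)) u := by
  have h1 : ∀ j ∈ Finset.range (k + 1), 4 / (1 + c * cellLength u j) ≤ 4 / (1 + c * δ) +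
      4 * ((if j = 0 then 1 else 0) + (if j = k then 1 else 0)) +
      4 * (if j ≠ 0 ∧ j ≠ k then (if cellLength u j ≤ δ then (1 : ℝ) else 0) else 0) := by
    intro j _
    have hL := cellLength_nonneg hu j
    have h4 : 4 / (1 + c * cellLength u j) ≤ 4 :=
      div_le_self (by norm_num) (by linarith [mul_nonneg hc hL])
    have h5 : 0 ≤ 4 / (1 + c * δ) := by positivity
    by_cases h0 : j = 0
    · simp only [h0, if_true] at h4 ⊢
      simp only [ne_eq, not_true_eq_false, false_and, if_false]
      split_ifs <;> linarith
    by_cases hk : j = k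
    · simp only [hk, if_true] at h4 ⊢
      simp only [ne_eq, not_true_eq_false, and_false, if_false]
      split_ifs <;> linarith
    · simp only [h0, hk, if_false, ne_eq, not_false_iff, and_self, if_true]
      by_cases hd : cellLength u j ≤ δ
      · rw [if_pos hd]; linarith
      · rw [if_neg hd]
        have : 4 / (1 + c * cellLength u j) ≤ 4 / (1 + c * δ) := by
          gcongr
          exact (not_le.mp hd).le
        linarith
  have h2 := sum_interior_le u hu (fun a b => if b - a ≤ δ then (1 : ℝ) else 0)
    (fun a b => {u : Fin k → ℝ | |u b - u a| ≤ δ}.indicator (fun _ => (1 : ℝ)) u)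
    (fun a b => indicator_nonneg (fun _ _ => zero_le_one) _) fun a b _ hab _ => by
      simp only [indicator, mem_ofPred_eq, abs_of_nonneg (sub_nonneg.mpr hab)]
      exact le_rfl
  calc smallCells c u ≤ _ := Finset.sum_le_sum h1
    _ = ((k : ℝ) + 1) * (4 / (1 + c * δ)) + 8 + 4 * ∑ i ∈ Finset.range (k - 1),
          (if cellLength u (i + 1) ≤ δ then (1 : ℝ) else 0) := by
        rw [Finset.sum_add_distrib, Finset.sum_add_distrib, ← Finset.mul_sum, ← Finset.mul_sum,
          Finset.sum_add_distrib, sum_range_interior]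
        simp
        norm_num
    _ ≤ _ := by
        have : ∑ i ∈ Finset.range (k - 1), (if cellLength u (i + 1) ≤ δ then (1 : ℝ) else 0) ≤ _ :=
          h2
        linarith

theorem integral_smallCells_le (m : ℕ) {c δ : ℝ} (hc : 0 ≤ c) (hδ : 0 ≤ δ) :
    ∫ u : Fin (m + 1) → ℝ, smallCells c u ∂(Measure.pi fun _ => unif) ≤
      8 + ((m : ℝ) + 2) * (4 / (1 + c * δ)) + 8 * ((m : ℝ) + 1) ^ 2 * δ := by
  have hms : ∀ a b : Fin (m + 1), MeasurableSet {u : Fin (m + 1) → ℝ | |u b - u a| ≤ δ} :=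
    fun a b => measurableSet_le (by fun_prop) measurable_const
  have hi : ∀ a b : Fin (m + 1), Integrable
      ({u : Fin (m + 1) → ℝ | |u b - u a| ≤ δ}.indicator fun _ => (1 : ℝ))
      (Measure.pi fun _ => unif) := fun a b => (integrable_const 1).indicator (hms a b)
  calc _ ≤ ∫ u : Fin (m + 1) → ℝ, (8 + (((m + 1 : ℕ) : ℝ) + 1) * (4 / (1 + c * δ)) +
      4 * ∑ a, ∑ b ∈ Finset.univ.erase a,
        {u : Fin (m + 1) → ℝ | |u b - u a| ≤ δ}.indicator (fun _ => (1 : ℝ)) u)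
          ∂(Measure.pi fun _ => unif) := by
        refine integral_mono_ae (integrable_smallCells _ hc) ?_ ?_
        · exact (integrable_const _).add ((integrable_finsetSum _ fun a _ =>
            integrable_finsetSum _ fun b _ => hi a b).const_mul 4)
        · filter_upwards [ae_pi_mem (m + 1)] with u hu
          exact smallCells_le_pairs hc hδ hu
    _ = 8 + ((m : ℝ) + 2) * (4 / (1 + c * δ)) + 4 * ∑ a, ∑ b ∈ Finset.univ.erase a,
          (Measure.pi fun _ : Fin (m + 1) => unif).real {u | |u b - u a| ≤ δ} := by
        rw [integral_add (integrable_const _) ((integrable_finsetSum _ fun a _ =>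
            integrable_finsetSum _ fun b _ => hi a b).const_mul 4), integral_const_mul,
            integral_finsetSum _ fun a _ => integrable_finsetSum _ fun b _ => hi a b]
        simp_rw [integral_finsetSum _ fun b _ => hi _ b, integral_indicator_const _ (hms _ _)]
        simp
        left
        ring
    _ ≤ 8 + ((m : ℝ) + 2) * (4 / (1 + c * δ)) + 4 * ∑ _a : Fin (m + 1),
          ∑ _b : Fin (m + 1), 2 * δ := by
        gcongr with a _
        refine (Finset.sum_le_sum fun b hb => measure_abs_sub_le m
          (Finset.ne_of_mem_erase hb) hδ).trans ?_
        exact Finset.sum_le_sum_of_subset_of_nonneg (Finset.subset_univ _)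
          fun _ _ _ => by positivity
    _ = _ := by
        simp
        ring

end SmallCells

/-! ### From the design density to Lebesgue measure -/

section Design

/-- The law of the design points. -/
noncomputable abbrev designLaw (dens : ℝ → ℝ) : Measure ℝ :=
  unif.withDensity fun x => ENNReal.ofReal (dens x)

variable {dens : ℝ → ℝ} {A : Set ℝ}

theorem volume_ne_top_of_subset (hA : A ⊆ Icc 0 1) : volume A ≠ ∞ :=
  ((measure_mono hA).trans_lt (by simp)).ne

theorem designLaw_le (hA : MeasurableSet A) (hA1 : A ⊆ Icc 0 1) {b : ℝ} (hb : 0 ≤ b)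
    (h : ∀ x ∈ A, dens x ≤ b) : (designLaw dens).real A ≤ b * volume.real A := by
  refine ENNReal.toReal_le_of_le_ofReal (by positivity) ?_
  rw [withDensity_apply _ hA, ENNReal.ofReal_mul hb,
    ofReal_measureReal (volume_ne_top_of_subset hA1)]
  calc _ ≤ ∫⁻ _x in A, ENNReal.ofReal b ∂unif :=
        setLIntegral_mono' hA fun x hx => ENNReal.ofReal_le_ofReal (h x hx)
    _ = ENNReal.ofReal b * volume A := by
        rw [setLIntegral_const, unif, Measure.restrict_apply hA, inter_eq_left.mpr hA1]

theorem le_designLaw [IsProbabilityMeasure (designLaw dens)] (hA : MeasurableSet A)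
    (hA1 : A ⊆ Icc 0 1) {b : ℝ} (hb : 0 ≤ b)
    (h : ∀ x ∈ A, b ≤ dens x) : b * volume.real A ≤ (designLaw dens).real A := by
  rw [measureReal_def (designLaw dens), ← ENNReal.ofReal_le_iff_le_toReal (measure_ne_top _ _),
    withDensity_apply _ hA, ENNReal.ofReal_mul hb,
    ofReal_measureReal (volume_ne_top_of_subset hA1)]
  calc ENNReal.ofReal b * volume A = ∫⁻ _x in A, ENNReal.ofReal b ∂unif := by
        rw [setLIntegral_const, unif, Measure.restrict_apply hA, inter_eq_left.mpr hA1]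
    _ ≤ _ := setLIntegral_mono' hA fun x hx => ENNReal.ofReal_le_ofReal (h x hx)

theorem volume_real_cell {k : ℕ} {u : Fin k → ℝ} (hu : ∀ i, u i ∈ Icc (0 : ℝ) 1) (j : ℕ) :
    volume.real (cell u j) = cellLength u j := by
  rw [cell, Real.volume_real_Ioc_of_le (monotone_orderStat hu j.le_succ), cellLength]

variable {k : ℕ} {u v : Fin k → ℝ}

/-- The squared probability of the intersection of two cells, divided by the probabilities of
the cells. -/
noncomputable def overlapProb (μ : Measure ℝ) (u v : Fin k → ℝ) (j l : ℕ) : ℝ :=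
  μ.real (cell u j ∩ cell v l) ^ 2 / (μ.real (cell u j) * μ.real (cell v l))

theorem overlapProb_nonneg (μ : Measure ℝ) (u v : Fin k → ℝ) (j l : ℕ) :
    0 ≤ overlapProb μ u v j l := by
  unfold overlapProb; positivity

theorem overlapProb_symm (μ : Measure ℝ) (u v : Fin k → ℝ) (j l : ℕ) :
    overlapProb μ u v j l = overlapProb μ v u l j := by
  rw [overlapProb, overlapProb, inter_comm, mul_comm (μ.real (cell u j))]

/-- One factor of the squared probability cancels against the cell of `v`, and the other sums to the
probability of `cell u j` over the disjoint cells of `v`. Every exceptional cell therefore costs at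
most 1, however many cells it meets. -/
theorem sum_overlapProb_le (μ : Measure ℝ) [IsProbabilityMeasure μ]
    (hv : ∀ i, v i ∈ Icc (0 : ℝ) 1) (j : ℕ) :
    ∑ l ∈ Finset.range (k + 1), overlapProb μ u v j l ≤ 1 := by
  rcases (measureReal_nonneg (μ := μ) (s := cell u j)).eq_or_lt with h0 | hp
  · simp [overlapProb, ← h0]
  calc _ ≤ ∑ l ∈ Finset.range (k + 1), μ.real (cell u j ∩ cell v l) / μ.real (cell u j) := by
        refine Finset.sum_le_sum fun l _ => ?_
        rcases (measureReal_nonneg (μ := μ) (s := cell v l)).eq_or_lt with h1 | hq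
        · rw [overlapProb, ← h1]
          simp only [mul_zero, div_zero]
          positivity
        · rw [overlapProb, div_le_div_iff₀ (by positivity) hp, pow_two]
          have : μ.real (cell u j ∩ cell v l) ≤ μ.real (cell v l) :=
            measureReal_mono inter_subset_right
          have h3 : 0 ≤ μ.real (cell u j ∩ cell v l) := measureReal_nonneg
          nlinarith [mul_le_mul_of_nonneg_left this (mul_nonneg h3 hp.le)]
    _ = μ.real (⋃ l ∈ Finset.range (k + 1), cell u j ∩ cell v l) / μ.real (cell u j) := by
        rw [← Finset.sum_div, measureReal_biUnion_finset]
        · intro a _ b _ hab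
          exact (disjoint_cell hv hab).mono inter_subset_right inter_subset_right
        · exact fun l _ => (measurableSet_cell _ _).inter (measurableSet_cell _ _)
    _ ≤ 1 := by
        refine div_le_one_of_le₀ (measureReal_mono ?_) measureReal_nonneg
        exact iUnion₂_subset fun l _ => inter_subset_left

theorem sum_sum_overlapProb_mul_le (μ : Measure ℝ) [IsProbabilityMeasure μ]
    (hv : ∀ i, v i ∈ Icc (0 : ℝ) 1) {w : ℕ → ℝ} (hw : ∀ j, 0 ≤ w j) :
    ∑ j ∈ Finset.range (k + 1), ∑ l ∈ Finset.range (k + 1), overlapProb μ u v j l * w j ≤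
      ∑ j ∈ Finset.range (k + 1), w j := by
  refine Finset.sum_le_sum fun j _ => ?_
  rw [← Finset.sum_mul]
  exact mul_le_of_le_one_left (hw j) (sum_overlapProb_le μ hv j)

theorem sum_sum_overlapProb_mul_le' (μ : Measure ℝ) [IsProbabilityMeasure μ]
    (hu : ∀ i, u i ∈ Icc (0 : ℝ) 1) {w : ℕ → ℝ} (hw : ∀ j, 0 ≤ w j) :
    ∑ j ∈ Finset.range (k + 1), ∑ l ∈ Finset.range (k + 1), overlapProb μ u v j l * w l ≤
      ∑ j ∈ Finset.range (k + 1), w j := by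
  rw [Finset.sum_comm]
  simp_rw [overlapProb_symm μ u v]
  exact sum_sum_overlapProb_mul_le μ hu hw

/-- Short cells: the density is almost constant on two overlapping short cells. -/
theorem overlapProb_le_overlap [IsProbabilityMeasure (designLaw dens)]
    (hu : ∀ i, u i ∈ Icc (0 : ℝ) 1) (hv : ∀ i, v i ∈ Icc (0 : ℝ) 1) {c θ δ : ℝ} (hc : 0 < c)
    (hθ : 0 < θ) (hθ2 : θ ≤ 1 / 2) (hdc : ∀ x ∈ Icc (0 : ℝ) 1, c ≤ dens x)
    (hδ : ∀ x ∈ Icc (0 : ℝ) 1, ∀ y ∈ Icc (0 : ℝ) 1, |x - y| ≤ δ → |dens x - dens y| ≤ θ * c)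
    {j l : ℕ} (hj : cellLength u j ≤ δ) (hl : cellLength v l ≤ δ) :
    overlapProb (designLaw dens) u v j l ≤ (1 + 16 * θ) * overlap u v j l := by
  by_cases hne : (cell u j ∩ cell v l).Nonempty
  swap
  · rw [not_nonempty_iff_eq_empty] at hne
    simp [overlapProb, overlap, hne]
  obtain ⟨x, hxu, hxv⟩ := hne
  have hx := cell_subset hu j hxu
  set d := dens x
  have hd : c ≤ d := hdc x hx
  have hd0 : 0 < d := hc.trans_le hd
  have hclose : ∀ {w : Fin k → ℝ} {i : ℕ}, (∀ i, w i ∈ Icc (0 : ℝ) 1) → cellLength w i ≤ δ →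
      x ∈ cell w i → ∀ y ∈ cell w i, (1 - θ) * d ≤ dens y ∧ dens y ≤ (1 + θ) * d := by
    intro w i hw hi hxw y hy
    have h1 : |x - y| ≤ δ := by
      refine le_trans ?_ hi
      rw [abs_le, cellLength]
      constructor <;> linarith [hxw.1, hxw.2, hy.1, hy.2]
    have h2 := abs_le.mp (hδ x hx y (cell_subset hw i hy) h1)
    have h3 : θ * c ≤ θ * d := mul_le_mul_of_nonneg_left hd hθ.le
    constructor <;> linarith [h2.1, h2.2]
  have hLu : 0 < cellLength u j := by rw [cellLength]; linarith [hxu.1, hxu.2]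
  have hLv : 0 < cellLength v l := by rw [cellLength]; linarith [hxv.1, hxv.2]
  have h1θ : 0 < (1 - θ) * d := mul_pos (by linarith) hd0
  have hp : (1 - θ) * d * cellLength u j ≤ (designLaw dens).real (cell u j) := by
    rw [← volume_real_cell hu]
    exact le_designLaw (measurableSet_cell u j) (cell_subset hu j) h1θ.le
      fun y hy => (hclose hu hj hxu y hy).1
  have hq : (1 - θ) * d * cellLength v l ≤ (designLaw dens).real (cell v l) := by
    rw [← volume_real_cell hv]
    exact le_designLaw (measurableSet_cell v l) (cell_subset hv l) h1θ.le
      fun y hy => (hclose hv hl hxv y hy).1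
  have hr : (designLaw dens).real (cell u j ∩ cell v l) ≤
      (1 + θ) * d * volume.real (cell u j ∩ cell v l) :=
    designLaw_le ((measurableSet_cell u j).inter (measurableSet_cell v l))
      (inter_subset_left.trans (cell_subset hu j)) (by positivity)
      fun y hy => (hclose hu hj hxu y hy.1).2
  set o := volume.real (cell u j ∩ cell v l) with ho
  calc overlapProb (designLaw dens) u v j l ≤ ((1 + θ) * d * o) ^ 2 /
        (((1 - θ) * d * cellLength u j) * ((1 - θ) * d * cellLength v l)) := by
        unfold overlapProb
        gcongr
    _ = ((1 + θ) ^ 2 / (1 - θ) ^ 2) * overlap u v j l := by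
        have : 1 - θ ≠ 0 := by linarith
        rw [overlap, ← ho]
        field_simp
    _ ≤ _ := by
        refine mul_le_mul_of_nonneg_right ?_ (overlap_nonneg hu hv _ _)
        rw [div_le_iff₀ (by have : 0 < 1 - θ := by linarith
                            positivity)]
        -- The function ((1 + θ)/(1 - θ))² is convex with values 1 at 0 and 9 at 1/2; its chord is 1
        -- + 16 θ.
        nlinarith [mul_nonneg hθ.le (sub_nonneg.mpr hθ2), mul_nonneg (mul_nonneg hθ.le hθ.le) hθ.le,
          mul_nonneg (mul_nonneg hθ.le hθ.le) (sub_nonneg.mpr hθ2)]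

/-- Pairs of short interior cells are compared with Lebesgue overlaps. All other pairs contain a
boundary cell or a cell longer than `δ`; each partition has two of the former and, having total
length 1, at most 1 / δ of the latter, and each costs at most 1. -/
theorem sum_overlapProb_le_interiorOverlap [IsProbabilityMeasure (designLaw dens)]
    (hu : ∀ i, u i ∈ Icc (0 : ℝ) 1) (hv : ∀ i, v i ∈ Icc (0 : ℝ) 1) {c θ δ : ℝ} (hc : 0 < c)
    (hθ : 0 < θ) (hθ2 : θ ≤ 1 / 2) (hdc : ∀ x ∈ Icc (0 : ℝ) 1, c ≤ dens x) (hδ0 : 0 < δ)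
    (hδ : ∀ x ∈ Icc (0 : ℝ) 1, ∀ y ∈ Icc (0 : ℝ) 1, |x - y| ≤ δ → |dens x - dens y| ≤ θ * c) :
    ∑ j ∈ Finset.range (k + 1), ∑ l ∈ Finset.range (k + 1),
        overlapProb (designLaw dens) u v j l ≤
      (1 + 16 * θ) * interiorOverlap u v + 2 * (2 + 1 / δ) := by
  -- A weight that is at least 1 on every exceptional cell and sums to exactly 2 + 1 / δ; using the
  -- length divided by `δ` avoids counting the long cells.
  set b : (Fin k → ℝ) → ℕ → ℝ := fun u j =>
    (if j = 0 then 1 else 0) + (if j = k then 1 else 0) + cellLength u j / δ with hb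
  have hb0 : ∀ {u : Fin k → ℝ}, (∀ i, u i ∈ Icc (0 : ℝ) 1) → ∀ j, 0 ≤ b u j := by
    intro u hu j
    have := cellLength_nonneg hu j
    simp only [hb]
    positivity
  have hb1 : ∀ {u : Fin k → ℝ}, (∀ i, u i ∈ Icc (0 : ℝ) 1) → ∀ j,
      ¬ ((j ≠ 0 ∧ j ≠ k) ∧ cellLength u j ≤ δ) → 1 ≤ b u j := by
    intro u hu j h
    have h0 := div_nonneg (cellLength_nonneg hu j) hδ0.le
    simp only [hb]
    by_cases h1 : j = 0
    · simp only [h1, if_true] at h0 ⊢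
      split_ifs <;> linarith
    by_cases h2 : j = k
    · simp only [h2, if_true] at h0 ⊢
      split_ifs <;> linarith
    have h3 : δ < cellLength u j := by
      by_contra h4
      exact h ⟨⟨h1, h2⟩, not_lt.mp h4⟩
    have : 1 ≤ cellLength u j / δ := by rw [le_div_iff₀ hδ0]; linarith
    simp only [h1, h2, if_false]
    linarith
  have hbs : ∀ u : Fin k → ℝ, ∑ j ∈ Finset.range (k + 1), b u j = 2 + 1 / δ := by
    intro u
    simp only [hb]
    rw [Finset.sum_add_distrib, Finset.sum_add_distrib, ← Finset.sum_div, sum_cellLength]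
    simp
    norm_num
  set μ := designLaw dens
  set η := 1 + 16 * θ
  have hpt : ∀ j l, overlapProb μ u v j l ≤
      (if j ≠ 0 ∧ j ≠ k then (if l ≠ 0 ∧ l ≠ k then η * overlap u v j l else 0) else 0) +
      (overlapProb μ u v j l * b u j + overlapProb μ u v j l * b v l) := by
    intro j l
    have h0 := overlapProb_nonneg μ u v j l
    have ho : 0 ≤ η * overlap u v j l := mul_nonneg (by positivity) (overlap_nonneg hu hv j l)
    have hif : 0 ≤ (if j ≠ 0 ∧ j ≠ k then
        (if l ≠ 0 ∧ l ≠ k then η * overlap u v j l else 0) else 0) := by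
      split_ifs <;> simp [ho]
    by_cases h1 : (j ≠ 0 ∧ j ≠ k) ∧ cellLength u j ≤ δ
    · by_cases h2 : (l ≠ 0 ∧ l ≠ k) ∧ cellLength v l ≤ δ
      · rw [if_pos h1.1, if_pos h2.1]
        have := overlapProb_le_overlap hu hv hc hθ hθ2 hdc hδ h1.2 h2.2
        have h3 := mul_nonneg h0 (hb0 hu j)
        have h4 := mul_nonneg h0 (hb0 hv l)
        linarith
      · have := mul_le_mul_of_nonneg_left (hb1 hv l h2) h0
        have h3 := mul_nonneg h0 (hb0 hu j)
        linarith
    · have := mul_le_mul_of_nonneg_left (hb1 hu j h1) h0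
      have h4 := mul_nonneg h0 (hb0 hv l)
      linarith
  have e : ∑ j ∈ Finset.range (k + 1), ∑ l ∈ Finset.range (k + 1),
      (if j ≠ 0 ∧ j ≠ k then (if l ≠ 0 ∧ l ≠ k then η * overlap u v j l else 0) else 0) =
      η * interiorOverlap u v := by
    rw [interiorOverlap, Finset.mul_sum, ← sum_range_interior k
      (fun j => η * ∑ l ∈ Finset.range (k - 1), overlap u v j (l + 1))]
    refine Finset.sum_congr rfl fun j _ => ?_
    split_ifs with h
    · rw [sum_range_interior k fun l => η * overlap u v j l, Finset.mul_sum]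
    · simp
  calc _ ≤ _ := Finset.sum_le_sum fun j _ => Finset.sum_le_sum fun l _ => hpt j l
    _ = η * interiorOverlap u v + (∑ j ∈ Finset.range (k + 1), ∑ l ∈ Finset.range (k + 1),
          overlapProb μ u v j l * b u j + ∑ j ∈ Finset.range (k + 1),
          ∑ l ∈ Finset.range (k + 1), overlapProb μ u v j l * b v l) := by
        rw [← e]
        simp only [Finset.sum_add_distrib]
    _ ≤ _ := by
        have h1 := sum_sum_overlapProb_mul_le (u := u) μ hv (hb0 hu)
        have h2 := sum_sum_overlapProb_mul_le' (v := v) μ hu (hb0 hv)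
        rw [hbs] at h1 h2
        linarith

end Design

/-! ### Conditional covariance of two trees given their partitions -/

section Conditional

variable {k m n : ℕ} {μ ν : Measure ℝ} {s : ℝ → ℝ} {B : ℝ}

/-- The difference of the tree and of its population version, at the point `t`, as a function of
the design points `x`, the errors `e` and the partition `u`. -/
noncomputable def deviation (μ : Measure ℝ) (s : ℝ → ℝ) (x e : Fin n → ℝ) (u : Fin k → ℝ)
    (t : ℝ) : ℝ :=
  ∑ i, e i * weight (Finset.range (k + 1)) (cell u) x t i +
    bias μ s (Finset.range (k + 1)) (cell u) x t

theorem cellAverage_eq (x y : Fin n → ℝ) (A : Set ℝ) :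
    cellAverage x y A = (∑ i, A.indicator (fun _ => (1 : ℝ)) (x i) * y i) / hits A x := by
  classical
  unfold cellAverage hits
  congr 1
  · rw [Finset.sum_filter]
    refine Finset.sum_congr rfl fun i _ => ?_
    by_cases h : x i ∈ A <;> simp [h]
  · rw [Finset.card_filter]
    push_cast
    refine Finset.sum_congr rfl fun i _ => ?_
    by_cases h : x i ∈ A <;> simp [h]

/-- The tree is linear in its responses, so errors and values of `s` separate cell by cell. In an
empty cell both averages are 0, in accordance with division by zero. -/
theorem treeEst_sub_eq_deviation (μ : Measure ℝ) (s : ℝ → ℝ) (x e : Fin n → ℝ) (u : Fin k → ℝ)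
    (t : ℝ) :
    treeEst x (fun i => s (x i) + e i) u t -
      ∑ j ∈ Finset.range (k + 1), (cell u j).indicator (fun _ => meanOn μ s (cell u j)) t =
    deviation μ s x e u t := by
  unfold treeEst deviation weight bias
  simp_rw [Finset.mul_sum]
  rw [Finset.sum_comm, ← Finset.sum_sub_distrib, ← Finset.sum_add_distrib]
  refine Finset.sum_congr rfl fun j _ => ?_
  by_cases h : t ∈ cell u j
  · simp only [h, indicator_of_mem, one_mul, centeredAverage, cellAverage_eq]
    simp only [mul_add, Finset.sum_add_distrib, add_div, Finset.sum_div]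
    have : ∀ i, e i * ((cell u j).indicator (fun _ => (1 : ℝ)) (x i) / hits (cell u j) x) =
        (cell u j).indicator (fun _ => (1 : ℝ)) (x i) * e i / hits (cell u j) x := fun i => by
      ring
    simp_rw [this]
    ring
  · simp [h]

theorem abs_weight_le (J : Finset ℕ) (A : ℕ → Set ℝ) (x : Fin n → ℝ) (t : ℝ) (i : Fin n) :
    |weight J A x t i| ≤ J.card := by
  refine (Finset.abs_sum_le_sum_abs _ _).trans ?_
  calc _ ≤ ∑ _j ∈ J, (1 : ℝ) := by
        refine Finset.sum_le_sum fun j _ => ?_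
        rw [abs_mul, abs_div, abs_of_nonneg (indicator_one_nonneg _ _),
          abs_of_nonneg (indicator_one_nonneg _ _), abs_of_nonneg (hits_nonneg _ _)]
        refine mul_le_one₀ (indicator_one_le _ _) (div_nonneg (indicator_one_nonneg _ _)
          (hits_nonneg _ _)) (div_le_one_of_le₀ ?_ (hits_nonneg _ _))
        exact Finset.single_le_sum (f := fun i => (A j).indicator (fun _ => (1 : ℝ)) (x i))
          (fun _ _ => indicator_one_nonneg _ _) (Finset.mem_univ i)
    _ = J.card := by simp

theorem abs_bias_le [IsProbabilityMeasure μ] (hB : ∀ a, |s a| ≤ B) (J : Finset ℕ)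
    (A : ℕ → Set ℝ) (x : Fin n → ℝ) (t : ℝ) : |bias μ s J A x t| ≤ J.card * (2 * B) := by
  refine (Finset.abs_sum_le_sum_abs _ _).trans ?_
  calc _ ≤ ∑ _j ∈ J, (2 * B) := by
        refine Finset.sum_le_sum fun j _ => ?_
        rw [abs_mul, abs_of_nonneg (indicator_one_nonneg _ _)]
        exact (mul_le_of_le_one_left (abs_nonneg _) (indicator_one_le _ _)).trans
          (abs_centeredAverage_le μ hB _ _)
    _ = _ := by simp

/-- Indicators of cells are jointly measurable in the partition and the point. -/
theorem measurable_indicator_cell {α : Type*} [MeasurableSpace α] {u : α → Fin k → ℝ} {t : α → ℝ}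
    (hu : Measurable u) (ht : Measurable t) (j : ℕ) :
    Measurable fun a => (cell (u a) j).indicator (fun _ => (1 : ℝ)) (t a) := by
  have h1 := (measurable_orderStat j).comp hu
  have h2 := (measurable_orderStat (j + 1)).comp hu
  have : (fun a => (cell (u a) j).indicator (fun _ => (1 : ℝ)) (t a)) =
      ({a | orderStat (u a) j < t a} ∩ {a | t a ≤ orderStat (u a) (j + 1)}).indicator
        fun _ => (1 : ℝ) := by
    ext a
    simp only [indicator, cell, mem_Ioc, mem_inter_iff, mem_ofPred_eq]
  rw [this]
  exact measurable_const.indicator ((measurableSet_lt h1 ht).inter (measurableSet_le ht h2))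

theorem measurable_hits_cell {α : Type*} [MeasurableSpace α] {u : α → Fin k → ℝ}
    {x : α → Fin n → ℝ} (hu : Measurable u) (hx : Measurable x) (j : ℕ) :
    Measurable fun a => hits (cell (u a) j) (x a) :=
  Finset.measurable_sum _ fun i _ =>
    measurable_indicator_cell hu ((measurable_pi_apply i).comp hx) j

theorem measurable_weight_cell {α : Type*} [MeasurableSpace α] {u : α → Fin k → ℝ}
    {x : α → Fin n → ℝ} {t : α → ℝ} (hu : Measurable u) (hx : Measurable x) (ht : Measurable t)
    (i : Fin n) :
    Measurable fun a => weight (Finset.range (k + 1)) (cell (u a)) (x a) (t a) i :=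
  Finset.measurable_sum _ fun j _ => (measurable_indicator_cell hu ht j).mul
    ((measurable_indicator_cell hu ((measurable_pi_apply i).comp hx) j).div
      (measurable_hits_cell hu hx j))

theorem measurable_meanOn_cell [IsProbabilityMeasure μ] {α : Type*} [MeasurableSpace α]
    {u : α → Fin k → ℝ} (hu : Measurable u) (hs : Measurable s) (j : ℕ) :
    Measurable fun a => meanOn μ s (cell (u a) j) := by
  have e : ∀ a, meanOn μ s (cell (u a) j) =
      (∫ t, (cell (u a) j).indicator (fun _ => (1 : ℝ)) t * s t ∂μ) /
        ∫ t, (cell (u a) j).indicator (fun _ => (1 : ℝ)) t ∂μ := by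
    intro a
    rw [integral_indicator_one_eq μ (measurableSet_cell _ _), meanOn,
      ← integral_indicator (measurableSet_cell _ _)]
    congr 2
    ext t
    by_cases h : t ∈ cell (u a) j <;> simp [h]
  simp_rw [e]
  have h1 := measurable_indicator_cell (α := α × ℝ) (hu.comp measurable_fst) measurable_snd j
  have h2 := h1.mul (hs.comp measurable_snd)
  exact (StronglyMeasurable.integral_prod_right (ν := μ)
      (f := fun a t => (cell (u a) j).indicator (fun _ => (1 : ℝ)) t * s t)
      h2.stronglyMeasurable).measurable.div
    (StronglyMeasurable.integral_prod_right (ν := μ)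
      (f := fun a t => (cell (u a) j).indicator (fun _ => (1 : ℝ)) t)
      h1.stronglyMeasurable).measurable

theorem measurable_bias_cell [IsProbabilityMeasure μ] {α : Type*} [MeasurableSpace α]
    {u : α → Fin k → ℝ} {x : α → Fin n → ℝ} {t : α → ℝ} (hu : Measurable u) (hx : Measurable x)
    (ht : Measurable t) (hs : Measurable s) :
    Measurable fun a => bias μ s (Finset.range (k + 1)) (cell (u a)) (x a) (t a) :=
  Finset.measurable_sum _ fun j _ => (measurable_indicator_cell hu ht j).mul
    (((Finset.measurable_sum _ fun i _ =>
      (measurable_indicator_cell hu ((measurable_pi_apply i).comp hx) j).mul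
        (hs.comp ((measurable_pi_apply i).comp hx))).div
      (measurable_hits_cell hu hx j)).sub (measurable_meanOn_cell hu hs j))

theorem measurable_deviation [IsProbabilityMeasure μ] {α : Type*} [MeasurableSpace α]
    {u : α → Fin k → ℝ} {x e : α → Fin n → ℝ} {t : α → ℝ} (hu : Measurable u) (hx : Measurable x)
    (he : Measurable e) (ht : Measurable t) (hs : Measurable s) :
    Measurable fun a => deviation μ s (x a) (e a) (u a) (t a) :=
  (Finset.measurable_sum _ fun i _ => ((measurable_pi_apply i).comp he).mul
    (measurable_weight_cell hu hx ht i)).add (measurable_bias_cell hu hx ht hs)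

theorem abs_deviation_le [IsProbabilityMeasure μ] (hB : ∀ a, |s a| ≤ B) (x e : Fin n → ℝ)
    (u : Fin k → ℝ) (t : ℝ) :
    |deviation μ s x e u t| ≤ ((k : ℝ) + 1) * (∑ i, |e i| + 2 * B) := by
  have h1 := abs_bias_le (μ := μ) hB (Finset.range (k + 1)) (cell u) x t
  have h2 : |∑ i, e i * weight (Finset.range (k + 1)) (cell u) x t i| ≤
      ((k : ℝ) + 1) * ∑ i, |e i| := by
    refine (Finset.abs_sum_le_sum_abs _ _).trans ?_
    rw [Finset.mul_sum]
    refine Finset.sum_le_sum fun i _ => ?_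
    rw [abs_mul, mul_comm]
    have := abs_weight_le (Finset.range (k + 1)) (cell u) x t i
    simp only [Finset.card_range, Nat.cast_add, Nat.cast_one] at this
    gcongr
  simp only [Finset.card_range, Nat.cast_add, Nat.cast_one] at h1
  refine (abs_add_le _ _).trans ?_
  linarith

/-- The conditional covariance of two deviations, given the partitions. -/
noncomputable def condCov (n : ℕ) (μ ν : Measure ℝ) (s : ℝ → ℝ) (u v : Fin k → ℝ) : ℝ :=
  ∫ z : (Fin n → ℝ) × ℝ, ∫ e : Fin n → ℝ, deviation μ s z.1 e u z.2 * deviation μ s z.1 e v z.2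
    ∂(Measure.pi fun _ => ν) ∂((Measure.pi fun _ => μ).prod μ)

/-- The part of the conditional covariance that comes from the errors, up to their variance. -/
noncomputable def noiseCov (m : ℕ) (μ : Measure ℝ) (u v : Fin k → ℝ) : ℝ :=
  ∑ j ∈ Finset.range (k + 1), ∑ l ∈ Finset.range (k + 1),
    ((m : ℝ) + 1) * μ.real (cell u j ∩ cell v l) ^ 2 * crossInv μ m (cell u j) (cell v l)

/-- The errors are integrated first: they are centered and uncorrelated, so the terms mixing errors
and noiseless parts vanish and the errors contribute only the inner product of the weights. -/
theorem condCov_eq [IsProbabilityMeasure μ] [IsProbabilityMeasure ν] (hν : MemLp id 2 ν)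
    (hν0 : ∫ e, e ∂ν = 0) {σ2 : ℝ} (hσ : ∫ e, e ^ 2 ∂ν = σ2) (hs : Measurable s)
    (hB : ∀ a, |s a| ≤ B) (u v : Fin k → ℝ) :
    condCov (m + 1) μ ν s u v = σ2 * noiseCov m μ u v +
      ∫ z : (Fin (m + 1) → ℝ) × ℝ, bias μ s (Finset.range (k + 1)) (cell u) z.1 z.2 *
        bias μ s (Finset.range (k + 1)) (cell v) z.1 z.2 ∂((Measure.pi fun _ => μ).prod μ) := by
  have hB0 : 0 ≤ B := (abs_nonneg _).trans (hB 0)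
  unfold condCov deviation
  simp_rw [integral_affine_mul_affine hν hν0 hσ]
  have hw : ∀ (w : Fin k → ℝ) (i : Fin (m + 1)), Measurable fun z : (Fin (m + 1) → ℝ) × ℝ =>
      weight (Finset.range (k + 1)) (cell w) z.1 z.2 i := fun w i =>
    measurable_weight_cell measurable_const measurable_fst measurable_snd i
  have hb : ∀ w : Fin k → ℝ, Measurable fun z : (Fin (m + 1) → ℝ) × ℝ =>
      bias μ s (Finset.range (k + 1)) (cell w) z.1 z.2 := fun w =>
    measurable_bias_cell measurable_const measurable_fst measurable_snd hs
  have i1 : Integrable (fun z : (Fin (m + 1) → ℝ) × ℝ => ∑ i,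
      weight (Finset.range (k + 1)) (cell u) z.1 z.2 i *
        weight (Finset.range (k + 1)) (cell v) z.1 z.2 i) ((Measure.pi fun _ => μ).prod μ) :=
    integrable_finsetSum _ fun i _ => integrable_of_abs_le ((hw u i).mul (hw v i)) fun z => by
      rw [abs_mul]
      exact mul_le_mul (abs_weight_le _ _ _ _ _) (abs_weight_le _ _ _ _ _) (abs_nonneg _)
        (Nat.cast_nonneg _)
  have i2 : Integrable (fun z : (Fin (m + 1) → ℝ) × ℝ =>
      bias μ s (Finset.range (k + 1)) (cell u) z.1 z.2 *
        bias μ s (Finset.range (k + 1)) (cell v) z.1 z.2) ((Measure.pi fun _ => μ).prod μ) :=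
    integrable_of_abs_le ((hb u).mul (hb v)) fun z => by
      rw [abs_mul]
      exact mul_le_mul (abs_bias_le hB _ _ _ _) (abs_bias_le hB _ _ _ _) (abs_nonneg _)
        (by positivity)
  rw [integral_add (i1.const_mul _) i2, integral_const_mul,
    integral_sum_weight_mul_weight μ _ _ (measurableSet_cell u) (measurableSet_cell v), noiseCov]

/-- Weighting `crossInv_le` by the ratio of the cell probabilities makes both terms multiples of
`overlapProb`, with the normalized moments of `invSq_le` as factors. The row and column sums of
`overlapProb` are at most 1, so the errors remain single sums over cells. -/
theorem noiseCov_le [IsProbabilityMeasure μ] {u v : Fin k → ℝ}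
    (hu : ∀ i, u i ∈ Icc (0 : ℝ) 1) (hv : ∀ i, v i ∈ Icc (0 : ℝ) 1) :
    ((m : ℝ) + 1) * noiseCov m μ u v ≤
      ∑ j ∈ Finset.range (k + 1), ∑ l ∈ Finset.range (k + 1), overlapProb μ u v j l +
      (∑ j ∈ Finset.range (k + 1), 4 / (1 + ((m : ℝ) + 1) * μ.real (cell u j)) +
       ∑ l ∈ Finset.range (k + 1), 4 / (1 + ((m : ℝ) + 1) * μ.real (cell v l))) / 2 := by
  set h : (Fin k → ℝ) → ℕ → ℝ := fun w j => 4 / (1 + ((m : ℝ) + 1) * μ.real (cell w j)) with hh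
  have hh0 : ∀ w j, 0 ≤ h w j := fun w j => by simp only [hh]; positivity
  have hpt : ∀ j l, ((m : ℝ) + 1) * (((m : ℝ) + 1) * μ.real (cell u j ∩ cell v l) ^ 2 *
      crossInv μ m (cell u j) (cell v l)) ≤ overlapProb μ u v j l +
        (overlapProb μ u v j l * h u j + overlapProb μ u v j l * h v l) / 2 := by
    intro j l
    have h0 := overlapProb_nonneg μ u v j l
    have hA := measurableSet_cell u j
    have hB := measurableSet_cell v l
    have hle1 : μ.real (cell u j ∩ cell v l) ≤ μ.real (cell u j) :=
      measureReal_mono inter_subset_left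
    have hle2 : μ.real (cell u j ∩ cell v l) ≤ μ.real (cell v l) :=
      measureReal_mono inter_subset_right
    have hz : 0 ≤ overlapProb μ u v j l +
        (overlapProb μ u v j l * h u j + overlapProb μ u v j l * h v l) / 2 := by
      have := mul_nonneg h0 (hh0 u j)
      have := mul_nonneg h0 (hh0 v l)
      linarith
    have hr0 : 0 ≤ μ.real (cell u j ∩ cell v l) := measureReal_nonneg
    -- The ratio used as weight must be positive, so cells of probability zero are treated apart;
    -- there the left side is zero.
    rcases (measureReal_nonneg (μ := μ) (s := cell u j)).eq_or_lt with hp | hp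
    · have : μ.real (cell u j ∩ cell v l) = 0 := by linarith
      rw [this]
      simpa using hz
    rcases (measureReal_nonneg (μ := μ) (s := cell v l)).eq_or_lt with hq | hq
    · have : μ.real (cell u j ∩ cell v l) = 0 := by linarith
      rw [this]
      simpa using hz
    have hI := crossInv_le (m := m) μ hA hB (div_pos hp hq)
    have hIA := invSq_le μ hA m
    have hIB := invSq_le μ hB m
    have h0' : 0 ≤ ((m : ℝ) + 1) * (((m : ℝ) + 1) * μ.real (cell u j ∩ cell v l) ^ 2) := by
      positivity
    have key := mul_le_mul_of_nonneg_left hI h0'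
    have e : ((m : ℝ) + 1) * (((m : ℝ) + 1) * μ.real (cell u j ∩ cell v l) ^ 2) *
        ((μ.real (cell u j) / μ.real (cell v l) * invSq μ m (cell u j) +
          (μ.real (cell u j) / μ.real (cell v l))⁻¹ * invSq μ m (cell v l)) / 2) =
        overlapProb μ u v j l * ((((m : ℝ) + 1) * μ.real (cell u j)) ^ 2 * invSq μ m (cell u j)) / 2
        + overlapProb μ u v j l *
          ((((m : ℝ) + 1) * μ.real (cell v l)) ^ 2 * invSq μ m (cell v l)) / 2 := by
      unfold overlapProb
      field_simp
    rw [e] at key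
    have k1 := mul_le_mul_of_nonneg_left hIA h0
    have k2 := mul_le_mul_of_nonneg_left hIB h0
    simp only [hh]
    linarith
  rw [noiseCov, Finset.mul_sum]
  simp_rw [Finset.mul_sum]
  refine (Finset.sum_le_sum fun j _ => Finset.sum_le_sum fun l _ => hpt j l).trans ?_
  simp only [Finset.sum_add_distrib, ← Finset.sum_div]
  have h1 := sum_sum_overlapProb_mul_le (u := u) μ hv (hh0 u)
  have h2 := sum_sum_overlapProb_mul_le' (v := v) μ hu (hh0 v)
  linarith

/-- Distinct cells of one partition are disjoint, so only the diagonal remains, and each diagonal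
term is within 4 / (1 + t) of 1, where t = (m + 1) times the probability of the cell. -/
theorem abs_noiseCov_self_sub_le [IsProbabilityMeasure μ] {u : Fin k → ℝ}
    (hu : ∀ i, u i ∈ Icc (0 : ℝ) 1) :
    |((m : ℝ) + 1) * noiseCov m μ u u - ((k : ℝ) + 1)| ≤
      ∑ j ∈ Finset.range (k + 1), 4 / (1 + ((m : ℝ) + 1) * μ.real (cell u j)) := by
  have e : ((m : ℝ) + 1) * noiseCov m μ u u - ((k : ℝ) + 1) = ∑ j ∈ Finset.range (k + 1),
      ((((m : ℝ) + 1) * μ.real (cell u j)) ^ 2 * invSq μ m (cell u j) - 1) := by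
    rw [Finset.sum_sub_distrib, noiseCov, Finset.mul_sum]
    congr 1
    · refine Finset.sum_congr rfl fun j hj => ?_
      rw [Finset.sum_eq_single_of_mem j hj, inter_self, crossInv_self]
      · ring
      · intro l _ hl
        rw [(disjoint_cell hu hl.symm).inter_eq]
        simp
    · simp
  rw [e]
  refine (Finset.abs_sum_le_sum_abs _ _).trans (Finset.sum_le_sum fun j _ => ?_)
  rw [abs_le]
  have h1 := invSq_le μ (measurableSet_cell u j) m
  have h2 := le_invSq μ (measurableSet_cell u j) m
  constructor <;> linarith

theorem sum_hits_bound_le {u : Fin k → ℝ} (hu : ∀ i, u i ∈ Icc (0 : ℝ) 1) {c : ℝ} (hc : 0 ≤ c)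
    (hμ : ∀ j, c * cellLength u j ≤ μ.real (cell u j)) :
    ∑ j ∈ Finset.range (k + 1), 4 / (1 + ((m : ℝ) + 1) * μ.real (cell u j)) ≤
      smallCells (((m : ℝ) + 1) * c) u := by
  refine Finset.sum_le_sum fun j _ => ?_
  have := cellLength_nonneg hu j
  rw [mul_assoc]
  gcongr
  exact hμ j

/-- The oscillation of `s` on a cell is at most `C` times its length, and the squared lengths sum to
at most the total length 1. After multiplication by the sample size, the Lipschitz part is thus
bounded uniformly in `k`. -/
theorem integral_bias_cell_sq_le [IsProbabilityMeasure μ] (hs : Measurable s)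
    (hB : ∀ a, |s a| ≤ B) {C : ℝ≥0} (hC : LipschitzWith C s) {u : Fin k → ℝ}
    (hu : ∀ i, u i ∈ Icc (0 : ℝ) 1) {c : ℝ} (hc : 0 ≤ c)
    (hμ : ∀ j, c * cellLength u j ≤ μ.real (cell u j)) :
    ((m : ℝ) + 1) * ∫ z : (Fin (m + 1) → ℝ) × ℝ,
      bias μ s (Finset.range (k + 1)) (cell u) z.1 z.2 ^ 2 ∂((Measure.pi fun _ => μ).prod μ) ≤
      B ^ 2 * smallCells (((m : ℝ) + 1) * c) u + 5 * (C : ℝ) ^ 2 := by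
  have h := integral_bias_sq_le (m := m) μ hs hB (Finset.range (k + 1)) (measurableSet_cell u)
    (disjoint_cell hu) (d := fun j => C * cellLength u j) fun j a ha b hb => by
      refine (hC.dist_le_mul a b).trans ?_
      gcongr
      rw [Real.dist_eq, abs_le, cellLength]
      constructor <;> linarith [ha.1, ha.2, hb.1, hb.2]
  refine h.trans ?_
  have h1 : ∑ j ∈ Finset.range (k + 1), ((C : ℝ) * cellLength u j) ^ 2 ≤ (C : ℝ) ^ 2 := by
    calc _ ≤ ∑ j ∈ Finset.range (k + 1), (C : ℝ) ^ 2 * cellLength u j := by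
          refine Finset.sum_le_sum fun j _ => ?_
          rw [mul_pow]
          gcongr
          have h0 := cellLength_nonneg hu j
          have h1 := cellLength_le_one hu j
          nlinarith
      _ = (C : ℝ) ^ 2 := by rw [← Finset.mul_sum, sum_cellLength, mul_one]
  have h2 := sum_hits_bound_le (m := m) hu hc hμ
  have h3 := mul_le_mul_of_nonneg_left h2 (sq_nonneg B)
  linarith

theorem condCov_le [IsProbabilityMeasure μ] [IsProbabilityMeasure ν] (hν : MemLp id 2 ν)
    (hν0 : ∫ e, e ∂ν = 0) {σ2 : ℝ} (hσ : ∫ e, e ^ 2 ∂ν = σ2) (hs : Measurable s)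
    (hB : ∀ a, |s a| ≤ B) {C : ℝ≥0} (hC : LipschitzWith C s) {u v : Fin k → ℝ}
    (hu : ∀ i, u i ∈ Icc (0 : ℝ) 1) (hv : ∀ i, v i ∈ Icc (0 : ℝ) 1) {c : ℝ} (hc : 0 ≤ c)
    (hμ : ∀ w : Fin k → ℝ, (∀ i, w i ∈ Icc (0 : ℝ) 1) → ∀ j,
      c * cellLength w j ≤ μ.real (cell w j)) :
    ((m : ℝ) + 1) * condCov (m + 1) μ ν s u v ≤
      σ2 * ∑ j ∈ Finset.range (k + 1), ∑ l ∈ Finset.range (k + 1), overlapProb μ u v j l +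
      (σ2 + B ^ 2) * ((smallCells (((m : ℝ) + 1) * c) u + smallCells (((m : ℝ) + 1) * c) v) / 2) +
        5 * (C : ℝ) ^ 2 := by
  have hB0 : 0 ≤ B := (abs_nonneg _).trans (hB 0)
  have hσ0 : 0 ≤ σ2 := hσ ▸ integral_nonneg fun e => sq_nonneg e
  have h1 := integral_bias_cell_sq_le (m := m) hs hB hC hu hc (hμ u hu)
  have h2 := integral_bias_cell_sq_le (m := m) hs hB hC hv hc (hμ v hv)
  have h3 := noiseCov_le (m := m) (μ := μ) hu hv
  have h4 := sum_hits_bound_le (m := m) hu hc (hμ u hu)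
  have h5 := sum_hits_bound_le (m := m) hv hc (hμ v hv)
  have hb : ∀ w : Fin k → ℝ, Integrable (fun z : (Fin (m + 1) → ℝ) × ℝ =>
      bias μ s (Finset.range (k + 1)) (cell w) z.1 z.2 ^ 2)
      ((Measure.pi fun _ => μ).prod μ) := fun w =>
    integrable_of_abs_le (c := (((Finset.range (k + 1)).card : ℝ) * (2 * B)) ^ 2)
      ((measurable_bias_cell measurable_const measurable_fst measurable_snd hs).pow_const 2)
      fun z => by
        rw [abs_pow]
        gcongr
        exact abs_bias_le hB _ _ _ _
  have h6 : ∫ z : (Fin (m + 1) → ℝ) × ℝ, bias μ s (Finset.range (k + 1)) (cell u) z.1 z.2 *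
        bias μ s (Finset.range (k + 1)) (cell v) z.1 z.2 ∂((Measure.pi fun _ => μ).prod μ) ≤
      (∫ z : (Fin (m + 1) → ℝ) × ℝ, bias μ s (Finset.range (k + 1)) (cell u) z.1 z.2 ^ 2
        ∂((Measure.pi fun _ => μ).prod μ) + ∫ z : (Fin (m + 1) → ℝ) × ℝ,
        bias μ s (Finset.range (k + 1)) (cell v) z.1 z.2 ^ 2
          ∂((Measure.pi fun _ => μ).prod μ)) / 2 := by
    rw [← integral_add (hb u) (hb v), ← integral_div]
    refine integral_mono (integrable_of_abs_le
      (c := (((Finset.range (k + 1)).card : ℝ) * (2 * B)) *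
        (((Finset.range (k + 1)).card : ℝ) * (2 * B)))
      ((measurable_bias_cell measurable_const measurable_fst measurable_snd hs).mul
        (measurable_bias_cell measurable_const measurable_fst measurable_snd hs)) fun z => ?_)
      (((hb u).add (hb v)).div_const 2) fun z => ?_
    · rw [abs_mul]
      exact mul_le_mul (abs_bias_le hB _ _ _ _) (abs_bias_le hB _ _ _ _) (abs_nonneg _)
        (by positivity)
    · simp only [Pi.add_apply]
      linarith [two_mul_le_add_sq (bias μ s (Finset.range (k + 1)) (cell u) z.1 z.2)
        (bias μ s (Finset.range (k + 1)) (cell v) z.1 z.2)]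
  rw [condCov_eq hν hν0 hσ hs hB]
  have hm : 0 ≤ (m : ℝ) + 1 := by positivity
  have k1 := mul_le_mul_of_nonneg_left h6 hm
  have k2 := mul_le_mul_of_nonneg_left h3 hσ0
  have k3 := mul_le_mul_of_nonneg_left (add_le_add h4 h5) hσ0
  nlinarith

theorem abs_condCov_self_sub_le [IsProbabilityMeasure μ] [IsProbabilityMeasure ν]
    (hν : MemLp id 2 ν)
    (hν0 : ∫ e, e ∂ν = 0) {σ2 : ℝ} (hσ : ∫ e, e ^ 2 ∂ν = σ2) (hs : Measurable s)
    (hB : ∀ a, |s a| ≤ B) {C : ℝ≥0} (hC : LipschitzWith C s) {u : Fin k → ℝ}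
    (hu : ∀ i, u i ∈ Icc (0 : ℝ) 1) {c : ℝ} (hc : 0 ≤ c)
    (hμ : ∀ j, c * cellLength u j ≤ μ.real (cell u j)) :
    |((m : ℝ) + 1) * condCov (m + 1) μ ν s u u - σ2 * ((k : ℝ) + 1)| ≤
      (σ2 + B ^ 2) * smallCells (((m : ℝ) + 1) * c) u + 5 * (C : ℝ) ^ 2 := by
  have hσ0 : 0 ≤ σ2 := hσ ▸ integral_nonneg fun e => sq_nonneg e
  have h1 := integral_bias_cell_sq_le (m := m) hs hB hC hu hc hμ
  have h3 := abs_noiseCov_self_sub_le (m := m) (μ := μ) hu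
  have h4 := sum_hits_bound_le (m := m) hu hc hμ
  rw [condCov_eq hν hν0 hσ hs hB]
  simp_rw [← pow_two]
  set R := ∫ z : (Fin (m + 1) → ℝ) × ℝ, bias μ s (Finset.range (k + 1)) (cell u) z.1 z.2 ^ 2
        ∂((Measure.pi fun _ => μ).prod μ)
  have hR : 0 ≤ ((m : ℝ) + 1) * R :=
    mul_nonneg (by positivity) (integral_nonneg fun z => sq_nonneg _)
  have e : ((m : ℝ) + 1) * (σ2 * noiseCov m μ u u + R) - σ2 * ((k : ℝ) + 1) =
      σ2 * (((m : ℝ) + 1) * noiseCov m μ u u - ((k : ℝ) + 1)) + ((m : ℝ) + 1) * R := by ring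
  rw [e]
  refine (abs_add_le _ _).trans ?_
  rw [abs_mul, abs_of_nonneg hσ0, abs_of_nonneg hR]
  have k1 := mul_le_mul_of_nonneg_left (h3.trans h4) hσ0
  linarith

end Conditional

/-! ### From the model to integrals over product measures -/

section Transfer

theorem measurePreserving_sum_prod {ι ι' : Type*} [Fintype ι] [Fintype ι']
    (m : ι → Measure ℝ) (m' : ι' → Measure ℝ) [∀ i, IsProbabilityMeasure (m i)]
    [∀ i, IsProbabilityMeasure (m' i)] :
    MeasurePreserving (fun x : ι ⊕ ι' → ℝ => (fun i => x (.inl i), fun i => x (.inr i)))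
      (Measure.pi (Sum.elim m m')) ((Measure.pi m).prod (Measure.pi m')) := by
  have : ∀ i, IsProbabilityMeasure (Sum.elim m m' i) := by
    rintro (i | i)
    · exact inferInstanceAs (IsProbabilityMeasure (m i))
    · exact inferInstanceAs (IsProbabilityMeasure (m' i))
  exact measurePreserving_sumPiEquivProdPi (Sum.elim m m')

theorem measurePreserving_unit (m : Measure ℝ) [IsProbabilityMeasure m] :
    MeasurePreserving (fun x : Unit → ℝ => x ()) (Measure.pi fun _ => m) m :=
  measurePreserving_eval (fun _ : Unit => m) ()

variable {Ω : Type*} [MeasurableSpace Ω] {P : Measure Ω} [IsProbabilityMeasure P]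
  {dens : ℝ → ℝ} {ν : Measure ℝ} [IsProbabilityMeasure ν] {n k q : ℕ}
  [IsProbabilityMeasure (designLaw dens)]

/-- The joint law of the design points, the errors and of some of the uniform variables. -/
theorem Model.map_blocks (M : Model P dens ν n k q) {K : Type*} [Fintype K] (g : K → Fin q × Fin k)
    (hg : Function.Injective g) :
    P.map (fun ω => (((fun i => M.X (some i) ω, M.X none ω), fun i => M.ε (some i) ω),
      fun j => M.U (g j).1 (g j).2 ω)) =
    (((Measure.pi fun _ : Fin n => designLaw dens).prod (designLaw dens)).prod
      (Measure.pi fun _ : Fin n => ν)).prod (Measure.pi fun _ : K => unif) := by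
  -- The required variables are selected by an injection into the index set of the independent
  -- family, in the nested order of the product on the right. The error of the generic observation
  -- is left out.
  let idx : ((Fin n ⊕ Unit) ⊕ Fin n) ⊕ K → Option (Fin n) ⊕ (Option (Fin n) ⊕ Fin q × Fin k) :=
    Sum.elim (Sum.elim (Sum.elim (fun i => .inl (some i)) fun _ => .inl none)
      fun i => .inr (.inl (some i))) fun j => .inr (.inr (g j))
  have hidx : Function.Injective idx := by
    rintro (((i | i) | i) | i) (((j | j) | j) | j) h <;> simp [idx] at h ⊢
    · exact h
    · exact h
    · exact hg h
  let m : ((Fin n ⊕ Unit) ⊕ Fin n) ⊕ K → Measure ℝ :=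
    Sum.elim (Sum.elim (Sum.elim (fun _ => designLaw dens) fun _ => designLaw dens)
      fun _ => ν) fun _ => unif
  have hind := M.indep.precomp hidx
  set f := Sum.elim M.X (Sum.elim M.ε fun p : Fin q × Fin k => M.U p.1 p.2) with hf
  have hfm : ∀ i, Measurable (f i) := by
    rintro (i | i | i)
    · exact M.measurable_X i
    · exact M.measurable_ε i
    · exact M.measurable_U i.1 i.2
  have hmap : P.map (fun ω i => f (idx i) ω) = Measure.pi m := by
    rw [(iIndepFun_iff_map_fun_eq_pi_map fun i => (hfm (idx i)).aemeasurable).mp hind]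
    congr 1
    ext1 i
    rcases i with ((i | i) | i) | i
    · exact M.law_X (some i)
    · exact M.law_X none
    · exact M.law_ε (some i)
    · exact M.law_U (g i).1 (g i).2
  have i1 : ∀ i, IsProbabilityMeasure (Sum.elim (fun _ : Fin n => designLaw dens)
      (fun _ : Unit => designLaw dens) i) := by
    rintro (i | i)
    · exact inferInstanceAs (IsProbabilityMeasure (designLaw dens))
    · exact inferInstanceAs (IsProbabilityMeasure (designLaw dens))
  have i2 : ∀ i, IsProbabilityMeasure (Sum.elim (Sum.elim (fun _ : Fin n => designLaw dens)
      (fun _ : Unit => designLaw dens)) (fun _ : Fin n => ν) i) := by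
    rintro (i | i)
    · exact i1 i
    · exact inferInstanceAs (IsProbabilityMeasure ν)
  have T1 := measurePreserving_sum_prod (fun _ : Fin n => designLaw dens)
    (fun _ : Unit => designLaw dens)
  have T1' := ((MeasurePreserving.id (Measure.pi fun _ : Fin n => designLaw dens)).prod
    (measurePreserving_unit (designLaw dens))).comp T1
  have T2 := (T1'.prod (MeasurePreserving.id (Measure.pi fun _ : Fin n => ν))).comp
    (measurePreserving_sum_prod (Sum.elim (fun _ : Fin n => designLaw dens)
    (fun _ : Unit => designLaw dens)) (fun _ : Fin n => ν))
  have T3 := (T2.prod (MeasurePreserving.id (Measure.pi fun _ : K => unif))).comp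
    (measurePreserving_sum_prod (Sum.elim (Sum.elim (fun _ : Fin n => designLaw dens)
    (fun _ : Unit => designLaw dens)) (fun _ : Fin n => ν)) (fun _ : K => unif))
  rw [← T3.map_eq, show Measure.pi (Sum.elim (Sum.elim (Sum.elim (fun _ : Fin n => designLaw dens)
    (fun _ : Unit => designLaw dens)) (fun _ : Fin n => ν)) (fun _ : K => unif)) =
    P.map (fun ω i => f (idx i) ω) from hmap.symm,
    Measure.map_map T3.measurable (measurable_pi_iff.mpr fun i => hfm (idx i))]
  rfl

theorem Model.ae_X_mem (M : Model P dens ν n k q) :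
    ∀ᵐ ω ∂P, ∀ i, M.X i ω ∈ Icc (0 : ℝ) 1 := by
  rw [ae_all_iff]
  intro i
  have h : ∀ᵐ x ∂(designLaw dens), x ∈ Icc (0 : ℝ) 1 :=
    (withDensity_absolutelyContinuous _ _).ae_le (ae_restrict_mem measurableSet_Icc)
  have h2 : ∀ᵐ x ∂(P.map (M.X i)), x ∈ Icc (0 : ℝ) 1 := by rw [M.law_X i]; exact h
  exact ae_of_ae_map (M.measurable_X i).aemeasurable h2

/-- The error is centered and independent of the design point, so it does not contribute to the
conditional mean. -/
theorem Model.cellMean_eq (M : Model P dens ν n k q) (hν : MemLp id 2 ν) (hν0 : ∫ e, e ∂ν = 0)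
    {s : ℝ → ℝ} {B : ℝ} (hs : Measurable s) (hB : ∀ a, |s a| ≤ B) {A : Set ℝ}
    (hA : MeasurableSet A) :
    cellMean P (M.X none) (M.Y s none) A = meanOn (designLaw dens) s A := by
  have hXm := M.measurable_X none
  have hεm := M.measurable_ε none
  have hS : MeasurableSet (M.X none ⁻¹' A) := hXm hA
  have hP : P.real (M.X none ⁻¹' A) = (designLaw dens).real A := by
    rw [← map_measureReal_apply hXm hA, M.law_X none]
  have hεi : Integrable (M.ε none) P := by
    have : Integrable id (P.map (M.ε none)) := by
      rw [M.law_ε none]; exact hν.integrable one_le_two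
    exact this.comp_measurable hεm
  have hε0 : ∫ ω, M.ε none ω ∂P = 0 := by
    have h := integral_map (μ := P) hεm.aemeasurable (f := fun e : ℝ => e) (by fun_prop)
    rw [M.law_ε none, hν0] at h
    exact h.symm
  have hind : IndepFun (M.X none) (M.ε none) P := by
    have := M.indep.indepFun (i := .inl none) (j := .inr (.inl none)) (by simp)
    exact this
  have h1 : ∫ ω in M.X none ⁻¹' A, M.ε none ω ∂P = 0 := by
    have hi2 : IndepFun (fun ω => A.indicator (fun _ => (1 : ℝ)) (M.X none ω)) (M.ε none) P :=
      hind.comp (measurable_const.indicator hA) measurable_id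
    have := hi2.integral_fun_mul_eq_mul_integral
      ((measurable_const.indicator hA).comp hXm).aestronglyMeasurable hεm.aestronglyMeasurable
    rw [hε0, mul_zero] at this
    rw [← this, ← integral_indicator hS]
    congr 1
    ext ω
    by_cases h : M.X none ω ∈ A
    · simp [indicator, h]
    · simp [indicator, h]
  have h2 : ∫ ω in M.X none ⁻¹' A, s (M.X none ω) ∂P = ∫ a in A, s a ∂(designLaw dens) := by
    rw [show designLaw dens = P.map (M.X none) from (M.law_X none).symm,
      setIntegral_map hA hs.aestronglyMeasurable hXm.aemeasurable]
  have hsi : Integrable (fun ω => s (M.X none ω)) P :=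
    integrable_of_abs_le (hs.comp hXm) fun ω => hB _
  unfold cellMean Model.Y ProbabilityTheory.cond
  -- No case distinction is needed: if the cell has probability zero, both sides are 0 by the
  -- conventions for inverses.
  rw [integral_smul_measure, integral_add hsi.integrableOn hεi.integrableOn, h1, h2, add_zero,
    meanOn, ← hP, ENNReal.toReal_inv, smul_eq_mul, div_eq_inv_mul]
  rfl

/-- The extension of a function on `[0,1]` by its boundary values. -/
noncomputable def extendUnit (s : ℝ → ℝ) : ℝ → ℝ := fun x => s (projIcc (0 : ℝ) 1 zero_le_one x)

theorem extendUnit_eq (s : ℝ → ℝ) {x : ℝ} (hx : x ∈ Icc (0 : ℝ) 1) : extendUnit s x = s x := by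
  rw [extendUnit, projIcc_of_mem zero_le_one hx]

theorem lipschitzWith_extendUnit {s : ℝ → ℝ} {C : ℝ≥0} (hs : LipschitzOnWith C s (Icc 0 1)) :
    LipschitzWith C (extendUnit s) := by
  refine LipschitzWith.of_dist_le_mul fun x y => ?_
  refine (hs.dist_le_mul _ (projIcc 0 1 zero_le_one x).2 _ (projIcc 0 1 zero_le_one y).2).trans ?_
  gcongr
  exact (LipschitzWith.projIcc (zero_le_one (α := ℝ))).dist_le_mul x y |>.trans (by simp)

theorem abs_extendUnit_le {s : ℝ → ℝ} {C : ℝ≥0} (hs : LipschitzOnWith C s (Icc 0 1)) (x : ℝ) :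
    |extendUnit s x| ≤ |s 0| + C := by
  have h1 := hs.dist_le_mul _ (projIcc 0 1 zero_le_one x).2 0 (by simp)
  have h2 : dist ((projIcc (0 : ℝ) 1 zero_le_one x : Icc (0 : ℝ) 1) : ℝ) 0 ≤ 1 := by
    rw [Real.dist_eq, sub_zero, abs_of_nonneg (projIcc 0 1 zero_le_one x).2.1]
    exact (projIcc 0 1 zero_le_one x).2.2
  have h3 : |extendUnit s x - s 0| ≤ C := by
    refine le_trans h1 ?_
    exact mul_le_of_le_one_right C.2 h2
  have := abs_sub_abs_le_abs_sub (extendUnit s x) (s 0)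
  linarith

/-- The function `s` is controlled only on [0,1], which contains the design points almost surely.
Replacing it by `extendUnit s` gives a bounded and globally Lipschitz, hence measurable, function
without changing the deviation. -/
theorem Model.treeDev_ae_eq (M : Model P dens ν n k q) (hν : MemLp id 2 ν)
    (hν0 : ∫ e, e ∂ν = 0) {s : ℝ → ℝ} {C : ℝ≥0} (hs : LipschitzOnWith C s (Icc 0 1)) (l : Fin q) :
    M.treeDev s l =ᵐ[P] fun ω => deviation (designLaw dens) (extendUnit s)
      (fun i => M.X (some i) ω) (fun i => M.ε (some i) ω) (fun j => M.U l j ω) (M.X none ω) := by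
  have hmean : ∀ A, MeasurableSet A →
      cellMean P (M.X none) (M.Y s none) A = meanOn (designLaw dens) (extendUnit s) A := by
    intro A hA
    rw [← M.cellMean_eq hν hν0 (lipschitzWith_extendUnit hs).continuous.measurable
      (abs_extendUnit_le hs) hA]
    refine integral_congr_ae (cond_absolutelyContinuous.ae_le ?_)
    filter_upwards [M.ae_X_mem] with ω hω
    simp only [Model.Y, extendUnit_eq s (hω none)]
  filter_upwards [M.ae_X_mem] with ω hω
  rw [← treeEst_sub_eq_deviation, Model.treeDev, treeProj]
  congr 1
  · simp only [Model.Y, extendUnit_eq s (hω _)]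
  · simp_rw [hmean _ (measurableSet_cell _ _)]

theorem memLp_deviation {α : Type*} [MeasurableSpace α] {ρ : Measure α} [IsProbabilityMeasure ρ]
    {μ : Measure ℝ} [IsProbabilityMeasure μ] {s : ℝ → ℝ} {B : ℝ} {u : α → Fin k → ℝ}
    {x e : α → Fin n → ℝ} {t : α → ℝ} (hu : Measurable u) (hx : Measurable x)
    (he : Measurable e) (ht : Measurable t) (hs : Measurable s) (hB : ∀ a, |s a| ≤ B)
    (he2 : ∀ i, MemLp (fun a => e a i) 2 ρ) :
    MemLp (fun a => deviation μ s (x a) (e a) (u a) (t a)) 2 ρ := by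
  have hb : MemLp (fun a => ((k : ℝ) + 1) * (∑ i, |e a i| + 2 * B)) 2 ρ :=
    ((memLp_finsetSum _ fun i _ => (he2 i).abs).add (memLp_const _)).const_mul _
  refine hb.of_le (measurable_deviation hu hx he ht hs).aestronglyMeasurable (.of_forall fun a => ?_)
  rw [Real.norm_eq_abs]
  exact (abs_deviation_le hB _ _ _ _).trans (le_abs_self _)

theorem Model.memLp_ε (M : Model P dens ν n k q) (hν : MemLp id 2 ν) (i : Option (Fin n)) :
    MemLp (M.ε i) 2 P := by
  have : MemLp id 2 (P.map (M.ε i)) := by rw [M.law_ε i]; exact hν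
  exact this.comp_of_map (M.measurable_ε i).aemeasurable

theorem Model.memLp_treeDev (M : Model P dens ν n k q) (hν : MemLp id 2 ν)
    (hν0 : ∫ e, e ∂ν = 0) {s : ℝ → ℝ} {C : ℝ≥0} (hs : LipschitzOnWith C s (Icc 0 1)) (l : Fin q) :
    MemLp (M.treeDev s l) 2 P := by
  rw [memLp_congr_ae (M.treeDev_ae_eq hν hν0 hs l)]
  exact memLp_deviation (measurable_pi_iff.mpr fun j => M.measurable_U l j)
    (measurable_pi_iff.mpr fun i => M.measurable_X _)
    (measurable_pi_iff.mpr fun i => M.measurable_ε _) (M.measurable_X none)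
    (lipschitzWith_extendUnit hs).continuous.measurable (abs_extendUnit_le hs)
    fun i => M.memLp_ε hν (some i)

theorem Model.forestDev_eq (M : Model P dens ν n k q) (s : ℝ → ℝ) (ω : Ω) :
    M.forestDev s ω = (1 / (q : ℝ)) * ∑ l, M.treeDev s l ω := by
  simp only [Model.forestDev, forestEst, forestProj, Model.treeDev, Finset.sum_sub_distrib,
    mul_sub]

theorem Model.memLp_forestDev (M : Model P dens ν n k q) (hν : MemLp id 2 ν)
    (hν0 : ∫ e, e ∂ν = 0) {s : ℝ → ℝ} {C : ℝ≥0} (hs : LipschitzOnWith C s (Icc 0 1)) :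
    MemLp (M.forestDev s) 2 P := by
  have : M.forestDev s = fun ω => (1 / (q : ℝ)) * ∑ l, M.treeDev s l ω :=
    funext fun ω => M.forestDev_eq s ω
  rw [this]
  exact (memLp_finsetSum _ fun l _ => M.memLp_treeDev hν hν0 hs l).const_mul _

variable {s : ℝ → ℝ} {B : ℝ} {μ : Measure ℝ} [IsProbabilityMeasure μ]

/-- Fubini's theorem for the product of two deviations, with the partitions outside. -/
theorem integral_deviation_mul {β : Type*} [MeasurableSpace β] {ρ : Measure β}
    [IsProbabilityMeasure ρ] {u v : β → Fin k → ℝ} (hu : Measurable u) (hv : Measurable v)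
    (hs : Measurable s) (hB : ∀ a, |s a| ≤ B) (hν : MemLp id 2 ν) :
    Integrable (fun b => condCov n μ ν s (u b) (v b)) ρ ∧
    ∫ z : (((Fin n → ℝ) × ℝ) × (Fin n → ℝ)) × β,
      deviation μ s z.1.1.1 z.1.2 (u z.2) z.1.1.2 * deviation μ s z.1.1.1 z.1.2 (v z.2) z.1.1.2
      ∂((((Measure.pi fun _ => μ).prod μ).prod (Measure.pi fun _ => ν)).prod ρ) =
      ∫ b, condCov n μ ν s (u b) (v b) ∂ρ := by
  set base : Measure (((Fin n → ℝ) × ℝ) × (Fin n → ℝ)) :=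
    ((Measure.pi fun _ => μ).prod μ).prod (Measure.pi fun _ => ν) with hbase
  have he : ∀ i : Fin n, MemLp (fun z : ((Fin n → ℝ) × ℝ) × (Fin n → ℝ) => z.2 i) 2 base :=
    fun i => (memLp_eval hν i).comp_measurePreserving measurePreserving_snd
  have hL : ∀ w : β → Fin k → ℝ, Measurable w →
      MemLp (fun z : (((Fin n → ℝ) × ℝ) × (Fin n → ℝ)) × β =>
        deviation μ s z.1.1.1 z.1.2 (w z.2) z.1.1.2) 2 (base.prod ρ) := fun w hw =>
    memLp_deviation (hw.comp measurable_snd) measurable_fst.fst.fst measurable_fst.snd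
      measurable_fst.fst.snd hs hB fun i =>
        (he i).comp_measurePreserving measurePreserving_fst
  have hL' : ∀ w : Fin k → ℝ, MemLp (fun z : ((Fin n → ℝ) × ℝ) × (Fin n → ℝ) =>
      deviation μ s z.1.1 z.2 w z.1.2) 2 base := fun w =>
    memLp_deviation measurable_const measurable_fst.fst measurable_snd measurable_fst.snd hs hB he
  have hI : Integrable (fun z : (((Fin n → ℝ) × ℝ) × (Fin n → ℝ)) × β =>
      deviation μ s z.1.1.1 z.1.2 (u z.2) z.1.1.2 * deviation μ s z.1.1.1 z.1.2 (v z.2) z.1.1.2)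
      (base.prod ρ) := (hL u hu).integrable_mul (hL v hv)
  have e : ∀ b, ∫ y, deviation μ s y.1.1 y.2 (u b) y.1.2 * deviation μ s y.1.1 y.2 (v b) y.1.2
      ∂base = condCov n μ ν s (u b) (v b) := by
    intro b
    have hI' : Integrable (fun y : ((Fin n → ℝ) × ℝ) × (Fin n → ℝ) =>
        deviation μ s y.1.1 y.2 (u b) y.1.2 * deviation μ s y.1.1 y.2 (v b) y.1.2) base :=
      (hL' (u b)).integrable_mul (hL' (v b))
    rw [hbase, integral_prod _ hI', condCov]
  constructor
  · have := hI.integral_prod_right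
    simp only [e] at this
    exact this
  · rw [integral_prod_symm _ hI]
    simp only [e]

theorem Model.treeVar_eq (M : Model P dens ν n k q) (hν : MemLp id 2 ν)
    (hν0 : ∫ e, e ∂ν = 0) {s : ℝ → ℝ} {C : ℝ≥0} (hs : LipschitzOnWith C s (Icc 0 1)) (l : Fin q) :
    M.treeVar s l = ∫ u : Fin k → ℝ, condCov n (designLaw dens) ν (extendUnit s) u u
      ∂(Measure.pi fun _ => unif) := by
  have hsm := (lipschitzWith_extendUnit hs).continuous.measurable
  have hF := (integral_deviation_mul (n := n) (μ := designLaw dens) (ν := ν)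
    (ρ := Measure.pi fun _ : Fin k => unif) (u := fun u => u) (v := fun u => u) measurable_id
    measurable_id hsm (abs_extendUnit_le hs) hν).2
  rw [← hF,
    ← M.map_blocks (fun j : Fin k => (l, j)) fun a b h => by simpa using h, integral_map,
    Model.treeVar]
  · refine integral_congr_ae ?_
    filter_upwards [M.treeDev_ae_eq hν hν0 hs l] with ω hω
    rw [hω, pow_two]
  · exact ((((measurable_pi_iff.mpr fun i => M.measurable_X _).prodMk (M.measurable_X none)).prodMk
      (measurable_pi_iff.mpr fun i => M.measurable_ε _)).prodMk
      (measurable_pi_iff.mpr fun j => M.measurable_U _ _)).aemeasurable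
  · have h := measurable_deviation (μ := designLaw dens) (n := n) (k := k)
      (α := (((Fin n → ℝ) × ℝ) × (Fin n → ℝ)) × (Fin k → ℝ))
      (measurable_snd) measurable_fst.fst.fst measurable_fst.snd measurable_fst.fst.snd hsm
    exact (h.mul h).aestronglyMeasurable

/-- Distinct trees use disjoint blocks of uniform variables. The two blocks are indexed by the sum
type `Fin k ⊕ Fin k`, whose product measure splits into two independent partitions. -/
theorem Model.integral_treeDev_mul (M : Model P dens ν n k q) (hν : MemLp id 2 ν)
    (hν0 : ∫ e, e ∂ν = 0) {s : ℝ → ℝ} {C : ℝ≥0} (hs : LipschitzOnWith C s (Icc 0 1))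
    {l l' : Fin q} (hl : l ≠ l') :
    ∫ ω, M.treeDev s l ω * M.treeDev s l' ω ∂P =
      ∫ p : (Fin k → ℝ) × (Fin k → ℝ), condCov n (designLaw dens) ν (extendUnit s) p.1 p.2
      ∂((Measure.pi fun _ => unif).prod (Measure.pi fun _ => unif)) := by
  have hsm := (lipschitzWith_extendUnit hs).continuous.measurable
  have hinl : Measurable fun w : Fin k ⊕ Fin k → ℝ => fun j => w (.inl j) :=
    measurable_pi_iff.mpr fun j => measurable_pi_apply _
  have hinr : Measurable fun w : Fin k ⊕ Fin k → ℝ => fun j => w (.inr j) :=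
    measurable_pi_iff.mpr fun j => measurable_pi_apply _
  have hmp := measurePreserving_sum_prod (fun _ : Fin k => unif) (fun _ : Fin k => unif)
  have helim : (Sum.elim (fun _ : Fin k => unif) fun _ : Fin k => unif) = fun _ => unif := by
    ext1 i; rcases i with i | i <;> rfl
  rw [helim] at hmp
  have hcc := (integral_deviation_mul (n := n) (μ := designLaw dens) (ν := ν)
    (ρ := (Measure.pi fun _ : Fin k => unif).prod (Measure.pi fun _ : Fin k => unif))
    measurable_fst measurable_snd hsm (abs_extendUnit_le hs) hν).1
  have h2 : ∫ p : (Fin k → ℝ) × (Fin k → ℝ), condCov n (designLaw dens) ν (extendUnit s) p.1 p.2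
      ∂((Measure.pi fun _ => unif).prod (Measure.pi fun _ => unif)) =
      ∫ w : Fin k ⊕ Fin k → ℝ, condCov n (designLaw dens) ν (extendUnit s)
        (fun j => w (.inl j)) (fun j => w (.inr j)) ∂(Measure.pi fun _ => unif) := by
    rw [← hmp.map_eq, integral_map hmp.measurable.aemeasurable]
    rw [hmp.map_eq]
    exact hcc.aestronglyMeasurable
  rw [h2, ← (integral_deviation_mul hinl hinr hsm (abs_extendUnit_le hs) hν).2,
    ← M.map_blocks (Sum.elim (fun j : Fin k => (l, j)) (fun j : Fin k => (l', j))), integral_map]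
  · refine integral_congr_ae ?_
    filter_upwards [M.treeDev_ae_eq hν hν0 hs l, M.treeDev_ae_eq hν hν0 hs l'] with ω hω hω'
    rw [hω, hω']
    rfl
  · exact ((((measurable_pi_iff.mpr fun i => M.measurable_X _).prodMk (M.measurable_X none)).prodMk
      (measurable_pi_iff.mpr fun i => M.measurable_ε _)).prodMk
      (measurable_pi_iff.mpr fun j => M.measurable_U _ _)).aemeasurable
  · have h := fun (w : (Fin k ⊕ Fin k → ℝ) → Fin k → ℝ) (hw : Measurable w) =>
      measurable_deviation (μ := designLaw dens) (n := n) (k := k)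
      (α := (((Fin n → ℝ) × ℝ) × (Fin n → ℝ)) × (Fin k ⊕ Fin k → ℝ))
      (hw.comp measurable_snd) measurable_fst.fst.fst measurable_fst.snd measurable_fst.fst.snd hsm
    exact ((h _ hinl).mul (h _ hinr)).aestronglyMeasurable
  · rintro (i | i) (j | j) h <;> simp [hl, hl.symm] at h ⊢ <;> exact h

theorem Model.forestVar_eq (M : Model P dens ν n k q) (hν : MemLp id 2 ν)
    (hν0 : ∫ e, e ∂ν = 0) {s : ℝ → ℝ} {C : ℝ≥0} (hs : LipschitzOnWith C s (Icc 0 1)) :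
    M.forestVar s = (1 / (q : ℝ)) ^ 2 *
      (q * ∫ u : Fin k → ℝ, condCov n (designLaw dens) ν (extendUnit s) u u
        ∂(Measure.pi fun _ => unif) +
      q * ((q : ℝ) - 1) * ∫ p : (Fin k → ℝ) × (Fin k → ℝ),
        condCov n (designLaw dens) ν (extendUnit s) p.1 p.2
        ∂((Measure.pi fun _ => unif).prod (Measure.pi fun _ => unif))) := by
  have hint : ∀ l l' : Fin q, Integrable (fun ω => M.treeDev s l ω * M.treeDev s l' ω) P :=
    fun l l' => (M.memLp_treeDev hν hν0 hs l).integrable_mul (M.memLp_treeDev hν hν0 hs l')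
  have e : ∀ ω, M.forestDev s ω ^ 2 =
      (1 / (q : ℝ)) ^ 2 * ∑ l, ∑ l', M.treeDev s l ω * M.treeDev s l' ω := by
    intro ω
    rw [M.forestDev_eq, mul_pow, pow_two (∑ l, _), Finset.sum_mul_sum]
  unfold Model.forestVar
  simp_rw [e]
  rw [integral_const_mul, integral_finsetSum _ fun l _ => integrable_finsetSum _ fun l' _ =>
    hint l l']
  congr 1
  simp_rw [integral_finsetSum _ fun l' _ => hint _ l']
  set V := ∫ u : Fin k → ℝ, condCov n (designLaw dens) ν (extendUnit s) u u
        ∂(Measure.pi fun _ => unif)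
  set W := ∫ p : (Fin k → ℝ) × (Fin k → ℝ),
        condCov n (designLaw dens) ν (extendUnit s) p.1 p.2
        ∂((Measure.pi fun _ => unif).prod (Measure.pi fun _ => unif))
  -- All diagonal terms equal V and all off-diagonal ones W; writing them as W plus a diagonal
  -- correction makes the double sum immediate.
  have h : ∀ l l' : Fin q, ∫ ω, M.treeDev s l ω * M.treeDev s l' ω ∂P =
      W + if l = l' then V - W else 0 := by
    intro l l'
    split_ifs with hl
    · subst hl
      have := M.treeVar_eq hν hν0 hs l
      simp_rw [Model.treeVar, pow_two] at this
      rw [this]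
      ring
    · rw [M.integral_treeDev_mul hν hν0 hs hl, add_zero]
  simp_rw [h]
  simp [Finset.sum_add_distrib]
  ring

end Transfer

/-! ### Averaging over the partitions and asymptotic bounds -/

section Asymptotic

theorem isLittleO_of_eventually_abs_le {f b a : ℕ → ℝ} (ha : Tendsto a atTop (𝓝 0))
    (h : ∀ᶠ n in atTop, |f n| ≤ a n * |b n|) : f =o[atTop] b := by
  rw [isLittleO_iff]
  intro ε hε
  filter_upwards [h, ha.eventually_le_const hε] with n hn han
  rw [Real.norm_eq_abs, Real.norm_eq_abs]
  exact hn.trans (mul_le_mul_of_nonneg_right han (abs_nonneg _))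

theorem exists_uniform_modulus {dens : ℝ → ℝ} (hdens : ContinuousOn dens (Icc 0 1)) {ε : ℝ}
    (hε : 0 < ε) :
    ∃ δ > 0, ∀ x ∈ Icc (0 : ℝ) 1, ∀ y ∈ Icc (0 : ℝ) 1, |x - y| ≤ δ → |dens x - dens y| ≤ ε := by
  obtain ⟨δ, hδ, h⟩ := Metric.uniformContinuousOn_iff.mp
    (isCompact_Icc.uniformContinuousOn_of_continuous hdens) ε hε
  exact ⟨δ / 2, by positivity, fun x hx y hy hxy =>
    (h x hx y hy (by rw [Real.dist_eq]; linarith)).le⟩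

theorem exists_pos_le {dens : ℝ → ℝ} (hdens : ContinuousOn dens (Icc 0 1))
    (hpos : ∀ x ∈ Icc (0 : ℝ) 1, 0 < dens x) :
    ∃ c > 0, ∀ x ∈ Icc (0 : ℝ) 1, c ≤ dens x := by
  obtain ⟨x, hx, h⟩ := isCompact_Icc.exists_isMinOn (nonempty_Icc.mpr zero_le_one) hdens
  exact ⟨dens x, hpos x hx, fun y hy => h hy⟩

variable {k : ℕ → ℕ}

/-- The expected contribution of the small cells is negligible compared to `k`. -/
theorem tendsto_integral_smallCells_div (hk : Tendsto k atTop atTop)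
    (hkn : Tendsto (fun n => (k n : ℝ) / (n : ℝ)) atTop (𝓝 0)) {c : ℝ} (hc : 0 < c) :
    Tendsto (fun n => (∫ u : Fin (k n) → ℝ, smallCells ((n : ℝ) * c) u
      ∂(Measure.pi fun _ => unif)) / (k n : ℝ)) atTop (𝓝 0) := by
  have hk' : Tendsto (fun n => (k n : ℝ)) atTop atTop := tendsto_natCast_atTop_atTop.comp hk
  have hsqrt : Tendsto (fun n => √((k n : ℝ) / (n : ℝ))) atTop (𝓝 0) := by
    have := (Real.continuous_sqrt.tendsto 0).comp hkn
    rwa [Real.sqrt_zero] at this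
  have hlim : Tendsto (fun n => 8 / (k n : ℝ) + 8 / c * √((k n : ℝ) / (n : ℝ)) +
      8 * √((k n : ℝ) / (n : ℝ))) atTop (𝓝 0) := by
    have := ((hk'.const_div_atTop 8).add (hsqrt.const_mul (8 / c))).add (hsqrt.const_mul 8)
    simpa using this
  refine squeeze_zero' (.of_forall fun n => ?_) ?_ hlim
  · refine div_nonneg (integral_nonneg_of_ae ?_) (Nat.cast_nonneg _)
    filter_upwards [ae_pi_mem (k n)] with u hu
    exact smallCells_nonneg (by positivity) hu
  filter_upwards [hk.eventually_ge_atTop 1, eventually_ge_atTop 1] with n hkn1 hn1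
  have hn0 : (0 : ℝ) < n := by exact_mod_cast hn1
  have hk0 : (0 : ℝ) < k n := by exact_mod_cast hkn1
  have hk1 : (1 : ℝ) ≤ k n := by exact_mod_cast hkn1
  set r := (k n : ℝ) / (n : ℝ) with hr
  have hr0 : 0 < r := by positivity
  have hs0 : 0 < √r := Real.sqrt_pos.mpr hr0
  have hsr : √r * √r = r := Real.mul_self_sqrt hr0.le
  obtain ⟨m, hm⟩ : ∃ m, k n = m + 1 := ⟨k n - 1, by omega⟩
  -- With r = k/n, the threshold √r/k is short compared with the typical length 1/k, so close pairs
  -- number O(k√r) in mean. It is long compared with 1/n, so a cell above it contributes O(√r).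
  have hb := integral_smallCells_le m (c := (n : ℝ) * c) (δ := √r / (k n : ℝ)) (by positivity)
    (by positivity)
  rw [hm] at hk0 hk1 ⊢
  push_cast at hk0 hk1 hb ⊢
  rw [hm] at hb
  push_cast at hb
  rw [div_le_iff₀ hk0]
  refine hb.trans ?_
  have e1 : (n : ℝ) * c * (√r / ((m : ℝ) + 1)) = c / √r := by
    have : (m : ℝ) + 1 = √r * √r * n := by rw [hsr, hr, hm]; push_cast; field_simp
    rw [this]
    field_simp
  have e2 : 4 / (1 + c / √r) ≤ 4 / c * √r := by
    calc 4 / (1 + c / √r) ≤ 4 / (c / √r) := by gcongr; linarith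
      _ = 4 / c * √r := by field_simp
  rw [e1]
  have e3 : ((m : ℝ) + 2) * (4 / (1 + c / √r)) ≤ (2 * ((m : ℝ) + 1)) * (4 / c * √r) := by
    gcongr
    linarith
  have e4 : 8 * ((m : ℝ) + 1) ^ 2 * (√r / ((m : ℝ) + 1)) = 8 * √r * ((m : ℝ) + 1) := by
    field_simp
  rw [e4]
  have e5 : (8 / ((m : ℝ) + 1) + 8 / c * √r + 8 * √r) * ((m : ℝ) + 1) =
      8 + 8 / c * √r * ((m : ℝ) + 1) + 8 * √r * ((m : ℝ) + 1) := by
    field_simp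
  rw [e5]
  have e6 : (2 * ((m : ℝ) + 1)) * (4 / c * √r) = 8 / c * √r * ((m : ℝ) + 1) := by ring
  linarith

variable {dens s : ℝ → ℝ} {ν : Measure ℝ} [IsProbabilityMeasure ν]
  [IsProbabilityMeasure (designLaw dens)] {B : ℝ} {C : ℝ≥0} {c σ2 : ℝ}

theorem mul_cellLength_le_designLaw {k : ℕ} (hc : 0 ≤ c)
    (hdc : ∀ x ∈ Icc (0 : ℝ) 1, c ≤ dens x) {u : Fin k → ℝ} (hu : ∀ i, u i ∈ Icc (0 : ℝ) 1)
    (j : ℕ) : c * cellLength u j ≤ (designLaw dens).real (cell u j) := by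
  rw [← volume_real_cell hu]
  exact le_designLaw (measurableSet_cell u j) (cell_subset hu j) hc
    fun x hx => hdc x (cell_subset hu j hx)

theorem abs_integral_condCov_self_sub_le (k m : ℕ) (hν : MemLp id 2 ν)
    (hν0 : ∫ e, e ∂ν = 0) (hσ : ∫ e, e ^ 2 ∂ν = σ2) (hB : ∀ a, |s a| ≤ B)
    (hC : LipschitzWith C s) (hc : 0 ≤ c) (hdc : ∀ x ∈ Icc (0 : ℝ) 1, c ≤ dens x) :
    |((m : ℝ) + 1) * ∫ u : Fin k → ℝ, condCov (m + 1) (designLaw dens) ν s u u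
        ∂(Measure.pi fun _ => unif) - σ2 * ((k : ℝ) + 1)| ≤
      (σ2 + B ^ 2) * ∫ u : Fin k → ℝ, smallCells (((m : ℝ) + 1) * c) u
        ∂(Measure.pi fun _ => unif) + 5 * (C : ℝ) ^ 2 := by
  have hsm := hC.continuous.measurable
  have hi := (integral_deviation_mul (n := m + 1) (μ := designLaw dens) (ν := ν)
    (ρ := Measure.pi fun _ : Fin k => unif) (u := fun u => u) (v := fun u => u) measurable_id
    measurable_id hsm hB hν).1
  have hS := integrable_smallCells k (c := ((m : ℝ) + 1) * c) (by positivity)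
  have e : ((m : ℝ) + 1) * ∫ u : Fin k → ℝ, condCov (m + 1) (designLaw dens) ν s u u
        ∂(Measure.pi fun _ => unif) - σ2 * ((k : ℝ) + 1) =
      ∫ u : Fin k → ℝ, (((m : ℝ) + 1) * condCov (m + 1) (designLaw dens) ν s u u -
        σ2 * ((k : ℝ) + 1)) ∂(Measure.pi fun _ => unif) := by
    rw [integral_sub (hi.const_mul _) (integrable_const _), integral_const_mul]
    simp
  have e2 : (σ2 + B ^ 2) * ∫ u : Fin k → ℝ, smallCells (((m : ℝ) + 1) * c) u
        ∂(Measure.pi fun _ => unif) + 5 * (C : ℝ) ^ 2 =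
      ∫ u : Fin k → ℝ, ((σ2 + B ^ 2) * smallCells (((m : ℝ) + 1) * c) u + 5 * (C : ℝ) ^ 2)
        ∂(Measure.pi fun _ => unif) := by
    rw [integral_add (hS.const_mul _) (integrable_const _), integral_const_mul]
    simp
  rw [e, e2, ← Real.norm_eq_abs]
  refine norm_integral_le_of_norm_le ((hS.const_mul _).add (integrable_const _)) ?_
  filter_upwards [ae_pi_mem k] with u hu
  exact abs_condCov_self_sub_le hν hν0 hσ hsm hB hC hu hc (mul_cellLength_le_designLaw hc hdc hu)

theorem integral_condCov_le (k m : ℕ) (hk : 2 ≤ k) (hν : MemLp id 2 ν)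
    (hν0 : ∫ e, e ∂ν = 0) (hσ : ∫ e, e ^ 2 ∂ν = σ2) (hB : ∀ a, |s a| ≤ B)
    (hC : LipschitzWith C s) (hc : 0 < c) (hdc : ∀ x ∈ Icc (0 : ℝ) 1, c ≤ dens x) {θ δ : ℝ}
    (hθ : 0 < θ) (hθ2 : θ ≤ 1 / 2) (hδ0 : 0 < δ)
    (hδ : ∀ x ∈ Icc (0 : ℝ) 1, ∀ y ∈ Icc (0 : ℝ) 1, |x - y| ≤ δ → |dens x - dens y| ≤ θ * c) :
    ((m : ℝ) + 1) * ∫ p : (Fin k → ℝ) × (Fin k → ℝ),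
        condCov (m + 1) (designLaw dens) ν s p.1 p.2
        ∂((Measure.pi fun _ => unif).prod (Measure.pi fun _ => unif)) ≤
      σ2 * ((1 + 16 * θ) * (3 / 4 * k) + 2 * (2 + 1 / δ)) +
      (σ2 + B ^ 2) * ∫ u : Fin k → ℝ, smallCells (((m : ℝ) + 1) * c) u
        ∂(Measure.pi fun _ => unif) + 5 * (C : ℝ) ^ 2 := by
  -- The profile isolates both endpoints of a gap, hence the writing of the number of points as `m +
  -- 2` there.
  obtain ⟨k, rfl⟩ : ∃ k', k = k' + 2 := ⟨k - 2, by omega⟩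
  have hσ0 : 0 ≤ σ2 := hσ ▸ integral_nonneg fun e => sq_nonneg e
  have hsm := hC.continuous.measurable
  set Λ : Measure (Fin (k + 2) → ℝ) := Measure.pi fun _ => unif with hΛ
  have hi := (integral_deviation_mul (n := m + 1) (μ := designLaw dens) (ν := ν)
    (ρ := Λ.prod Λ) measurable_fst measurable_snd hsm hB hν).1
  have hS : Integrable (fun u => smallCells (((m : ℝ) + 1) * c) u) Λ :=
    integrable_smallCells (k + 2) (c := ((m : ℝ) + 1) * c) (by positivity)
  have hS1 : Integrable (fun p : (Fin (k + 2) → ℝ) × (Fin (k + 2) → ℝ) =>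
      smallCells (((m : ℝ) + 1) * c) p.1) (Λ.prod Λ) := hS.comp_fst Λ
  have hS2 : Integrable (fun p : (Fin (k + 2) → ℝ) × (Fin (k + 2) → ℝ) =>
      smallCells (((m : ℝ) + 1) * c) p.2) (Λ.prod Λ) := hS.comp_snd Λ
  have hO : Integrable (fun p : (Fin (k + 2) → ℝ) × (Fin (k + 2) → ℝ) =>
      interiorOverlap p.1 p.2) (Λ.prod Λ) := (integral_interiorOverlap_le k).1
  have hO2 := (integral_interiorOverlap_le k).2
  rw [← hΛ] at hO2
  have e1 : ∫ p : (Fin (k + 2) → ℝ) × (Fin (k + 2) → ℝ),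
      smallCells (((m : ℝ) + 1) * c) p.1 ∂(Λ.prod Λ) =
      ∫ u, smallCells (((m : ℝ) + 1) * c) u ∂Λ := by
    rw [integral_fun_fst (f := fun u => smallCells (((m : ℝ) + 1) * c) u)]; simp
  have e2 : ∫ p : (Fin (k + 2) → ℝ) × (Fin (k + 2) → ℝ),
      smallCells (((m : ℝ) + 1) * c) p.2 ∂(Λ.prod Λ) =
      ∫ u, smallCells (((m : ℝ) + 1) * c) u ∂Λ := by
    rw [integral_fun_snd (f := fun u => smallCells (((m : ℝ) + 1) * c) u)]; simp
  have j1 : Integrable (fun p : (Fin (k + 2) → ℝ) × (Fin (k + 2) → ℝ) =>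
      σ2 * ((1 + 16 * θ) * interiorOverlap p.1 p.2 + 2 * (2 + 1 / δ))) (Λ.prod Λ) :=
    ((hO.const_mul _).fun_add (integrable_const _)).const_mul _
  have j2 : Integrable (fun p : (Fin (k + 2) → ℝ) × (Fin (k + 2) → ℝ) =>
      (σ2 + B ^ 2) * ((smallCells (((m : ℝ) + 1) * c) p.1 +
        smallCells (((m : ℝ) + 1) * c) p.2) / 2)) (Λ.prod Λ) :=
    ((hS1.fun_add hS2).div_const 2).const_mul _
  calc _ = ∫ p : (Fin (k + 2) → ℝ) × (Fin (k + 2) → ℝ),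
        ((m : ℝ) + 1) * condCov (m + 1) (designLaw dens) ν s p.1 p.2 ∂(Λ.prod Λ) :=
        (integral_const_mul _ _).symm
    _ ≤ ∫ p : (Fin (k + 2) → ℝ) × (Fin (k + 2) → ℝ),
        (σ2 * ((1 + 16 * θ) * interiorOverlap p.1 p.2 + 2 * (2 + 1 / δ)) +
        (σ2 + B ^ 2) * ((smallCells (((m : ℝ) + 1) * c) p.1 +
          smallCells (((m : ℝ) + 1) * c) p.2) / 2) + 5 * (C : ℝ) ^ 2) ∂(Λ.prod Λ) := by
        refine integral_mono_ae (hi.const_mul _)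
          ((j1.fun_add j2).add (integrable_const _)) ?_
        have h := ae_pi_mem (k + 2)
        filter_upwards [Measure.quasiMeasurePreserving_fst.ae h,
          Measure.quasiMeasurePreserving_snd.ae h] with p hp1 hp2
        have h1 := condCov_le (m := m) (μ := designLaw dens) hν hν0 hσ hsm hB hC hp1 hp2 hc.le
          fun w hw => mul_cellLength_le_designLaw hc.le hdc hw
        have h2 := sum_overlapProb_le_interiorOverlap hp1 hp2 hc hθ hθ2 hdc hδ0 hδ
        have h3 := mul_le_mul_of_nonneg_left h2 hσ0
        linarith
    _ = σ2 * ((1 + 16 * θ) * ∫ p : (Fin (k + 2) → ℝ) × (Fin (k + 2) → ℝ),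
          interiorOverlap p.1 p.2 ∂(Λ.prod Λ) + 2 * (2 + 1 / δ)) +
        (σ2 + B ^ 2) * ∫ u, smallCells (((m : ℝ) + 1) * c) u ∂Λ + 5 * (C : ℝ) ^ 2 := by
        rw [integral_add (j1.fun_add j2) (integrable_const _), integral_add j1 j2,
          integral_const_mul, integral_const_mul, integral_div, integral_add hS1 hS2, e1, e2,
          integral_add (hO.const_mul _) (integrable_const _), integral_const_mul]
        simp
    _ ≤ _ := by
        push_cast
        gcongr

end Asymptotic

end PURF

/-! ### Assembly of the asymptotic statements -/

theorem mainTheorem2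
    (s dens : ℝ → ℝ) (C : ℝ≥0) (σ : ℝ) (ν : Measure ℝ) [IsProbabilityMeasure ν]
    (hs : LipschitzOnWith C s (Icc 0 1))
    (hdens : ContinuousOn dens (Icc 0 1))
    (hdens_pos : ∀ x ∈ Icc (0 : ℝ) 1, 0 < dens x)
    (hν : MemLp id 2 ν) (hν_mean : ∫ e, e ∂ν = 0) (hν_var : variance id ν = σ ^ 2)
    (k q : ℕ → ℕ)
    (hk : Tendsto k atTop atTop)
    (hkn : Tendsto (fun n => (k n : ℝ) / (n : ℝ)) atTop (𝓝 0))
    (hq : Tendsto q atTop atTop)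
    {Ω : ℕ → Type*} [∀ n, MeasurableSpace (Ω n)]
    (P : ∀ n, Measure (Ω n)) [∀ n, IsProbabilityMeasure (P n)]
    (M : ∀ n, PURF.Model (P n) dens ν n (k n) (q n)) :
    ((∀ n, Integrable (fun ω => ((M n).forestDev s ω) ^ 2) (P n)) ∧
      ∃ f : ℕ → ℝ, f =o[atTop] (fun n => (k n : ℝ) / (n : ℝ)) ∧
        ∀ n, (M n).forestVar s ≤ 3 / 4 * (σ ^ 2 * ((k n : ℝ) + 1) / (n : ℝ)) + f n) ∧
    ((∀ n l, Integrable (fun ω => ((M n).treeDev s l ω) ^ 2) (P n)) ∧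
      ∃ g : ℕ → ℝ, g =o[atTop] (fun n => (k n : ℝ) / (n : ℝ)) ∧
        ∀ n l, (M n).treeVar s l = σ ^ 2 * ((k n : ℝ) + 1) / (n : ℝ) + g n) := by
  open PURF in
  have hprob : IsProbabilityMeasure (designLaw dens) := by
    have h := Measure.isProbabilityMeasure_map ((M 0).measurable_X none).aemeasurable (μ := P 0)
    rwa [(M 0).law_X none] at h
  obtain ⟨c, hc, hdc⟩ := exists_pos_le hdens hdens_pos
  have hσ : ∫ e, e ^ 2 ∂ν = σ ^ 2 := by
    rw [← hν_var, variance_of_integral_eq_zero aemeasurable_id hν_mean]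
    rfl
  have hC := lipschitzWith_extendUnit hs
  have hB := abs_extendUnit_le hs
  set B : ℝ := |s 0| + C with hBdef
  set H : ℕ → ℝ := fun n => ∫ u : Fin (k n) → ℝ, smallCells ((n : ℝ) * c) u
    ∂(Measure.pi fun _ => unif) with hH
  set V : ℕ → ℝ := fun n => ∫ u : Fin (k n) → ℝ,
    condCov n (designLaw dens) ν (extendUnit s) u u ∂(Measure.pi fun _ => unif) with hV
  set W : ℕ → ℝ := fun n => ∫ p : (Fin (k n) → ℝ) × (Fin (k n) → ℝ),
    condCov n (designLaw dens) ν (extendUnit s) p.1 p.2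
      ∂((Measure.pi fun _ => unif).prod (Measure.pi fun _ => unif)) with hW
  have hk' : Tendsto (fun n => (k n : ℝ)) atTop atTop := tendsto_natCast_atTop_atTop.comp hk
  have hq' : Tendsto (fun n => (q n : ℝ)) atTop atTop := tendsto_natCast_atTop_atTop.comp hq
  have hHk : Tendsto (fun n => H n / (k n : ℝ)) atTop (𝓝 0) :=
    tendsto_integral_smallCells_div hk hkn hc
  have hH0 : ∀ n, 0 ≤ H n := fun n => by
    refine integral_nonneg_of_ae ?_
    filter_upwards [ae_pi_mem (k n)] with u hu
    exact smallCells_nonneg (by positivity) hu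
  -- the relative error of the variance of a tree
  set a : ℕ → ℝ := fun n => (σ ^ 2 + B ^ 2) * (H n / k n) + 5 * (C : ℝ) ^ 2 / k n with ha
  have ha0 : Tendsto a atTop (𝓝 0) := by
    have := (hHk.const_mul (σ ^ 2 + B ^ 2)).add (hk'.const_div_atTop (5 * (C : ℝ) ^ 2))
    simpa using this
  have hVle : ∀ n, 1 ≤ n → 1 ≤ k n → |(n : ℝ) * V n - σ ^ 2 * ((k n : ℝ) + 1)| ≤ a n * k n := by
    intro n hn hkn1
    obtain ⟨m, rfl⟩ : ∃ m, n = m + 1 := ⟨n - 1, by omega⟩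
    have hk0 : (0 : ℝ) < k (m + 1) := by exact_mod_cast hkn1
    have h := abs_integral_condCov_self_sub_le (k (m + 1)) m hν hν_mean hσ hB hC hc.le hdc
    have e : a (m + 1) * k (m + 1) = (σ ^ 2 + B ^ 2) * H (m + 1) + 5 * (C : ℝ) ^ 2 := by
      simp only [ha]; field_simp
    rw [e]
    simp only [hV, hH]
    push_cast
    exact h
  -- The forest is bounded from above only, so its error is the positive part of the excess; the
  -- inequality then holds for every `n`, including `n = 0`. The error of the tree is an exact
  -- difference formed with `V n`, which does not involve `l`.
  refine ⟨⟨fun n => ((M n).memLp_forestDev hν hν_mean hs).integrable_sq,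
    fun n => max 0 ((M n).forestVar s - 3 / 4 * (σ ^ 2 * ((k n : ℝ) + 1) / (n : ℝ))), ?_,
    fun n => ?_⟩, fun n l => ((M n).memLp_treeDev hν hν_mean hs l).integrable_sq,
    fun n => V n - σ ^ 2 * ((k n : ℝ) + 1) / (n : ℝ), ?_, fun n l => ?_⟩
  · rw [isLittleO_iff]
    intro ε hε
    -- The relative density error 16 θ times 3/4 gives 12 θ. Since `δ`, and with it the constant 1 /
    -- δ, depends on `θ`, the tolerance `ε` is fixed before `n` tends to infinity.
    obtain ⟨θ, hθ, hθ2, hθε⟩ : ∃ θ : ℝ, 0 < θ ∧ θ ≤ 1 / 2 ∧ 12 * θ * σ ^ 2 < ε := by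
      refine ⟨min (1 / 2) (ε / (12 * σ ^ 2 + 1)), by positivity, min_le_left _ _, ?_⟩
      have h1 : min (1 / 2) (ε / (12 * σ ^ 2 + 1)) ≤ ε / (12 * σ ^ 2 + 1) := min_le_right _ _
      have h2 : ε / (12 * σ ^ 2 + 1) * (12 * σ ^ 2 + 1) = ε := by field_simp
      have h3 : 0 < ε / (12 * σ ^ 2 + 1) := by positivity
      nlinarith [sq_nonneg σ]
    obtain ⟨δ, hδ0, hδ⟩ := exists_uniform_modulus hdens (mul_pos hθ hc)
    have hlim : Tendsto (fun n => (2 * σ ^ 2 + a n) / q n + 12 * θ * σ ^ 2 +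
        σ ^ 2 * (2 * (2 + 1 / δ)) / k n + a n) atTop (𝓝 (12 * θ * σ ^ 2)) := by
      have h1 : Tendsto (fun n => (2 * σ ^ 2 + a n) / q n) atTop (𝓝 0) :=
        (tendsto_const_nhds.add ha0).div_atTop hq'
      have := ((h1.add_const (12 * θ * σ ^ 2)).add
        (hk'.const_div_atTop (σ ^ 2 * (2 * (2 + 1 / δ))))).add ha0
      simpa using this
    filter_upwards [hlim.eventually_le_const hθε, eventually_ge_atTop 1,
      hk.eventually_ge_atTop 2, hq.eventually_ge_atTop 1] with n hle hn1 hk2 hq1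
    have hn0 : (0 : ℝ) < n := by exact_mod_cast hn1
    have hk0 : (0 : ℝ) < k n := by exact_mod_cast (by omega : 0 < k n)
    have hk1 : (1 : ℝ) ≤ k n := by exact_mod_cast (by omega : 1 ≤ k n)
    have hq0 : (0 : ℝ) < q n := by exact_mod_cast hq1
    have hqq : (1 : ℝ) ≤ q n := by exact_mod_cast hq1
    rw [Real.norm_eq_abs, abs_of_nonneg (le_max_left _ _), Real.norm_eq_abs,
      abs_of_nonneg (by positivity)]
    refine max_le (by positivity) ?_
    have hVn := (abs_le.mp (hVle n hn1 (by omega))).2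
    have hWn : (n : ℝ) * W n ≤ σ ^ 2 * ((1 + 16 * θ) * (3 / 4 * k n) + 2 * (2 + 1 / δ)) +
        a n * k n := by
      obtain ⟨m, rfl⟩ : ∃ m, n = m + 1 := ⟨n - 1, by omega⟩
      have h := integral_condCov_le (k (m + 1)) m hk2 hν hν_mean hσ hB hC hc hdc hθ hθ2 hδ0 hδ
      have e : a (m + 1) * k (m + 1) = (σ ^ 2 + B ^ 2) * H (m + 1) + 5 * (C : ℝ) ^ 2 := by
        simp only [ha]; field_simp
      rw [e, ← add_assoc]
      simp only [hW, hH]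
      push_cast
      exact h
    set X := σ ^ 2 * ((1 + 16 * θ) * (3 / 4 * k n) + 2 * (2 + 1 / δ)) + a n * k n with hX
    have han : 0 ≤ a n := by
      have := hH0 n
      simp only [ha]
      positivity
    have hX0 : 0 ≤ X := by positivity
    -- The factor 1 - 1/q in front of W may be dropped only because the upper bound `X` is
    -- nonnegative; the sign of W itself plays no role.
    have hF : (n : ℝ) * (M n).forestVar s ≤ (n * V n) / q n + X := by
      have e : (n : ℝ) * (M n).forestVar s = (n * V n) / q n + (1 - 1 / q n) * (n * W n) := by
        rw [(M n).forestVar_eq hν hν_mean hs]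
        simp only [hV, hW]
        field_simp
      rw [e]
      have h1 : 0 ≤ 1 - 1 / (q n : ℝ) := by
        rw [sub_nonneg, div_le_one hq0]; exact hqq
      have h2 : 1 - 1 / (q n : ℝ) ≤ 1 := by
        have : 0 ≤ 1 / (q n : ℝ) := by positivity
        linarith
      have h3 := mul_le_mul_of_nonneg_left hWn h1
      have h4 := mul_le_mul_of_nonneg_right h2 hX0
      linarith
    have hVq : (n * V n) / q n ≤ k n * ((2 * σ ^ 2 + a n) / q n) := by
      rw [← mul_div_assoc]
      refine div_le_div_of_nonneg_right ?_ hq0.le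
      linarith [mul_le_mul_of_nonneg_left hk1 (sq_nonneg σ)]
    have hfin : (n : ℝ) * ((M n).forestVar s - 3 / 4 * (σ ^ 2 * ((k n : ℝ) + 1) / (n : ℝ))) ≤
        k n * ε := by
      have e1 : (n : ℝ) * ((M n).forestVar s - 3 / 4 * (σ ^ 2 * ((k n : ℝ) + 1) / (n : ℝ))) =
          n * (M n).forestVar s - 3 / 4 * (σ ^ 2 * ((k n : ℝ) + 1)) := by field_simp
      have e2 : (k n : ℝ) * ((2 * σ ^ 2 + a n) / q n + 12 * θ * σ ^ 2 +
          σ ^ 2 * (2 * (2 + 1 / δ)) / k n + a n) = k n * ((2 * σ ^ 2 + a n) / q n) +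
          12 * θ * σ ^ 2 * k n + σ ^ 2 * (2 * (2 + 1 / δ)) + a n * k n := by
        field_simp
      have e3 := mul_le_mul_of_nonneg_left hle hk0.le
      rw [e2] at e3
      rw [e1]
      have e4 : X = 3 / 4 * (σ ^ 2 * k n) + 12 * θ * σ ^ 2 * k n + σ ^ 2 * (2 * (2 + 1 / δ)) +
          a n * k n := by rw [hX]; ring
      rw [e4] at hF
      linarith [sq_nonneg σ]
    have hdiv : ε * ((k n : ℝ) / n) = k n * ε / n := by ring
    rw [hdiv, le_div_iff₀ hn0, mul_comm]
    exact hfin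
  · linarith [le_max_right 0
      ((M n).forestVar s - 3 / 4 * (σ ^ 2 * ((k n : ℝ) + 1) / (n : ℝ)))]
  · refine isLittleO_of_eventually_abs_le ha0 ?_
    filter_upwards [eventually_ge_atTop 1, hk.eventually_ge_atTop 1] with n hn1 hk1
    have hn0 : (0 : ℝ) < n := by exact_mod_cast hn1
    have h := hVle n hn1 hk1
    have e : V n - σ ^ 2 * ((k n : ℝ) + 1) / n = (n * V n - σ ^ 2 * ((k n : ℝ) + 1)) / n := by
      field_simp
    rw [e, abs_div, abs_of_pos hn0, abs_of_nonneg (by positivity : 0 ≤ (k n : ℝ) / n),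
      ← mul_div_assoc]
    gcongr
  · rw [(M n).treeVar_eq hν hν_mean hs l]
    ring
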